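/- **Theorem (genus $0$ open Virasoro constraints).** Let $N\ge 1$. Let $M$ be either a simply connected (non-empty) open subset of $\mathbb C^N$, with $\mathcal O(M)$ the ring of analytic functions on $M$, or the formal neighbourhood of a point $t_{\rm orig}\in\mathbb C^N$, with $\mathcal O(M)=\mathbb C[[t^1-t^1_{\rm orig},\dots,t^N-t^N_{\rm orig}]]$. Let $U\subset\mathbb C$ be a simply connected (non-empty) open set; if $M$ is formal, $U$ may also be the formal neighbourhood of a point. Correspondingly, $\mathcal O(M\times U)$ is the ring of analytic functions on $M\times U$, the ring $\mathcal O(U)[[t-t_{\rm orig}]]$, or the ring $\mathbb C[[t-t_{\rm orig},s-s_{\rm orig}]]$. Repeated Greek indices are summed from $1$ to $N$ unless another range is stated. *Conformal Frobenius manifold.* Let $\eta=(\eta_{\alpha\beta})$ be a symmetric non-degenerate complex $N\times N$ matrix, $(\eta^{\alpha\beta})=\eta^{-1}$, and let $F\in\mathcal O(M)$ satisfy, for all indices, $$\tfrac{\partial^3F}{\partial t^\alpha\partial t^\beta\partial t^\mu}\eta^{\mu\nu}\tfrac{\partial^3F}{\partial t^\nu\partial t^\gamma\partial t^\delta}=\tfrac{\partial^3F}{\partial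 t^\delta\partial t^\beta\partial t^\mu}\eta^{\mu\nu}\tfrac{\partial^3F}{\partial t^\nu\partial t^\gamma\partial t^\alpha},\qquad \tfrac{\partial^3F}{\partial t^1\partial t^\alpha\partial t^\beta}=\eta_{\alpha\beta}.$$ Let $E^\gamma=(1-q^\gamma)t^\gamma+r^\gamma$ with $q^\gamma,r^\gamma\in\mathbb C$, $q^1=0$, and suppose that $E^\gamma\frac{\partial F}{\partial t^\gamma}=(3-\delta)F+\frac12A_{\alpha\beta}t^\alpha t^\beta+B_\alpha t^\alpha+C$ for some $\delta,A_{\alpha\beta},B_\alpha,C\in\mathbb C$. Put $\mu^\alpha=q^\alpha-\frac\delta2$, $\mu=\mathrm{diag}(\mu^1,\dots,\mu^N)$, $c^\alpha_{\beta\gamma}=\eta^{\alpha\mu}\frac{\partial^3F}{\partial t^\mu\partial t^\beta\partial t^\gamma}$. *Calibration.* Let $\Omega^{\alpha,0}_{\beta,d}\in\mathcal O(M)$ ($1\le\alpha,\beta\le N$, $d\ge-1$) satisfy $\Omega^{\alpha,0}_{\beta,-1}=\delta^\alpha_\beta$; $\frac{\partial\Omega^{\alpha,0}_{\beta,d}}{\partial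 t^\gamma}=c^\alpha_{\gamma\mu}\Omega^{\mu,0}_{\beta,d-1}$ for $d\ge0$; $\sum_{p+q=d,\ p,q\ge-1}(-1)^{p+1}\Omega^{\alpha,0}_{\mu,p}\eta^{\mu\nu}\Omega^{\beta,0}_{\nu,q}=0$ for $d\ge-1$; and $$E^\theta\tfrac{\partial}{\partial t^\theta}\Omega^{\alpha,0}_{\beta,d}=(d+1+\mu^\beta-\mu^\alpha)\Omega^{\alpha,0}_{\beta,d}+\sum_{i=1}^{d+1}\Omega^{\alpha,0}_{\mu,d-i}(R_i)^\mu_\beta,\quad d\ge-1,$$ for complex matrices $R_n$, $n\ge1$, with $[\mu,R_n]=nR_n$, $\eta R_n\eta^{-1}=(-1)^{n-1}R_n^T$. Let $R=\sum_{n\ge1}R_n$ (a finite sum). *Open potential.* Write $s=t^{N+1}$. Let $F^o\in\mathcal O(M\times U)$ satisfy the open WDVV equations: for $1\le\alpha,\beta,\gamma\le N$ $$\tfrac{\partial^3F}{\partial t^\alpha\partial t^\beta\partial t^\mu}\eta^{\mu\nu}\tfrac{\partial^2F^o}{\partial t^\nu\partial t^\gamma}+\tfrac{\partial^2F^o}{\partial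 t^\alpha\partial t^\beta}\tfrac{\partial^2F^o}{\partial s\partial t^\gamma}=\tfrac{\partial^3F}{\partial t^\gamma\partial t^\beta\partial t^\mu}\eta^{\mu\nu}\tfrac{\partial^2F^o}{\partial t^\nu\partial t^\alpha}+\tfrac{\partial^2F^o}{\partial t^\gamma\partial t^\beta}\tfrac{\partial^2F^o}{\partial s\partial t^\alpha},$$ $$\tfrac{\partial^3F}{\partial t^\alpha\partial t^\beta\partial t^\mu}\eta^{\mu\nu}\tfrac{\partial^2F^o}{\partial t^\nu\partial s}+\tfrac{\partial^2F^o}{\partial t^\alpha\partial t^\beta}\tfrac{\partial^2F^o}{\partial s^2}=\tfrac{\partial^2F^o}{\partial s\partial t^\beta}\tfrac{\partial^2F^o}{\partial s\partial t^\alpha};$$ the unit condition $\frac{\partial^2F^o}{\partial t^1\partial t^\alpha}=0$ ($1\le\alpha\le N$), $\frac{\partial^2F^o}{\partial t^1\partial s}=1$; and the homogeneity condition $$E^\gamma\tfrac{\partial F^o}{\partial t^\gamma}+E^{N+1}\tfrac{\partial F^o}{\partial s}=\tfrac{3-\delta}2F^o+D_\alpha t^\alpha+\widetilde Ds+C',\qquad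 E^{N+1}=\tfrac{1-\delta}2s+r^{N+1},$$ for some $r^{N+1},D_\alpha,\widetilde D,C'\in\mathbb C$. Put $\mu^{N+1}=\frac12$, $\widetilde\mu=\mathrm{diag}(\mu^1,\dots,\mu^{N+1})$ and $\Omega^{\alpha,0}_{N+1,d}=0$ for $1\le\alpha\le N$. Let $F^o$ carry a calibration: functions $\Phi_{\beta,d}\in\mathcal O(M\times U)$, $1\le\beta\le N+1$, $d\ge-1$, with $\Phi_{\beta,-1}=\delta_{\beta,N+1}$, $$\tfrac{\partial\Phi_{\beta,d}}{\partial t^\gamma}=\sum_{\mu\le N}\tfrac{\partial^2F^o}{\partial t^\gamma\partial t^\mu}\Omega^{\mu,0}_{\beta,d-1}+\tfrac{\partial^2F^o}{\partial t^\gamma\partial s}\Phi_{\beta,d-1}\quad(d\ge0,\ 1\le\gamma\le N+1),$$ $$\sum_{\mu\le N+1}E^\mu\tfrac{\partial\Phi_{\beta,d}}{\partial t^\mu}=\left(d+\tfrac12+\mu^\beta\right)\Phi_{\beta,d}+\sum_{i=1}^{d+1}\sum_{\mu\le N+1}\Phi_{\mu,d-i}(\widetilde R_i)^\mu_\beta\quad(d\ge-1),$$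 for complex $(N+1)\times(N+1)$ matrices $\widetilde R_n$, $n\ge1$, whose upper left $N\times N$ block is $R_n$, whose last column is zero, and which satisfy $[\widetilde\mu,\widetilde R_n]=n\widetilde R_n$. Let $\widetilde R=\sum_{n\ge1}\widetilde R_n$ (a finite sum). *Descendent potentials.* The functions $\Omega^{\alpha,0}_{1,0}-t^\alpha$ and $\Phi_{1,0}-t^{N+1}$ are constants; shift the coordinates so that $\Omega^{\alpha,0}_{1,0}=t^\alpha$ and $\Phi_{1,0}=t^{N+1}$. Let $t^\alpha_d$, $d\ge1$, be formal variables, $t^\alpha_0=t^\alpha$, $s_d=t^{N+1}_d$, $x=t^1_0$, and $\widetilde t^\alpha_d:=t^\alpha_d-\delta^{\alpha,1}\delta_{d,1}$. Let $v^\alpha\in\mathcal O(M)[[t^{\le N}_{\ge1}]]$, $1\le\alpha\le N$, solve $$\tfrac{\partial v^\alpha}{\partial t^\beta_d}=\partial_x\left(\Omega^{\alpha,0}_{\beta,d}\big|_{t=v}\right)\ (1\le\beta\le N,\ d\ge0),\qquad v^\alpha\big|_{t^*_{\ge1}=0}=t^\alpha_0,$$ and let $w^\alpha\in\mathcal O(M\times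 U)[[t^{\le N+1}_{\ge1}]]$, $1\le\alpha\le N+1$, solve $$\tfrac{\partial w^\alpha}{\partial t^\beta_d}=\partial_x\left(\Omega^{\alpha,0}_{\beta,d}\big|_{t=w}\right)\ (\alpha\le N),\quad \tfrac{\partial w^{N+1}}{\partial t^\beta_d}=\partial_x\left(\Phi_{\beta,d}\big|_{t=w}\right)\ (1\le\beta\le N+1,\ d\ge0),\qquad w^\alpha\big|_{t^*_{\ge1}=0}=t^\alpha_0 .$$ Each of these solutions exists and is unique. Put $\Omega_{\alpha,p;\beta,q}=\sum_{i=0}^q(-1)^{q-i}\Omega^{\mu,0}_{\alpha,p+q-i}\eta_{\mu\nu}\Omega^{\nu,0}_{\beta,i-1}$ and $$\mathcal F=\tfrac12\sum_{p,q\ge0}\widetilde t^\alpha_p\,\widetilde t^\beta_q\,\Omega_{\alpha,p;\beta,q}\big|_{t=v},\qquad \mathcal F^o=\sum_{d\ge0}\sum_{\alpha\le N+1}\widetilde t^\alpha_d\,\Phi_{\alpha,d}\big|_{t=w}.$$ *Operators.* For square matrices $A,R$ of equal size put $P_{-1}(A,R)=\mathrm{Id}$, $P_{m+1}(A,R)=RP_m(A,R)+P_m(A,R)(A+m+\frac12)$,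 and let $([A]_p)^\alpha_\beta$ be $A^\alpha_\beta$ if $\mu^\alpha-\mu^\beta=p$ and $0$ otherwise. For $m\ge-1$ put $$\begin{aligned}L_m=&\tfrac{\varepsilon^{-2}}2\sum_{d_1,d_2\ge0}(-1)^{d_1}\left([P_m(\mu+d_2+1,R)]_{m+d_1+d_2+1}\right)^\mu_\beta\eta_{\alpha\mu}\widetilde t^\alpha_{d_1}\widetilde t^\beta_{d_2}+\sum_{d\ge0,\,0\le k\le m+d}\left([P_m(\mu+d+1,R)]_{m+d-k}\right)^\beta_\alpha\widetilde t^\alpha_d\tfrac{\partial}{\partial t^\beta_k}\\&+\tfrac{\varepsilon^2}2\sum_{d_1,d_2\ge0,\,d_1+d_2\le m-1}(-1)^{d_2+1}\left([P_m(\mu-d_2,R)]_{m-1-d_1-d_2}\right)^\alpha_\mu\eta^{\mu\beta}\tfrac{\partial^2}{\partial t^\alpha_{d_1}\partial t^\beta_{d_2}}+\delta_{m,0}\tfrac14\mathrm{tr}\left(\tfrac14-\mu^2\right),\end{aligned}$$ $$\begin{aligned}\mathcal L_m=L_m&+\varepsilon^{-1}\sum_{d\ge0}\sum_{\alpha\le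 N+1}\left([P_m(\widetilde\mu+d+1,\widetilde R)]_{m+d+1}\right)^{N+1}_\alpha\widetilde t^\alpha_d\\&+\sum_{d\ge0,\,0\le k\le m+d}\ \sum_{\alpha\le N+1}\left([P_m(\widetilde\mu+d+1,\widetilde R)]_{m+d-k}\right)^{N+1}_\alpha\widetilde t^\alpha_d\tfrac{\partial}{\partial t^{N+1}_k}+\delta_{m,0}\tfrac34\\&+\varepsilon\sum_{0\le k\le m}\ \sum_{\alpha,\mu\le N}(-1)^{k+1}\left([P_m(\widetilde\mu-k,\widetilde R)]_{m-k}\right)^{N+1}_\alpha\eta^{\alpha\mu}\tfrac{\partial}{\partial t^\mu_k}+\varepsilon\tfrac{3(m+1)!}4\tfrac{\partial}{\partial t^{N+1}_{m-1}}\\&+\varepsilon^2\sum_{d_1,d_2\ge0,\,d_1+d_2\le m-1}\ \sum_{\alpha,\mu\le N}(-1)^{d_2+1}\left([P_m(\widetilde\mu-d_2,\widetilde R)]_{m-1-d_1-d_2}\right)^{N+1}_\alpha\eta^{\alpha\mu}\tfrac{\partial^2}{\partial t^{N+1}_{d_1}\partial t^\mu_{d_2}},\end{aligned}$$ where the term with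 $\partial/\partial t^{N+1}_{m-1}$ is absent for $m\le0$. Then $$\mathrm{Coef}_{\varepsilon^{-1}}\left(\frac{\mathcal L_m\,e^{\varepsilon^{-2}\mathcal F+\varepsilon^{-1}\mathcal F^o}}{e^{\varepsilon^{-2}\mathcal F+\varepsilon^{-1}\mathcal F^o}}\right)=0\qquad\text{for all }m\ge-1.$$ -/

import Mathlib

open scoped Matrix Topology

noncomputable section

namespace OpenVirasoro

/-! ## Rings of functions -/

/-- A `ℂ`-algebra of functions in the coordinates `x i`, `i : κ`, with the commuting partial
derivatives `D i = ∂/∂x i`.  Only the concrete instances `analytic`, `formal` and `formalOver`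
below are used. -/
structure FunctionSpace (κ : Type) [DecidableEq κ] where
  carrier : Type
  [ring : CommRing carrier]
  [alg : Algebra ℂ carrier]
  D : κ → Derivation ℂ carrier carrier
  x : κ → carrier
  D_x : ∀ i j, D i (x j) = if i = j then 1 else 0
  D_comm : ∀ i j f, D i (D j f) = D j (D i f)

attribute [instance] FunctionSpace.ring FunctionSpace.alg

section Analytic

variable {κ : Type} (M : TopologicalSpace.Opens (κ → ℂ))

/-- Extension by zero of a function on `M` to the whole of `ℂ^κ`. -/
def ext0 (f : M → ℂ) : (κ → ℂ) → ℂ := Function.extend Subtype.val f 0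

theorem ext0_apply (f : M → ℂ) (p : M) : ext0 M f p = f p :=
  Subtype.val_injective.extend_apply f 0 p

theorem ext0_eventually {f : M → ℂ} {g : (κ → ℂ) → ℂ} (h : ∀ p : M, f p = g p) (p : M) :
    ext0 M f =ᶠ[𝓝 (p : κ → ℂ)] g := by
  filter_upwards [M.isOpen.mem_nhds p.2] with y hy
  rw [← h ⟨y, hy⟩]
  exact ext0_apply M f ⟨y, hy⟩

variable [Fintype κ]

/-- The algebra of analytic functions on the open set `M`. -/
def holAlg : Subalgebra ℂ (M → ℂ) where
  carrier := {f | ∀ p : M, AnalyticAt ℂ (ext0 M f) p}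
  mul_mem' {f g} hf hg p :=
    ((hf p).mul (hg p)).congr (ext0_eventually M (f := f * g)
      (fun q => by simp [ext0_apply]) p).symm
  add_mem' {f g} hf hg p :=
    ((hf p).add (hg p)).congr (ext0_eventually M (f := f + g)
      (fun q => by simp [ext0_apply]) p).symm
  algebraMap_mem' c p :=
    (analyticAt_const (v := c)).congr (ext0_eventually M (fun q => by simp) p).symm

theorem ext0_differentiableAt (f : holAlg M) (p : M) :
    DifferentiableAt ℂ (ext0 M f) p := (f.2 p).differentiableAt

variable [DecidableEq κ]

/-- `∂f/∂x i` as a function on `M`. -/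
def partialFun (i : κ) (f : M → ℂ) : M → ℂ := fun p => fderiv ℂ (ext0 M f) p (Pi.single i 1)

theorem partialFun_mem (i : κ) (f : holAlg M) : partialFun M i f ∈ holAlg M := by
  intro p
  have h : AnalyticAt ℂ (fun y => fderiv ℂ (ext0 M f) y (Pi.single i 1)) (p : κ → ℂ) :=
    ((ContinuousLinearMap.apply ℂ ℂ (Pi.single i (1 : ℂ) : κ → ℂ)).analyticAt _).comp (f.2 p).fderiv
  exact h.congr (ext0_eventually M (fun q => rfl) p).symm

/-- `∂/∂x i` as a derivation of the algebra of analytic functions on `M`. -/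
def partialHol (i : κ) : Derivation ℂ (holAlg M) (holAlg M) :=
  Derivation.mk'
    { toFun := fun f => ⟨partialFun M i f, partialFun_mem M i f⟩
      map_add' := fun f g => by
        ext p
        have h : ext0 M (f + g : holAlg M) =ᶠ[𝓝 (p : κ → ℂ)] ext0 M f + ext0 M g :=
          ext0_eventually M (fun q => by simp [ext0_apply]) p
        simp only [partialFun, h.fderiv_eq]
        rw [fderiv_add (ext0_differentiableAt M f p) (ext0_differentiableAt M g p)]
        simp [partialFun]
      map_smul' := fun c f => by
        ext p
        have h : ext0 M (c • f : holAlg M) =ᶠ[𝓝 (p : κ → ℂ)] c • ext0 M f :=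
          ext0_eventually M (fun q => by simp [ext0_apply]) p
        simp only [partialFun, h.fderiv_eq]
        rw [fderiv_const_smul (ext0_differentiableAt M f p)]
        simp [partialFun] }
    (fun f g => by
      ext p
      have h : ext0 M (f * g : holAlg M) =ᶠ[𝓝 (p : κ → ℂ)] ext0 M f * ext0 M g :=
        ext0_eventually M (fun q => by simp [ext0_apply]) p
      simp only [partialFun, h.fderiv_eq, LinearMap.coe_mk, AddHom.coe_mk]
      rw [fderiv_mul (ext0_differentiableAt M f p) (ext0_differentiableAt M g p)]
      simp [partialFun, ext0_apply])

/-- `𝒪(M)` for an open set `M ⊆ ℂ^κ`. -/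
def analytic : FunctionSpace κ where
  carrier := holAlg M
  D := partialHol M
  x := fun i => ⟨fun p => (p : κ → ℂ) i, fun p =>
    ((ContinuousLinearMap.proj (R := ℂ) (φ := fun _ : κ => ℂ) i).analyticAt _).congr
      (ext0_eventually M (fun q => rfl) p).symm⟩
  D_x := fun i j => by
    ext p
    have h : ext0 M (fun q : M => (q : κ → ℂ) j) =ᶠ[𝓝 (p : κ → ℂ)]
        (ContinuousLinearMap.proj (R := ℂ) (φ := fun _ : κ => ℂ) j) :=
      ext0_eventually M (f := fun q : M => (q : κ → ℂ) j)
        (g := ContinuousLinearMap.proj (R := ℂ) (φ := fun _ : κ => ℂ) j) (fun q => rfl) p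
    change fderiv ℂ (ext0 M (fun q : M => (q : κ → ℂ) j)) p (Pi.single i 1) = _
    rw [h.fderiv_eq, ContinuousLinearMap.fderiv]
    by_cases hij : i = j
    · subst hij; simp
    · simp [hij, Ne.symm hij]
  D_comm := fun i j f => by
    ext p
    have key : ∀ a b : κ, fderiv ℂ (ext0 M (partialFun M b f)) p (Pi.single a 1) =
        fderiv ℂ (fderiv ℂ (ext0 M f)) p (Pi.single a 1) (Pi.single b 1) := by
      intro a b
      have h : ext0 M (partialFun M b f) =ᶠ[𝓝 (p : κ → ℂ)]
          fun y => fderiv ℂ (ext0 M f) y (Pi.single b 1) :=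
        ext0_eventually M (f := partialFun M b f)
          (g := fun y => fderiv ℂ (ext0 M f) y (Pi.single b 1)) (fun q => rfl) p
      rw [h.fderiv_eq]
      have hd : DifferentiableAt ℂ (fderiv ℂ (ext0 M f)) (p : κ → ℂ) :=
        (f.2 p).fderiv.differentiableAt
      rw [fderiv_clm_apply hd (differentiableAt_const _)]
      simp
    change fderiv ℂ (ext0 M (partialFun M j f)) p (Pi.single i 1) =
      fderiv ℂ (ext0 M (partialFun M i f)) p (Pi.single j 1)
    rw [key, key]
    exact ((f.2 p).contDiffAt.isSymmSndFDerivAt_of_omega).eq _ _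

end Analytic

section Formal

/-- A derivation of `R` applied to every coefficient of a power series. -/
def coeffDeriv {σ R : Type} [CommRing R] [Algebra ℂ R] (d : Derivation ℂ R R) :
    Derivation ℂ (MvPowerSeries σ R) (MvPowerSeries σ R) :=
  Derivation.mk'
    { toFun := fun f => fun n => d (MvPowerSeries.coeff n f)
      map_add' := fun f g => by
        ext n
        exact (congrArg d (map_add (MvPowerSeries.coeff n) f g)).trans (d.map_add _ _)
      map_smul' := fun c f => by
        ext n
        exact d.map_smul c (MvPowerSeries.coeff n f) }
    (fun f g => by
      classical
      ext n
      change d (MvPowerSeries.coeff n (f * g)) = MvPowerSeries.coeff n (f * _ + g * _)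
      rw [map_add, MvPowerSeries.coeff_mul, mul_comm g, MvPowerSeries.coeff_mul,
        MvPowerSeries.coeff_mul, map_sum, ← Finset.sum_add_distrib]
      refine Finset.sum_congr rfl fun q _ => ?_
      rw [Derivation.leibniz, smul_eq_mul, smul_eq_mul, mul_comm (MvPowerSeries.coeff q.2 g)]
      rfl)

theorem coeff_coeffDeriv {σ R : Type} [CommRing R] [Algebra ℂ R] (d : Derivation ℂ R R)
    (f : MvPowerSeries σ R) (n : σ →₀ ℕ) :
    MvPowerSeries.coeff n (coeffDeriv d f) = d (MvPowerSeries.coeff n f) := rfl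

/-- The formal partial derivative `∂/∂X i`. -/
def formalDeriv {σ R : Type} [CommRing R] [Algebra ℂ R] (i : σ) :
    Derivation ℂ (MvPowerSeries σ R) (MvPowerSeries σ R) :=
  (MvPowerSeries.pderiv R i).restrictScalars ℂ

theorem coeff_formalDeriv {σ R : Type} [CommRing R] [Algebra ℂ R] (i : σ)
    (f : MvPowerSeries σ R) (n : σ →₀ ℕ) :
    MvPowerSeries.coeff n (formalDeriv i f) =
      MvPowerSeries.coeff (n + Finsupp.single i 1) f * (n i + 1) :=
  MvPowerSeries.coeff_pderiv f n

theorem formalDeriv_comm {σ R : Type} [CommRing R] [Algebra ℂ R] (i j : σ)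
    (f : MvPowerSeries σ R) :
    formalDeriv i (formalDeriv j f) = formalDeriv j (formalDeriv i f) := by
  classical
  ext n
  simp only [coeff_formalDeriv, Finsupp.add_apply, Finsupp.single_apply]
  rw [add_right_comm n]
  by_cases h : i = j
  · subst h; ring
  · simp [h, Ne.symm h]; ring

/-- `𝒪` of the formal neighbourhood of `t₀ ∈ ℂ^κ`: formal power series in `x i - t₀ i`. -/
def formal {κ : Type} [DecidableEq κ] (t₀ : κ → ℂ) : FunctionSpace κ where
  carrier := MvPowerSeries κ ℂ
  D := formalDeriv
  x := fun i => MvPowerSeries.X i + MvPowerSeries.C (t₀ i)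
  D_x := fun i j => by
    change MvPowerSeries.pderiv ℂ i (MvPowerSeries.X j + MvPowerSeries.C (t₀ j)) = _
    rw [map_add, MvPowerSeries.pderiv_X, MvPowerSeries.pderiv_C, add_zero, Pi.single_apply]
    simp [eq_comm]
  D_comm := formalDeriv_comm

/-- Formal power series in `x i - t₀ i`, `i : σ`, with coefficients in `𝒪`. -/
def formalOver {σ τ : Type} [DecidableEq σ] [DecidableEq τ] (t₀ : σ → ℂ) (𝒪 : FunctionSpace τ) :
    FunctionSpace (σ ⊕ τ) where
  carrier := MvPowerSeries σ 𝒪.carrier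
  D := Sum.elim formalDeriv fun j => coeffDeriv (𝒪.D j)
  x := Sum.elim
    (fun i => MvPowerSeries.X i + MvPowerSeries.C (algebraMap ℂ 𝒪.carrier (t₀ i)))
    fun j => MvPowerSeries.C (𝒪.x j)
  D_x := by
    rintro (i | i) (j | j)
    · change MvPowerSeries.pderiv _ i (MvPowerSeries.X j + MvPowerSeries.C _) = _
      rw [map_add, MvPowerSeries.pderiv_X, MvPowerSeries.pderiv_C, add_zero, Pi.single_apply]
      simp [eq_comm]
    · change MvPowerSeries.pderiv _ i (MvPowerSeries.C _) = _
      simp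
    · ext n
      change 𝒪.D i (MvPowerSeries.coeff n (MvPowerSeries.X j + MvPowerSeries.C _)) = _
      simp only [map_add, MvPowerSeries.coeff_X, MvPowerSeries.coeff_C, reduceCtorEq, if_false,
        map_zero]
      split_ifs <;> simp
    · ext n
      change 𝒪.D i (MvPowerSeries.coeff n (MvPowerSeries.C _)) = _
      simp only [MvPowerSeries.coeff_C, Sum.inr.injEq]
      by_cases hn : n = 0
      · subst hn
        simp only [if_true, 𝒪.D_x]
        split_ifs <;> simp
      · simp only [hn, if_false, map_zero]
        split_ifs <;> simp [MvPowerSeries.coeff_one, hn]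
  D_comm := by
    rintro (i | i) (j | j) f
    · exact formalDeriv_comm i j f
    · ext n
      simp [coeff_formalDeriv, coeff_coeffDeriv, Derivation.leibniz, mul_comm]
    · ext n
      simp [coeff_formalDeriv, coeff_coeffDeriv, Derivation.leibniz, mul_comm]
    · ext n
      exact 𝒪.D_comm i j _

end Formal

/-- A pair `𝒪(M)`, `𝒪(M × U)`, with the pull-back `𝒪(M) → 𝒪(M × U)` along the projection.  The
coordinates on `M × U` are `t¹, …, tᴺ` (index `Sum.inl α`) and `s = tᴺ⁺¹` (index `Sum.inr ()`). -/
structure FunctionPair (N : ℕ) where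
  base : FunctionSpace (Fin N)
  total : FunctionSpace (Fin N ⊕ Unit)
  pull : base.carrier →ₐ[ℂ] total.carrier
  pull_x : ∀ α, pull (base.x α) = total.x (Sum.inl α)
  D_inl_pull : ∀ α f, total.D (Sum.inl α) (pull f) = pull (base.D α f)
  D_inr_pull : ∀ f, total.D (Sum.inr ()) (pull f) = 0

section Pairs

variable {N : ℕ}

/-- `M × U` as an open subset of `ℂ^(N+1)`. -/
def prodOpen (M : TopologicalSpace.Opens (Fin N → ℂ)) (U : TopologicalSpace.Opens ℂ) :
    TopologicalSpace.Opens (Fin N ⊕ Unit → ℂ) where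
  carrier := {p | (fun α => p (Sum.inl α)) ∈ M ∧ p (Sum.inr ()) ∈ U}
  is_open' := (M.isOpen.preimage (by fun_prop)).inter (U.isOpen.preimage (by fun_prop))

/-- The projection `ℂ^(N+1) → ℂ^N`. -/
def projL (N : ℕ) : (Fin N ⊕ Unit → ℂ) →L[ℂ] (Fin N → ℂ) :=
  ContinuousLinearMap.pi fun α => ContinuousLinearMap.proj (Sum.inl α)

theorem pull_eventually (M : TopologicalSpace.Opens (Fin N → ℂ)) (U : TopologicalSpace.Opens ℂ)
    (f : M → ℂ) (p : prodOpen M U) :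
    ext0 (prodOpen M U) (fun q => f ⟨projL N q, q.2.1⟩) =ᶠ[𝓝 (p : Fin N ⊕ Unit → ℂ)]
      fun y => ext0 M f (projL N y) :=
  ext0_eventually _ (f := fun q : prodOpen M U => f ⟨projL N q, q.2.1⟩)
    (g := fun y => ext0 M f (projL N y)) (fun q => (ext0_apply M f ⟨projL N q, q.2.1⟩).symm) p

/-- Pull-back of analytic functions along `M × U → M`. -/
def pullHol (M : TopologicalSpace.Opens (Fin N → ℂ)) (U : TopologicalSpace.Opens ℂ) :
    holAlg M →ₐ[ℂ] holAlg (prodOpen M U) where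
  toFun f := ⟨fun q => (f : M → ℂ) ⟨projL N q, q.2.1⟩, fun p => by
    have h : AnalyticAt ℂ (ext0 M f) (projL N (p : Fin N ⊕ Unit → ℂ)) :=
      f.2 ⟨projL N p, p.2.1⟩
    exact (h.fun_comp ((projL N).analyticAt (p : Fin N ⊕ Unit → ℂ))).congr
      (pull_eventually M U f p).symm⟩
  map_one' := rfl
  map_mul' _ _ := rfl
  map_zero' := rfl
  map_add' _ _ := rfl
  commutes' _ := rfl

theorem fderiv_pull (M : TopologicalSpace.Opens (Fin N → ℂ)) (U : TopologicalSpace.Opens ℂ)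
    (f : holAlg M) (p : prodOpen M U) (w : Fin N ⊕ Unit → ℂ) :
    fderiv ℂ (ext0 (prodOpen M U) (pullHol M U f : prodOpen M U → ℂ)) p w =
      fderiv ℂ (ext0 M f) (projL N p) (projL N w) := by
  have h₀ : fderiv ℂ (ext0 (prodOpen M U) (pullHol M U f : prodOpen M U → ℂ)) p =
      fderiv ℂ (fun y => ext0 M f (projL N y)) p := (pull_eventually M U f p).fderiv_eq
  rw [h₀]
  have h := (f.2 ⟨projL N p, p.2.1⟩).differentiableAt.hasFDerivAt.comp (p : Fin N ⊕ Unit → ℂ)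
    (projL N).hasFDerivAt
  exact congrArg (fun L => L w) h.fderiv

/-- `M ⊆ ℂ^N` and `U ⊆ ℂ` open, analytic functions. -/
def analyticPair (M : TopologicalSpace.Opens (Fin N → ℂ)) (U : TopologicalSpace.Opens ℂ) :
    FunctionPair N where
  base := analytic M
  total := analytic (prodOpen M U)
  pull := pullHol M U
  pull_x := fun _ => rfl
  D_inl_pull := fun α f => Subtype.ext <| funext fun p => by
    refine (fderiv_pull M U f p _).trans ?_
    have h : projL N (Pi.single (Sum.inl α) 1) = Pi.single α 1 := by
      ext β
      simp [projL, Pi.single_apply]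
    rw [h]
    rfl
  D_inr_pull := fun f => Subtype.ext <| funext fun p => by
    refine (fderiv_pull M U f p _).trans ?_
    have h : projL N (Pi.single (Sum.inr ()) 1) = 0 := by
      ext β
      simp [projL]
    rw [h, map_zero]
    rfl

theorem formalDeriv_rename {σ τ : Type} (e : σ ↪ τ) (i : σ) (f : MvPowerSeries σ ℂ) :
    formalDeriv (e i) (MvPowerSeries.rename e f) = MvPowerSeries.rename e (formalDeriv i f) := by
  classical
  ext n
  rw [coeff_formalDeriv]
  by_cases hn : n ∈ Set.range (Finsupp.mapDomain e)
  · obtain ⟨m, rfl⟩ := hn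
    have h : Finsupp.mapDomain e m + Finsupp.single (e i) 1 =
        Finsupp.embDomain e (m + Finsupp.single i 1) := by
      rw [Finsupp.embDomain_eq_mapDomain, Finsupp.mapDomain_add, Finsupp.mapDomain_single]
    rw [h, MvPowerSeries.coeff_embDomain_rename, Finsupp.mapDomain_apply e.injective,
      ← Finsupp.embDomain_eq_mapDomain, MvPowerSeries.coeff_embDomain_rename, coeff_formalDeriv]
  · rw [MvPowerSeries.coeff_rename_eq_zero _ _ hn, MvPowerSeries.coeff_rename_eq_zero, zero_mul]
    rintro ⟨m, hm⟩
    apply hn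
    refine ⟨m - Finsupp.single i 1, ?_⟩
    have hmi : Finsupp.single i 1 ≤ m := by
      rw [Finsupp.single_le_iff]
      have := DFunLike.congr_fun hm (e i)
      rw [Finsupp.mapDomain_apply e.injective] at this
      simp at this
      omega
    have h2 : Finsupp.mapDomain e (m - Finsupp.single i 1) + Finsupp.single (e i) 1 =
        n + Finsupp.single (e i) 1 := by
      rw [← hm, ← Finsupp.mapDomain_single (f := e), ← Finsupp.mapDomain_add,
        tsub_add_cancel_of_le hmi]
    exact add_right_cancel h2

theorem formalDeriv_rename_of_notMem {σ τ : Type} (e : σ ↪ τ) (j : τ) (hj : j ∉ Set.range e)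
    (f : MvPowerSeries σ ℂ) : formalDeriv j (MvPowerSeries.rename e f) = 0 := by
  classical
  ext n
  rw [coeff_formalDeriv, MvPowerSeries.coeff_rename_eq_zero, zero_mul, map_zero]
  rintro ⟨m, hm⟩
  have := DFunLike.congr_fun hm j
  rw [Finsupp.mapDomain_of_notMem_range _ _ hj] at this
  simp at this

/-- `M` and `U` formal neighbourhoods of `t₀` and `s₀`. -/
def formalPair (t₀ : Fin N → ℂ) (s₀ : ℂ) : FunctionPair N where
  base := formal t₀
  total := formal (Sum.elim t₀ fun _ => s₀)
  pull := MvPowerSeries.rename (Function.Embedding.inl : Fin N ↪ Fin N ⊕ Unit)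
  pull_x := fun α => by
    change MvPowerSeries.rename _ (MvPowerSeries.X α + MvPowerSeries.C (t₀ α)) = _
    rw [map_add, MvPowerSeries.rename_X, MvPowerSeries.rename_C]
    rfl
  D_inl_pull := fun α f => formalDeriv_rename Function.Embedding.inl α f
  D_inr_pull := fun f =>
    formalDeriv_rename_of_notMem Function.Embedding.inl (Sum.inr ()) (by simp) f

theorem formalDeriv_map {σ R : Type} [CommRing R] [Algebra ℂ R] (g : ℂ →+* R) (i : σ)
    (f : MvPowerSeries σ ℂ) :
    formalDeriv i (MvPowerSeries.map g f) = MvPowerSeries.map g (formalDeriv i f) := by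
  ext n
  simp [coeff_formalDeriv, MvPowerSeries.coeff_map]

theorem coeffDeriv_map {σ R : Type} [CommRing R] [Algebra ℂ R] (d : Derivation ℂ R R)
    (f : MvPowerSeries σ ℂ) :
    coeffDeriv d (MvPowerSeries.map (Algebra.ofId ℂ R : ℂ →+* R) f) = 0 := by
  ext n
  rw [coeff_coeffDeriv, MvPowerSeries.coeff_map]
  exact d.map_algebraMap _

/-- `U ⊆ ℂ` as a subset of `ℂ^Unit`. -/
def lineOpen (U : TopologicalSpace.Opens ℂ) : TopologicalSpace.Opens (Unit → ℂ) where
  carrier := {p | p () ∈ U}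
  is_open' := U.isOpen.preimage (by fun_prop)

/-- `M` the formal neighbourhood of `t₀` and `U ⊆ ℂ` open: `𝒪(M × U) = 𝒪(U)[[t - t₀]]`. -/
def formalAnalyticPair (t₀ : Fin N → ℂ) (U : TopologicalSpace.Opens ℂ) : FunctionPair N where
  base := formal t₀
  total := formalOver t₀ (analytic (lineOpen U))
  pull := MvPowerSeries.mapAlgHom (Algebra.ofId ℂ (analytic (lineOpen U)).carrier)
  pull_x := fun α => by
    change MvPowerSeries.map _ (MvPowerSeries.X α + MvPowerSeries.C (t₀ α)) = _
    rw [map_add, MvPowerSeries.map_X, MvPowerSeries.map_C]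
    rfl
  D_inl_pull := fun α f => formalDeriv_map _ α f
  D_inr_pull := fun f => coeffDeriv_map _ f

/-- The possible domains `M × U`: `M` is a simply connected open subset of `ℂ^N` or the formal
neighbourhood of a point `t₀`; `U` is a simply connected open subset of `ℂ` or, when `M` is formal,
possibly the formal neighbourhood of a point `s₀`.  A simply connected set is non-empty. -/
inductive Domain (N : ℕ) : Type
  | analytic (M : TopologicalSpace.Opens (Fin N → ℂ)) (U : TopologicalSpace.Opens ℂ)
      (hM : IsSimplyConnected (M : Set (Fin N → ℂ))) (hU : IsSimplyConnected (U : Set ℂ))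
  | formalAnalytic (t₀ : Fin N → ℂ) (U : TopologicalSpace.Opens ℂ)
      (hU : IsSimplyConnected (U : Set ℂ))
  | formal (t₀ : Fin N → ℂ) (s₀ : ℂ)

/-- The rings `𝒪(M)` and `𝒪(M × U)`. -/
def Domain.functions : Domain N → FunctionPair N
  | .analytic M U _ _ => analyticPair M U
  | .formalAnalytic t₀ U _ => formalAnalyticPair t₀ U
  | .formal t₀ s₀ => formalPair t₀ s₀

end Pairs

/-! ## Descendent variables and the principal hierarchy -/

/-- Infinite sum of power series, coefficient by coefficient.  In all uses below every coefficient
receives only finitely many non-zero contributions. -/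
def formalSum {J σ R : Type} [CommRing R] (f : J → MvPowerSeries σ R) : MvPowerSeries σ R :=
  fun n => ∑ᶠ j, MvPowerSeries.coeff n (f j)

section Descendents

variable {κ : Type} [DecidableEq κ] (𝒪 : FunctionSpace κ)

/-- `𝒪[[t^*_{≥1}]]`; the variable `X (α, k)` is `t^α_{k+1}`. -/
abbrev Desc : Type := MvPowerSeries (κ × ℕ) 𝒪.carrier

variable {𝒪}

/-- `dDesc (α, d) = ∂/∂t^α_d`. -/
def dDesc : κ × ℕ → Derivation ℂ (Desc 𝒪) (Desc 𝒪)
  | (α, 0) => coeffDeriv (𝒪.D α)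
  | (α, k + 1) => formalDeriv (α, k)

/-! A calibration is given by matrices `Ω k`, `k ≥ 0`, where `Ω k` has entry
`Ω k α β = Ω^{α,0}_{β,k-1}` (so `Ω 0` is the identity).  The index `e` is that of the unit
`∂/∂t¹`. The flat coordinate `t^α = t^α_0` is normalised to be `Ω^{α,0}_{1,0}`, that is `Ω 1 α e`;
it differs from the coordinate `x α` by a constant, so that `∂/∂t^α_0 = ∂/∂x α`. -/

variable (Ω : ℕ → Matrix κ κ 𝒪.carrier) (e : κ)

/-- `shifted (α, d) = t^α_d - δ^{α,1} δ_{d,1}`. -/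
def shifted : κ × ℕ → Desc 𝒪
  | (α, 0) => MvPowerSeries.C (Ω 1 α e)
  | (α, k + 1) => MvPowerSeries.X (α, k) - if α = e ∧ k = 0 then 1 else 0

/-- `f|_{t^γ = v^γ}` for `v^γ ∈ t^γ_0 + (t^*_{≥1})`, by the Taylor expansion
`∑ₙ (1/n!) ∑_{α₁,…,αₙ} (∂_{α₁}⋯∂_{αₙ} f) ∏ᵢ (v^{αᵢ} - t^{αᵢ}_0)`. -/
def substAt (v : κ → Desc 𝒪) (f : 𝒪.carrier) : Desc 𝒪 :=
  formalSum fun l : List κ =>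
    ((l.length.factorial : ℂ)⁻¹) •
      (MvPowerSeries.C (l.foldr (fun α g => 𝒪.D α g) f) *
        (l.map fun α => v α - MvPowerSeries.C (Ω 1 α e)).prod)

/-- `v` is the topological solution of the principal hierarchy
`∂v^α/∂t^β_d = ∂_x (Ω^{α,0}_{β,d}|_{t = v})`, `x = t^1_0`, with `v^α|_{t^*_{≥1} = 0} = t^α_0`. -/
def IsTopSolution (v : κ → Desc 𝒪) : Prop :=
  (∀ α, MvPowerSeries.constantCoeff (v α) = Ω 1 α e) ∧
  ∀ α β d, dDesc (β, d) (v α) = dDesc (e, 0) (substAt Ω e v (Ω (d + 1) α β))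

end Descendents

/-! ## Conformal Frobenius manifolds and solutions of the open WDVV equations -/

variable {N : ℕ} [NeZero N]

/-- A conformal Frobenius manifold in flat coordinates; the index `0` is that of `t¹`. -/
structure ConformalFrobenius (𝒪 : FunctionSpace (Fin N)) where
  η : Matrix (Fin N) (Fin N) ℂ
  η_symm : η.IsSymm
  η_nondeg : IsUnit η.det
  F : 𝒪.carrier
  wdvv : ∀ α β γ δ,
    ∑ μ, ∑ ν, η⁻¹ μ ν • (𝒪.D α (𝒪.D β (𝒪.D μ F)) * 𝒪.D ν (𝒪.D γ (𝒪.D δ F))) =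
    ∑ μ, ∑ ν, η⁻¹ μ ν • (𝒪.D δ (𝒪.D β (𝒪.D μ F)) * 𝒪.D ν (𝒪.D γ (𝒪.D α F)))
  unit : ∀ α β, 𝒪.D 0 (𝒪.D α (𝒪.D β F)) = algebraMap ℂ 𝒪.carrier (η α β)
  q : Fin N → ℂ
  r : Fin N → ℂ
  δ : ℂ
  q_unit : q 0 = 0
  homogeneous : ∃ (A : Matrix (Fin N) (Fin N) ℂ) (B : Fin N → ℂ) (C : ℂ),
    ∑ γ, ((1 - q γ) • 𝒪.x γ + algebraMap ℂ 𝒪.carrier (r γ)) * 𝒪.D γ F =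
      (3 - δ) • F + (1 / 2 : ℂ) • ∑ α, ∑ β, A α β • (𝒪.x α * 𝒪.x β) + ∑ α, B α • 𝒪.x α +
        algebraMap ℂ 𝒪.carrier C

namespace ConformalFrobenius

variable {𝒪 : FunctionSpace (Fin N)} (X : ConformalFrobenius 𝒪)

/-- The component `E^γ = (1 - q^γ) t^γ + r^γ` of the Euler vector field. -/
def E (γ : Fin N) : 𝒪.carrier := (1 - X.q γ) • 𝒪.x γ + algebraMap ℂ 𝒪.carrier (X.r γ)

/-- `μ^α = q^α - δ/2`. -/
def μ (α : Fin N) : ℂ := X.q α - X.δ / 2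

/-- `μ¹, …, μᴺ, μᴺ⁺¹` with `μᴺ⁺¹ = 1/2`. -/
def μt : Fin N ⊕ Unit → ℂ := Sum.elim X.μ fun _ => 1 / 2

/-- `c^α_{βγ} = η^{αμ} ∂³F/∂t^μ∂t^β∂t^γ`. -/
def c (α β γ : Fin N) : 𝒪.carrier := ∑ μ, X.η⁻¹ α μ • 𝒪.D μ (𝒪.D β (𝒪.D γ X.F))

end ConformalFrobenius

/-- A calibration of a conformal Frobenius manifold: `Ω k α β = Ω^{α,0}_{β,k-1}`, together with
its matrices `R n`, `n ≥ 1` (the value `R 0` is not used). -/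
structure Calibration {𝒪 : FunctionSpace (Fin N)} (X : ConformalFrobenius 𝒪) where
  Ω : ℕ → Matrix (Fin N) (Fin N) 𝒪.carrier
  Ω_zero : Ω 0 = 1
  D_Ω : ∀ k α β γ, 𝒪.D γ (Ω (k + 1) α β) = ∑ μ, X.c α γ μ * Ω k μ β
  orthogonal : ∀ k, 1 ≤ k → ∀ α β, ∑ i ∈ Finset.range (k + 1), ∑ μ, ∑ ν,
    ((-1) ^ i * X.η⁻¹ μ ν) • (Ω i α μ * Ω (k - i) β ν) = 0
  R : ℕ → Matrix (Fin N) (Fin N) ℂ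
  R_comm : ∀ n, 1 ≤ n →
    Matrix.diagonal X.μ * R n - R n * Matrix.diagonal X.μ = (n : ℂ) • R n
  R_adj : ∀ n, 1 ≤ n → X.η * R n * X.η⁻¹ = (-1 : ℂ) ^ (n - 1) • (R n)ᵀ
  homogeneous : ∀ k α β, ∑ θ, X.E θ * 𝒪.D θ (Ω k α β) =
    ((k : ℂ) + X.μ β - X.μ α) • Ω k α β +
      ∑ i ∈ Finset.Icc 1 k, ∑ μ, R i μ β • Ω (k - i) α μ

/-- A solution `F^o` of the open WDVV equations satisfying the unit and homogeneity conditions.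
The coordinate `s` has index `Sum.inr ()`. -/
structure OpenPotential (P : FunctionPair N) (X : ConformalFrobenius P.base) where
  Fo : P.total.carrier
  open_wdvv_1 : ∀ α β γ : Fin N,
    ∑ μ, ∑ ν, X.η⁻¹ μ ν • (P.pull (P.base.D α (P.base.D β (P.base.D μ X.F))) *
        P.total.D (.inl ν) (P.total.D (.inl γ) Fo)) +
      P.total.D (.inl α) (P.total.D (.inl β) Fo) * P.total.D (.inr ()) (P.total.D (.inl γ) Fo) =
    ∑ μ, ∑ ν, X.η⁻¹ μ ν • (P.pull (P.base.D γ (P.base.D β (P.base.D μ X.F))) *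
        P.total.D (.inl ν) (P.total.D (.inl α) Fo)) +
      P.total.D (.inl γ) (P.total.D (.inl β) Fo) * P.total.D (.inr ()) (P.total.D (.inl α) Fo)
  open_wdvv_2 : ∀ α β : Fin N,
    ∑ μ, ∑ ν, X.η⁻¹ μ ν • (P.pull (P.base.D α (P.base.D β (P.base.D μ X.F))) *
        P.total.D (.inl ν) (P.total.D (.inr ()) Fo)) +
      P.total.D (.inl α) (P.total.D (.inl β) Fo) * P.total.D (.inr ()) (P.total.D (.inr ()) Fo) =
    P.total.D (.inr ()) (P.total.D (.inl β) Fo) * P.total.D (.inr ()) (P.total.D (.inl α) Fo)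
  unit_t : ∀ α : Fin N, P.total.D (.inl 0) (P.total.D (.inl α) Fo) = 0
  unit_s : P.total.D (.inl 0) (P.total.D (.inr ()) Fo) = 1
  rs : ℂ
  homogeneous : ∃ (D : Fin N → ℂ) (Dt C : ℂ),
    ∑ γ, P.pull (X.E γ) * P.total.D (.inl γ) Fo +
        (((1 - X.δ) / 2) • P.total.x (.inr ()) + algebraMap ℂ _ rs) * P.total.D (.inr ()) Fo =
      ((3 - X.δ) / 2) • Fo + ∑ α, D α • P.total.x (.inl α) + Dt • P.total.x (.inr ()) +
        algebraMap ℂ _ C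

/-- The components `E¹, …, Eᴺ⁺¹` of the Euler vector field on `M × U`. -/
def OpenPotential.E {P : FunctionPair N} {X : ConformalFrobenius P.base}
    (Y : OpenPotential P X) : Fin N ⊕ Unit → P.total.carrier :=
  Sum.elim (fun γ => P.pull (X.E γ))
    fun _ => ((1 - X.δ) / 2) • P.total.x (.inr ()) + algebraMap ℂ _ Y.rs

/-- The `N × (N+1)` matrices `Ω^{α,0}_{β,k-1}` with the convention `Ω^{α,0}_{N+1,d} = 0`. -/
def Calibration.Ωext {P : FunctionPair N} {X : ConformalFrobenius P.base}
    (K : Calibration X) (k : ℕ) : Fin N → Fin N ⊕ Unit → P.total.carrier :=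
  fun α => Sum.elim (fun β => P.pull (K.Ω k α β)) fun _ => 0

/-- A calibration of `F^o`: `Φ k β = Φ_{β,k-1}`, together with the matrices `Rt n`, `n ≥ 1`
(the value `Rt 0` is not used). -/
structure OpenCalibration {P : FunctionPair N} {X : ConformalFrobenius P.base}
    (K : Calibration X) (Y : OpenPotential P X) where
  Φ : ℕ → Fin N ⊕ Unit → P.total.carrier
  Φ_zero : ∀ β, Φ 0 β = if β = .inr () then 1 else 0
  D_Φ : ∀ k β γ, P.total.D γ (Φ (k + 1) β) =
    ∑ μ, P.total.D γ (P.total.D (.inl μ) Y.Fo) * K.Ωext k μ β +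
      P.total.D γ (P.total.D (.inr ()) Y.Fo) * Φ k β
  Rt : ℕ → Matrix (Fin N ⊕ Unit) (Fin N ⊕ Unit) ℂ
  Rt_inl : ∀ n, 1 ≤ n → ∀ α β, Rt n (.inl α) (.inl β) = K.R n α β
  Rt_inr : ∀ n, 1 ≤ n → ∀ α, Rt n α (.inr ()) = 0
  Rt_comm : ∀ n, 1 ≤ n →
    Matrix.diagonal X.μt * Rt n - Rt n * Matrix.diagonal X.μt = (n : ℂ) • Rt n
  homogeneous : ∀ k β, ∑ μ, Y.E μ * P.total.D μ (Φ k β) =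
    ((k : ℂ) - 1 / 2 + X.μt β) • Φ k β +
      ∑ i ∈ Finset.Icc 1 k, ∑ μ, Rt i μ β • Φ (k - i) μ

/-! ## Descendent potentials -/

namespace Calibration

variable {𝒪 : FunctionSpace (Fin N)} {X : ConformalFrobenius 𝒪} (K : Calibration X)

/-- `v` is the topological solution `(v^⊤)^α ∈ 𝒪(M)[[t^*_{≥1}]]` of the principal hierarchy of
the Frobenius manifold. -/
def IsTop (v : Fin N → Desc 𝒪) : Prop := IsTopSolution K.Ω 0 v

/-- `Ω_{α,p;β,q} = ∑_{i=0}^q (-1)^{q-i} Ω^{μ,0}_{α,p+q-i} η_{μν} Ω^{ν,0}_{β,i-1}`. -/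
def twoPoint (p q : ℕ) : Matrix (Fin N) (Fin N) 𝒪.carrier :=
  ∑ i ∈ Finset.range (q + 1), (-1 : ℂ) ^ (q - i) •
    ((K.Ω (p + q - i + 1))ᵀ * X.η.map (algebraMap ℂ 𝒪.carrier) * K.Ω i)

/-- The descendent potential `ℱ = ½ ∑ 𝕥^α_p 𝕥^β_q Ω^⊤_{α,p;β,q}`, where `v` is the topological
solution and `𝕥^α_p = t^α_p - δ^{α,1} δ_{p,1}`. -/
def potential (v : Fin N → Desc 𝒪) : Desc 𝒪 :=
  (1 / 2 : ℂ) • formalSum fun j : (Fin N × ℕ) × (Fin N × ℕ) =>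
    shifted K.Ω 0 j.1 * shifted K.Ω 0 j.2 *
      substAt K.Ω 0 v (K.twoPoint j.1.2 j.2.2 j.1.1 j.2.1)

/-- `R = ∑_{n ≥ 1} R_n` (only finitely many `R_n` are non-zero). -/
def Rsum : Matrix (Fin N) (Fin N) ℂ := ∑ᶠ n : ℕ, K.R (n + 1)

end Calibration

/-- Pull-back `𝒪(M)[[t^{≤N}_{≥1}]] → 𝒪(M × U)[[t^{≤N+1}_{≥1}]]`. -/
def pullDesc (P : FunctionPair N) (f : Desc P.base) : Desc P.total :=
  MvPowerSeries.rename
    ((Function.Embedding.inl (α := Fin N) (β := Unit)).prodMap (Function.Embedding.refl ℕ))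
    (MvPowerSeries.map (P.pull : P.base.carrier →+* P.total.carrier) f)

namespace OpenCalibration

variable {P : FunctionPair N} {X : ConformalFrobenius P.base} {K : Calibration X}
  {Y : OpenPotential P X} (J : OpenCalibration K Y)

/-- The `(N+1) × (N+1)` matrices with rows `Ω^{α,0}_{β,k-1}`, `α ≤ N`, and last row
`Φ_{β,k-1}`; they define the extended principal hierarchy. -/
def Ωt (k : ℕ) : Matrix (Fin N ⊕ Unit) (Fin N ⊕ Unit) P.total.carrier :=
  Matrix.of (Sum.elim (K.Ωext k) fun _ => J.Φ k)

/-- `w` is the topological solution `(ṽ^⊤)^α` of the extended principal hierarchy. -/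
def IsTop (w : Fin N ⊕ Unit → Desc P.total) : Prop := IsTopSolution J.Ωt (.inl 0) w

/-- `𝕥^α_d = t^α_d - δ^{α,1} δ_{d,1}`, `1 ≤ α ≤ N+1`, with `t^{N+1}_d = s_d`. -/
def tt (i : (Fin N ⊕ Unit) × ℕ) : Desc P.total := shifted J.Ωt (.inl 0) i

/-- The open descendent potential `ℱ^o = ∑ 𝕥^α_d Φ^⊤_{α,d}`, where `w` is the topological
solution. -/
def potential (w : Fin N ⊕ Unit → Desc P.total) : Desc P.total :=
  formalSum fun i : (Fin N ⊕ Unit) × ℕ =>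
    J.tt i * substAt J.Ωt (.inl 0) w (J.Φ (i.2 + 1) i.1)

/-- `R̃ = ∑_{n ≥ 1} R̃_n` (only finitely many `R̃_n` are non-zero). -/
def Rtsum : Matrix (Fin N ⊕ Unit) (Fin N ⊕ Unit) ℂ := ∑ᶠ n : ℕ, J.Rt (n + 1)

end OpenCalibration

/-! ## Differential operators -/

/-- The operator `ε^eps · coef · ∂_{i₁} ⋯ ∂_{iₖ}`, where `ders = [i₁, …, iₖ]`. -/
structure DiffTerm (V A : Type) where
  eps : ℤ
  coef : A
  ders : List V

/-- A differential operator, given as a formal sum of terms. -/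
structure DiffOp (V A : Type) where
  Idx : Type
  term : Idx → DiffTerm V A

/-- Sum of two operators. -/
instance (V A : Type) : Add (DiffOp V A) where
  add L L' := ⟨L.Idx ⊕ L'.Idx, Sum.elim L.term L'.term⟩

section Action

variable {κ : Type} [DecidableEq κ] {𝒪 : FunctionSpace κ}

/-- `∂/∂t^α_d` of a Laurent series in `ε`. -/
def dLaurent (i : κ × ℕ) (g : LaurentSeries (Desc 𝒪)) : LaurentSeries (Desc 𝒪) :=
  HahnSeries.map g (dDesc i)

/-- `e^{-S} ∂_i (g e^S) = ∂_i g + (∂_i S) g`. -/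
def twisted (S : LaurentSeries (Desc 𝒪)) (i : κ × ℕ) (g : LaurentSeries (Desc 𝒪)) :
    LaurentSeries (Desc 𝒪) :=
  dLaurent i g + dLaurent i S * g

/-- `(T e^S) / e^S` for a single term `T`. -/
def DiffTerm.onExp (T : DiffTerm (κ × ℕ) (Desc 𝒪)) (S : LaurentSeries (Desc 𝒪)) :
    LaurentSeries (Desc 𝒪) :=
  HahnSeries.single T.eps T.coef * T.ders.foldr (twisted S) 1

/-- `Coef_{ε^n} ((L e^S) / e^S)`. -/
def DiffOp.coefOnExp (L : DiffOp (κ × ℕ) (Desc 𝒪)) (S : LaurentSeries (Desc 𝒪)) (n : ℤ) :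
    Desc 𝒪 :=
  formalSum fun j : L.Idx => ((L.term j).onExp S).coeff n

end Action

/-! ## Virasoro operators -/

section Coefficients

variable {κ : Type} [Fintype κ] [DecidableEq κ]

/-- `virAux A R n = P_{n-1}(A, R)`: `P_{-1} = 1`, `P_{m+1} = R P_m + P_m (A + m + 1/2)`. -/
def virAux (A R : Matrix κ κ ℂ) : ℕ → Matrix κ κ ℂ
  | 0 => 1
  | n + 1 => R * virAux A R n + virAux A R n * (A + ((n : ℂ) - 1 / 2) • 1)

/-- `P_m(A, R)` for `m ≥ -1`. -/
def virP (m : ℤ) (A R : Matrix κ κ ℂ) : Matrix κ κ ℂ := virAux A R (m + 1).toNat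

open Classical in
/-- `[A]_p`: the entries `A^α_β` with `μ^α - μ^β = p` (equivalently `q^α - q^β = p`). -/
def bracket (μ : κ → ℂ) (A : Matrix κ κ ℂ) (p : ℤ) : Matrix κ κ ℂ :=
  Matrix.of fun α β => if μ α - μ β = (p : ℂ) then A α β else 0

/-- `[P_m(μ + a, R)]_p`. -/
def virCoef (μ : κ → ℂ) (R : Matrix κ κ ℂ) (m a p : ℤ) : Matrix κ κ ℂ :=
  bracket μ (virP m (Matrix.diagonal μ + (a : ℂ) • 1) R) p

end Coefficients

namespace OpenCalibration

variable {P : FunctionPair N} {X : ConformalFrobenius P.base} {K : Calibration X}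
  {Y : OpenPotential P X} (J : OpenCalibration K Y)

/-- `ε^{-2}/2 ∑ (-1)^{d₁} ([P_m(μ+d₂+1,R)]_{m+d₁+d₂+1})^μ_β η_{αμ} 𝕥^α_{d₁} 𝕥^β_{d₂}`. -/
def L₁ (m : ℤ) : DiffOp ((Fin N ⊕ Unit) × ℕ) (Desc P.total) where
  Idx := (Fin N × ℕ) × (Fin N × ℕ)
  term := fun ((α, d₁), (β, d₂)) =>
    { eps := -2
      coef := (1 / 2 * (-1) ^ d₁ *
        (X.η * virCoef X.μ K.Rsum m (d₂ + 1) (m + d₁ + d₂ + 1)) α β) •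
          (J.tt (.inl α, d₁) * J.tt (.inl β, d₂))
      ders := [] }

/-- `∑_{d ≥ 0, 0 ≤ k ≤ m+d} ([P_m(μ+d+1,R)]_{m+d-k})^β_α 𝕥^α_d ∂/∂t^β_k`. -/
def L₂ (m : ℤ) : DiffOp ((Fin N ⊕ Unit) × ℕ) (Desc P.total) where
  Idx := (Fin N × ℕ) × (Fin N × ℕ)
  term := fun ((α, d), (β, k)) =>
    { eps := 0
      coef := if (k : ℤ) ≤ m + d then
        virCoef X.μ K.Rsum m (d + 1) (m + d - k) β α • J.tt (.inl α, d) else 0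
      ders := [(.inl β, k)] }

/-- `ε²/2 ∑_{d₁+d₂ ≤ m-1} (-1)^{d₂+1} ([P_m(μ-d₂,R)]_{m-1-d₁-d₂})^α_μ η^{μβ}
∂²/∂t^α_{d₁}∂t^β_{d₂}`. -/
def L₃ (_J : OpenCalibration K Y) (m : ℤ) :
    DiffOp ((Fin N ⊕ Unit) × ℕ) (Desc P.total) where
  Idx := (Fin N × ℕ) × (Fin N × ℕ)
  term := fun ((α, d₁), (β, d₂)) =>
    { eps := 2
      coef := if (d₁ : ℤ) + d₂ ≤ m - 1 then
        algebraMap ℂ _ (1 / 2 * (-1) ^ (d₂ + 1) *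
          (virCoef X.μ K.Rsum m (-d₂) (m - 1 - d₁ - d₂) * X.η⁻¹) α β) else 0
      ders := [(.inl α, d₁), (.inl β, d₂)] }

/-- `δ_{m,0} ¼ tr(¼ - μ²)`. -/
def L₄ (_J : OpenCalibration K Y) (m : ℤ) :
    DiffOp ((Fin N ⊕ Unit) × ℕ) (Desc P.total) where
  Idx := Unit
  term := fun _ =>
    { eps := 0
      coef := if m = 0 then algebraMap ℂ _ (1 / 4 * ∑ α, (1 / 4 - X.μ α ^ 2)) else 0
      ders := [] }

/-- The Virasoro operator `L_m` of the Frobenius manifold. -/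
def L (m : ℤ) : DiffOp ((Fin N ⊕ Unit) × ℕ) (Desc P.total) :=
  J.L₁ m + J.L₂ m + J.L₃ m + J.L₄ m

/-- `ε^{-1} ∑ ([P_m(μ̃+d+1,R̃)]_{m+d+1})^{N+1}_α 𝕥^α_d`, `1 ≤ α ≤ N+1`. -/
def Lo₁ (m : ℤ) : DiffOp ((Fin N ⊕ Unit) × ℕ) (Desc P.total) where
  Idx := (Fin N ⊕ Unit) × ℕ
  term := fun (α, d) =>
    { eps := -1
      coef := virCoef X.μt J.Rtsum m (d + 1) (m + d + 1) (.inr ()) α • J.tt (α, d)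
      ders := [] }

/-- `∑_{d ≥ 0, 0 ≤ k ≤ m+d} ([P_m(μ̃+d+1,R̃)]_{m+d-k})^{N+1}_α 𝕥^α_d ∂/∂t^{N+1}_k`,
`1 ≤ α ≤ N+1`. -/
def Lo₂ (m : ℤ) : DiffOp ((Fin N ⊕ Unit) × ℕ) (Desc P.total) where
  Idx := ((Fin N ⊕ Unit) × ℕ) × ℕ
  term := fun ((α, d), k) =>
    { eps := 0
      coef := if (k : ℤ) ≤ m + d then
        virCoef X.μt J.Rtsum m (d + 1) (m + d - k) (.inr ()) α • J.tt (α, d) else 0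
      ders := [(.inr (), k)] }

/-- `δ_{m,0} ¾`. -/
def Lo₃ (_J : OpenCalibration K Y) (m : ℤ) :
    DiffOp ((Fin N ⊕ Unit) × ℕ) (Desc P.total) where
  Idx := Unit
  term := fun _ =>
    { eps := 0
      coef := if m = 0 then algebraMap ℂ _ (3 / 4) else 0
      ders := [] }

/-- `ε ∑_{0 ≤ k ≤ m} (-1)^{k+1} ([P_m(μ̃-k,R̃)]_{m-k})^{N+1}_α η^{αμ} ∂/∂t^μ_k`,
`1 ≤ α, μ ≤ N`. -/
def Lo₄ (m : ℤ) : DiffOp ((Fin N ⊕ Unit) × ℕ) (Desc P.total) where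
  Idx := Fin N × ℕ
  term := fun (μ, k) =>
    { eps := 1
      coef := if (k : ℤ) ≤ m then
        algebraMap ℂ _ ((-1) ^ (k + 1) * ∑ α : Fin N,
          virCoef X.μt J.Rtsum m (-k) (m - k) (.inr ()) (.inl α) * X.η⁻¹ α μ) else 0
      ders := [(.inl μ, k)] }

/-- `ε (3(m+1)!/4) ∂/∂t^{N+1}_{m-1}`, absent for `m ≤ 0`, when there is no such variable. -/
def Lo₅ (_J : OpenCalibration K Y) (m : ℤ) :
    DiffOp ((Fin N ⊕ Unit) × ℕ) (Desc P.total) where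
  Idx := Unit
  term := fun _ =>
    { eps := 1
      coef := if 1 ≤ m then algebraMap ℂ _ (3 * (m + 1).toNat.factorial / 4) else 0
      ders := [(.inr (), (m - 1).toNat)] }

/-- `ε² ∑_{d₁+d₂ ≤ m-1} (-1)^{d₂+1} ([P_m(μ̃-d₂,R̃)]_{m-1-d₁-d₂})^{N+1}_α η^{αμ}
∂²/∂t^{N+1}_{d₁}∂t^μ_{d₂}`, `1 ≤ α, μ ≤ N`. -/
def Lo₆ (m : ℤ) : DiffOp ((Fin N ⊕ Unit) × ℕ) (Desc P.total) where
  Idx := ℕ × (Fin N × ℕ)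
  term := fun (d₁, (μ, d₂)) =>
    { eps := 2
      coef := if (d₁ : ℤ) + d₂ ≤ m - 1 then
        algebraMap ℂ _ ((-1) ^ (d₂ + 1) * ∑ α : Fin N,
          virCoef X.μt J.Rtsum m (-d₂) (m - 1 - d₁ - d₂) (.inr ()) (.inl α) * X.η⁻¹ α μ) else 0
      ders := [(.inr (), d₁), (.inl μ, d₂)] }

/-- The open Virasoro operator `ℒ_m`. -/
def openL (m : ℤ) : DiffOp ((Fin N ⊕ Unit) × ℕ) (Desc P.total) :=
  J.L m + J.Lo₁ m + (J.Lo₂ m + J.Lo₃ m) + (J.Lo₄ m + J.Lo₅ m) + J.Lo₆ m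

/-- The exponent `ε^{-2} ℱ + ε^{-1} ℱ^o`. -/
def exponent (v : Fin N → Desc P.base) (w : Fin N ⊕ Unit → Desc P.total) :
    LaurentSeries (Desc P.total) :=
  HahnSeries.single (-2) (pullDesc P (K.potential v)) + HahnSeries.single (-1) (J.potential w)

end OpenCalibration

end OpenVirasoro

end

open scoped Matrix Topology

noncomputable section

set_option linter.unusedSectionVars false

/-! Let `S(z) = ∑ z^k J.Ωt k`; its first `N` rows come from the calibration of `M`, and its last row
`S_{N+1}` consists of the `Φ_{β,k-1}`. By the closed and open WDVV equations, the `c^α_{βγ}` and the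
second derivatives of `F^o` are the structure constants of a flat F-manifold on `M × U`, calibrated
by `J.Ωt`. One theory of principal hierarchies therefore serves both `M` and `M × U`.

The topological solution is the unique solution of the Euler-Lagrange equation `∑ 𝕥^β_d (Ω
d)^α_β|_{t=v} = 0` (`exists_eulerLagrange`, `IsFlat.eulerLagrange_eq_zero`). Derivatives of `Φ` and
of the two-point functions are combinations of columns of the calibration, so this equation kills
the dependence of the potentials on the `𝕥` through `v` and `w`. Hence `∂ℱ^o/∂t^β_k =
Φ_{β,k}|_{t=w}` and `∂ℱ/∂t^μ_d = ∑ 𝕥^β_q Ω_{μ,d;β,q}|_{t=v}`, and the coefficient of `ε^{-1}`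
becomes a sum `∑ 𝕥^β_q (⋯)|_{t=w}`.

The matrices `P_m` encode iterates of `D = z⁻¹(z∂_z + μ̃ + R̃ - 1/2)` acting on row-valued series
(`sum_virAux_smul`). With `M = m + 1`, the factor of `𝕥^β_q` is the coefficient of `z^q` in `D^M
S_{N+1}`, plus `∑_d (-1)^{d+1}` times the coefficient of `z^{-d-1}` contracted through `η⁻¹` with
`Ω_{·,d;β,q}`. Homogeneity gives `D S_α = ∑_δ 𝒰_{αδ} S_δ + (μ^α - 1/2) z⁻¹ S_α`, with `𝒰` the
multiplication by the Euler field. As `μ^{N+1} = 1/2`, it follows that `D^M S_{N+1} = ∑_a h_a z^{-a}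
S`, where the row vectors `h_a` with `a ≥ 1` have no last component
(`OpenCalibration.rowOp_iterate`, `OpenPotential.rowCoef_inr`).

The identity `Calibration.sum_Ω_mul_twoPoint`, a consequence of orthogonality, makes the second
contribution cancel all terms with `a ≥ 1` (`OpenCalibration.rowOp_iterate_add_loop`). The surviving
term `h_0 · J.Ωt q` vanishes after summation against `𝕥`, again by the Euler-Lagrange equation. -/

namespace OpenVirasoro

/-! ### The degree filtration on power series -/

section DegreeIdeal

variable {σ R : Type} [CommRing R]

/-- The ideal of power series all of whose monomials have degree at least `k`. -/
def degIdeal (σ R : Type) [CommRing R] (k : ℕ) : Ideal (MvPowerSeries σ R) where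
  carrier := {f | ∀ n : σ →₀ ℕ, n.degree < k → MvPowerSeries.coeff n f = 0}
  add_mem' {f g} hf hg n hn := by rw [map_add, hf n hn, hg n hn, add_zero]
  zero_mem' n _ := map_zero _
  smul_mem' c f hf n hn := by
    classical
    rw [smul_eq_mul, MvPowerSeries.coeff_mul]
    refine Finset.sum_eq_zero fun q hq => ?_
    have h := congrArg Finsupp.degree (Finset.HasAntidiagonal.mem_antidiagonal.1 hq)
    rw [map_add] at h
    rw [hf q.2 (by omega), mul_zero]

theorem degIdeal_mono {k l : ℕ} (h : k ≤ l) : degIdeal σ R l ≤ degIdeal σ R k :=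
  fun _ hf n hn => hf n (lt_of_lt_of_le hn h)

theorem mem_degIdeal_zero (f : MvPowerSeries σ R) : f ∈ degIdeal σ R 0 :=
  fun _ hn => absurd hn (Nat.not_lt_zero _)

theorem mul_mem_degIdeal {k l : ℕ} {f g : MvPowerSeries σ R} (hf : f ∈ degIdeal σ R k)
    (hg : g ∈ degIdeal σ R l) : f * g ∈ degIdeal σ R (k + l) := by
  classical
  intro n hn
  rw [MvPowerSeries.coeff_mul]
  refine Finset.sum_eq_zero fun q hq => ?_
  have h := congrArg Finsupp.degree (Finset.HasAntidiagonal.mem_antidiagonal.1 hq)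
  rw [map_add] at h
  by_cases h1 : q.1.degree < k
  · rw [hf _ h1, zero_mul]
  · rw [hg q.2 (by omega), mul_zero]

theorem eq_of_sub_mem_degIdeal {f g : MvPowerSeries σ R} (h : ∀ k, f - g ∈ degIdeal σ R k) :
    f = g := by
  ext n
  have := h (n.degree + 1) n (Nat.lt_succ_self _)
  rwa [map_sub, sub_eq_zero] at this

theorem mem_degIdeal_one {f : MvPowerSeries σ R} :
    f ∈ degIdeal σ R 1 ↔ MvPowerSeries.constantCoeff f = 0 := by
  constructor
  · intro h
    exact h 0 (by simp)
  · intro h n hn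
    have : n = 0 := (Finsupp.degree_eq_zero_iff n).1 (by omega)
    rw [this]
    exact h

theorem X_mem_degIdeal (i : σ) : (MvPowerSeries.X i : MvPowerSeries σ R) ∈ degIdeal σ R 1 :=
  mem_degIdeal_one.2 (MvPowerSeries.constantCoeff_X i)

variable [Algebra ℂ R]

theorem smul_mem_degIdeal {k : ℕ} (c : ℂ) {f : MvPowerSeries σ R} (hf : f ∈ degIdeal σ R k) :
    c • f ∈ degIdeal σ R k := by
  intro n hn
  have : MvPowerSeries.coeff n (c • f) = c • MvPowerSeries.coeff n f := rfl
  rw [this, hf n hn, smul_zero]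

theorem coeffDeriv_mem_degIdeal (d : Derivation ℂ R R) {k : ℕ} {f : MvPowerSeries σ R}
    (hf : f ∈ degIdeal σ R k) : coeffDeriv d f ∈ degIdeal σ R k := by
  intro n hn
  rw [coeff_coeffDeriv, hf n hn, map_zero]

theorem formalDeriv_mem_degIdeal (i : σ) {k : ℕ} {f : MvPowerSeries σ R}
    (hf : f ∈ degIdeal σ R (k + 1)) : formalDeriv i f ∈ degIdeal σ R k := by
  intro n hn
  rw [coeff_formalDeriv, hf, zero_mul]
  rw [map_add, Finsupp.degree_single]
  omega

/-- A coefficient at a non-zero exponent is, up to a positive integer factor, a coefficient of some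
first derivative, and positive integers are units in a `ℂ`-algebra. -/
theorem mem_degIdeal_succ_of_formalDeriv {k : ℕ} {f : MvPowerSeries σ R}
    (h0 : MvPowerSeries.constantCoeff f = 0) (h : ∀ i, formalDeriv i f ∈ degIdeal σ R k) :
    f ∈ degIdeal σ R (k + 1) := by
  classical
  intro n hn
  by_cases hz : n = 0
  · rw [hz]; exact h0
  obtain ⟨i, hi⟩ : ∃ i, n i ≠ 0 := by
    by_contra hcon
    push Not at hcon
    exact hz (Finsupp.ext hcon)
  have hle : Finsupp.single i 1 ≤ n := by
    rw [Finsupp.single_le_iff]; omega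
  obtain ⟨p, rfl⟩ := exists_add_of_le hle
  rw [add_comm] at hn ⊢
  rw [map_add, Finsupp.degree_single] at hn
  have h1 := h i p (by omega)
  rw [coeff_formalDeriv] at h1
  have h2 : ((p i : R) + 1) = algebraMap ℂ R (p i + 1) := by simp
  have h3 : ((p i : ℂ) + 1) ≠ 0 := Nat.cast_add_one_ne_zero _
  have h4 : IsUnit ((p i : R) + 1) := by
    rw [h2]; exact (IsUnit.mk0 _ h3).map _
  exact (h4.mul_left_eq_zero).1 h1

/-- A family of power series is determined by its constant terms if its first derivatives are
determined, in each degree, by the family up to that degree. -/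
theorem eq_of_formalDeriv_congr {ι : Type} {u u' : ι → MvPowerSeries σ R}
    (h0 : ∀ a, MvPowerSeries.constantCoeff (u a) = MvPowerSeries.constantCoeff (u' a))
    (h : ∀ k, (∀ a, u a - u' a ∈ degIdeal σ R k) →
      ∀ a i, formalDeriv i (u a) - formalDeriv i (u' a) ∈ degIdeal σ R k) : u = u' := by
  have key : ∀ k a, u a - u' a ∈ degIdeal σ R k := by
    intro k
    induction k with
    | zero => exact fun a => mem_degIdeal_zero _
    | succ k ih =>
      intro a
      refine mem_degIdeal_succ_of_formalDeriv (by rw [map_sub, h0, sub_self]) fun i => ?_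
      rw [map_sub]
      exact h k ih a i
  exact funext fun a => eq_of_sub_mem_degIdeal fun k => key k a

end DegreeIdeal

/-! ### Coefficientwise infinite sums -/

section FormalSum

variable {σ R : Type} [CommRing R]

theorem coeff_formalSum {J : Type} (f : J → MvPowerSeries σ R) (n : σ →₀ ℕ) :
    MvPowerSeries.coeff n (formalSum f) = ∑ᶠ j, MvPowerSeries.coeff n (f j) := rfl

/-- Every coefficient receives only finitely many non-zero contributions. -/
def FormallySummable {J : Type} (f : J → MvPowerSeries σ R) : Prop :=
  ∀ n, (Function.support fun j => MvPowerSeries.coeff n (f j)).Finite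

theorem formallySummable_of_finite_support {J : Type} {f : J → MvPowerSeries σ R}
    (h : (Function.support f).Finite) : FormallySummable f := fun n => by
  refine h.subset fun j hj hz => hj ?_
  simp only [hz, map_zero]

theorem formalSum_zero {J : Type} : formalSum (fun _ : J => (0 : MvPowerSeries σ R)) = 0 := by
  ext n; simp [coeff_formalSum]

theorem formalSum_eq_sum {J : Type} {f : J → MvPowerSeries σ R} (s : Finset J)
    (h : ∀ j ∉ s, f j = 0) : formalSum f = ∑ j ∈ s, f j := by
  ext n
  rw [coeff_formalSum, map_sum]
  refine finsum_eq_sum_of_support_subset _ fun j hj => ?_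
  by_contra hjs
  exact hj (by simp only [h j hjs, map_zero])

theorem formalSum_sum {J J' : Type} {f : J ⊕ J' → MvPowerSeries σ R}
    (h : FormallySummable fun j => f (.inl j)) (h' : FormallySummable fun j => f (.inr j)) :
    formalSum f = formalSum (fun j => f (.inl j)) + formalSum fun j => f (.inr j) := by
  classical
  ext n
  rw [map_add, coeff_formalSum, coeff_formalSum, coeff_formalSum]
  have e : (Function.support fun j => MvPowerSeries.coeff n (f j)) ⊆
      ((h n).toFinset.disjSum (h' n).toFinset : Finset (J ⊕ J')) := by
    rintro (j | j) hj <;> simpa using hj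
  rw [finsum_eq_sum_of_support_subset _ e, Finset.sum_disjSum,
    finsum_eq_sum_of_support_subset _ (s := (h n).toFinset) (by simp),
    finsum_eq_sum_of_support_subset _ (s := (h' n).toFinset) (by simp)]

theorem FormallySummable.sumElim {J J' : Type} {f : J ⊕ J' → MvPowerSeries σ R}
    (h : FormallySummable fun j => f (.inl j)) (h' : FormallySummable fun j => f (.inr j)) :
    FormallySummable f := fun n => by
  refine (((h n).image Sum.inl).union ((h' n).image Sum.inr)).subset ?_
  rintro (j | j) hj
  · exact Or.inl ⟨j, hj, rfl⟩
  · exact Or.inr ⟨j, hj, rfl⟩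

theorem formalSum_prod {A B : Type} {f : A × B → MvPowerSeries σ R} (h : FormallySummable f) :
    formalSum f = formalSum fun a => formalSum fun b => f (a, b) := by
  ext n
  rw [coeff_formalSum, finsum_curry _ (h n)]
  rfl

end FormalSum

/-! ### Taylor expansion with power series increments -/

section Taylor

variable {κ : Type} [Fintype κ] [DecidableEq κ] {𝒪 : FunctionSpace κ}

theorem coeff_dDesc_zero (γ : κ) (f : Desc 𝒪) (n : κ × ℕ →₀ ℕ) :
    MvPowerSeries.coeff n (dDesc (γ, 0) f) = 𝒪.D γ (MvPowerSeries.coeff n f) := rfl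

theorem dDesc_zero_C (γ : κ) (f : 𝒪.carrier) :
    dDesc (𝒪 := 𝒪) (γ, 0) (MvPowerSeries.C f) = MvPowerSeries.C (𝒪.D γ f) := by
  ext n
  rw [coeff_dDesc_zero, MvPowerSeries.coeff_C, MvPowerSeries.coeff_C]
  split_ifs <;> simp

theorem dDesc_succ_C (γ : κ) (k : ℕ) (f : 𝒪.carrier) :
    dDesc (𝒪 := 𝒪) (γ, k + 1) (MvPowerSeries.C f) = 0 :=
  MvPowerSeries.pderiv_C

/-- The `n`-th term `(1/n!) ∑ ∏ h^{αᵢ} ∂_{α₁} ⋯ ∂_{αₙ} f` of the Taylor expansion of `f`. -/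
def taylorTerm (h : κ → Desc 𝒪) : ℕ → 𝒪.carrier → Desc 𝒪
  | 0, f => MvPowerSeries.C f
  | n + 1, f => ((n + 1 : ℂ)⁻¹) • ∑ γ, h γ * taylorTerm h n (𝒪.D γ f)

theorem sum_mul_taylorTerm (h : κ → Desc 𝒪) (n : ℕ) (f : 𝒪.carrier) :
    ∑ γ, h γ * taylorTerm h n (𝒪.D γ f) = (n + 1 : ℂ) • taylorTerm h (n + 1) f := by
  rw [taylorTerm, smul_smul, mul_inv_cancel₀ (Nat.cast_add_one_ne_zero n), one_smul]

theorem taylorTerm_add (h : κ → Desc 𝒪) (n : ℕ) : ∀ f g : 𝒪.carrier,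
    taylorTerm h n (f + g) = taylorTerm h n f + taylorTerm h n g := by
  induction n with
  | zero => intro f g; exact map_add _ f g
  | succ n ih =>
    intro f g
    simp only [taylorTerm, map_add, ih, mul_add, Finset.sum_add_distrib, smul_add]

theorem taylorTerm_zero (h : κ → Desc 𝒪) (n : ℕ) : taylorTerm h n (0 : 𝒪.carrier) = 0 := by
  have := taylorTerm_add h n 0 0
  simpa using this

theorem taylorTerm_succ_algebraMap (h : κ → Desc 𝒪) (n : ℕ) (c : ℂ) :
    taylorTerm h (n + 1) (algebraMap ℂ 𝒪.carrier c) = 0 := by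
  simp [taylorTerm, taylorTerm_zero]

/-- Multiply by `n + 1`: the recursion and the Leibniz rule give the products of Taylor terms with
weights `p.1` and `p.2`, whose sum is `n + 1`. -/
theorem taylorTerm_mul (h : κ → Desc 𝒪) (n : ℕ) : ∀ f g : 𝒪.carrier,
    taylorTerm h n (f * g) =
      ∑ p ∈ Finset.HasAntidiagonal.antidiagonal n, taylorTerm h p.1 f * taylorTerm h p.2 g := by
  induction n with
  | zero => intro f g; simp [taylorTerm]
  | succ n ih =>
    intro f g
    have hne : (n + 1 : ℂ) ≠ 0 := Nat.cast_add_one_ne_zero n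
    refine (smul_right_injective (Desc 𝒪) hne) ?_
    change (n + 1 : ℂ) • _ = (n + 1 : ℂ) • _
    rw [← sum_mul_taylorTerm]
    have e1 : ∀ γ, h γ * taylorTerm h n (𝒪.D γ (f * g)) =
        (∑ p ∈ Finset.HasAntidiagonal.antidiagonal n,
          taylorTerm h p.1 f * (h γ * taylorTerm h p.2 (𝒪.D γ g))) +
        ∑ p ∈ Finset.HasAntidiagonal.antidiagonal n,
          (h γ * taylorTerm h p.1 (𝒪.D γ f)) * taylorTerm h p.2 g := by
      intro γ
      rw [Derivation.leibniz, smul_eq_mul, smul_eq_mul, mul_comm g, taylorTerm_add, ih, ih,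
        mul_add, Finset.mul_sum, Finset.mul_sum]
      congr 1 <;> refine Finset.sum_congr rfl fun p _ => by ring
    rw [Finset.sum_congr rfl fun γ _ => e1 γ, Finset.sum_add_distrib, Finset.sum_comm,
      Finset.sum_comm (s := Finset.univ) (t := Finset.HasAntidiagonal.antidiagonal n)]
    simp_rw [← Finset.mul_sum, ← Finset.sum_mul, sum_mul_taylorTerm]
    have e2 : ∀ p ∈ Finset.HasAntidiagonal.antidiagonal (n + 1),
        (n + 1 : ℂ) • (taylorTerm h p.1 f * taylorTerm h p.2 g) =
          (p.2 : ℂ) • (taylorTerm h p.1 f * taylorTerm h p.2 g) +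
          (p.1 : ℂ) • (taylorTerm h p.1 f * taylorTerm h p.2 g) := by
      intro p hp
      rw [← add_smul]
      congr 1
      rw [Finset.HasAntidiagonal.mem_antidiagonal] at hp
      rw [← Nat.cast_add, add_comm p.2, hp]
      push_cast; rfl
    rw [Finset.smul_sum, Finset.sum_congr rfl e2, Finset.sum_add_distrib]
    congr 1
    · rw [Finset.Nat.antidiagonal_succ']
      simp
    · rw [Finset.Nat.antidiagonal_succ]
      simp

theorem taylorTerm_mem {h : κ → Desc 𝒪} (hh : ∀ γ, h γ ∈ degIdeal _ _ 1) (n : ℕ) :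
    ∀ f : 𝒪.carrier, taylorTerm h n f ∈ degIdeal _ _ n := by
  induction n with
  | zero => exact fun f => mem_degIdeal_zero _
  | succ n ih =>
    intro f
    refine smul_mem_degIdeal _ (Ideal.sum_mem _ fun γ _ => ?_)
    rw [add_comm]
    exact mul_mem_degIdeal (hh γ) (ih _)

/-- The increments are compared only in the directions on which functions in `𝒮` depend. Taking for
`𝒮` the functions pulled back from `M` makes the `s`-direction irrelevant. -/
theorem taylorTerm_congr {h h' : κ → Desc 𝒪} {k : ℕ} {𝒮 : Set 𝒪.carrier}
    (h𝒮 : ∀ f ∈ 𝒮, ∀ γ, 𝒪.D γ f ∈ 𝒮 ∧ (𝒪.D γ f = 0 ∨ h γ - h' γ ∈ degIdeal _ _ k)) (n : ℕ) :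
    ∀ f ∈ 𝒮, taylorTerm h n f - taylorTerm h' n f ∈ degIdeal _ _ k := by
  induction n with
  | zero => intro f _; simp [taylorTerm]
  | succ n ih =>
    intro f hf
    rw [taylorTerm, taylorTerm, ← smul_sub, ← Finset.sum_sub_distrib]
    refine smul_mem_degIdeal _ (Ideal.sum_mem _ fun γ _ => ?_)
    obtain ⟨h1, h2 | h2⟩ := h𝒮 f hf γ
    · simp [h2, taylorTerm_zero]
    · have e : h γ * taylorTerm h n (𝒪.D γ f) - h' γ * taylorTerm h' n (𝒪.D γ f) =
          h γ * (taylorTerm h n (𝒪.D γ f) - taylorTerm h' n (𝒪.D γ f)) +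
            taylorTerm h' n (𝒪.D γ f) * (h γ - h' γ) := by ring
      rw [e]
      exact Ideal.add_mem _ (Ideal.mul_mem_left _ _ (ih _ h1)) (Ideal.mul_mem_left _ _ h2)

/-- Here `a γ` plays the role of `∂_i t^γ_0`. The first sum comes from moving the base point and
keeps the order, the second from moving the increment and lowers the order by one. Summed over all
orders they combine to `∂_i (t_0 + h)`. -/
theorem dDesc_taylorTerm (h : κ → Desc 𝒪) (i : κ × ℕ) (a : κ → Desc 𝒪)
    (ha : ∀ f : 𝒪.carrier, dDesc (𝒪 := 𝒪) i (MvPowerSeries.C f) =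
      ∑ γ, a γ * MvPowerSeries.C (𝒪.D γ f)) (n : ℕ) :
    ∀ f : 𝒪.carrier, dDesc i (taylorTerm h (n + 1) f) =
      ∑ γ, a γ * taylorTerm h (n + 1) (𝒪.D γ f) + ∑ γ, dDesc i (h γ) * taylorTerm h n (𝒪.D γ f) := by
  induction n with
  | zero =>
    intro f
    simp only [taylorTerm, Nat.cast_zero, zero_add, inv_one, one_smul, map_sum,
      Derivation.leibniz, smul_eq_mul, ha, Finset.sum_add_distrib, Finset.mul_sum]
    congr 1
    · rw [Finset.sum_comm]
      refine Finset.sum_congr rfl fun γ _ => Finset.sum_congr rfl fun δ _ => ?_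
      rw [𝒪.D_comm]; ring
    · exact Finset.sum_congr rfl fun γ _ => mul_comm _ _
  | succ n ih =>
    intro f
    have hne : ((n + 1 : ℕ) + 1 : ℂ) ≠ 0 := Nat.cast_add_one_ne_zero _
    refine (smul_right_injective (Desc 𝒪) hne) ?_
    change ((n + 1 : ℕ) + 1 : ℂ) • _ = ((n + 1 : ℕ) + 1 : ℂ) • _
    rw [← Derivation.map_smul, ← sum_mul_taylorTerm, map_sum]
    simp only [Derivation.leibniz, smul_eq_mul, ih, Finset.sum_add_distrib, mul_add, smul_add,
      Finset.smul_sum]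
    have e1 : ∑ γ, h γ * ∑ δ, a δ * taylorTerm h (n + 1) (𝒪.D δ (𝒪.D γ f)) =
        ∑ δ, ((n + 1 : ℕ) + 1 : ℂ) • (a δ * taylorTerm h (n + 1 + 1) (𝒪.D δ f)) := by
      simp_rw [Finset.mul_sum]
      rw [Finset.sum_comm]
      refine Finset.sum_congr rfl fun δ _ => ?_
      rw [← mul_smul_comm, ← sum_mul_taylorTerm, Finset.mul_sum]
      refine Finset.sum_congr rfl fun γ _ => ?_
      rw [𝒪.D_comm]; ring
    have e2 : ∑ γ, h γ * ∑ δ, dDesc i (h δ) * taylorTerm h n (𝒪.D δ (𝒪.D γ f)) =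
        ∑ δ, (n + 1 : ℂ) • (dDesc i (h δ) * taylorTerm h (n + 1) (𝒪.D δ f)) := by
      simp_rw [Finset.mul_sum]
      rw [Finset.sum_comm]
      refine Finset.sum_congr rfl fun δ _ => ?_
      rw [← mul_smul_comm, ← sum_mul_taylorTerm, Finset.mul_sum]
      refine Finset.sum_congr rfl fun γ _ => ?_
      rw [𝒪.D_comm]; ring
    rw [e1, e2, add_assoc, ← Finset.sum_add_distrib]
    congr 1
    refine Finset.sum_congr rfl fun γ _ => ?_
    push_cast
    rw [mul_comm (taylorTerm h (n + 1) _)]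
    module

/-- The lists of length `n`. -/
def listsOfLength (κ : Type) [Fintype κ] [DecidableEq κ] : ℕ → Finset (List κ)
  | 0 => {[]}
  | n + 1 => (Finset.univ ×ˢ listsOfLength κ n).image fun p => p.1 :: p.2

theorem mem_listsOfLength (n : ℕ) : ∀ l : List κ, l ∈ listsOfLength κ n ↔ l.length = n := by
  induction n with
  | zero => intro l; simp [listsOfLength]
  | succ n ih =>
    rintro (_ | ⟨a, l⟩)
    · simp [listsOfLength]
    · simp [listsOfLength, ih]

theorem sum_listsOfLength_succ {A : Type} [AddCommMonoid A] (n : ℕ) (f : List κ → A) :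
    ∑ l ∈ listsOfLength κ (n + 1), f l = ∑ γ, ∑ l ∈ listsOfLength κ n, f (γ :: l) := by
  rw [listsOfLength, Finset.sum_image, Finset.sum_product]
  rintro ⟨a, l⟩ _ ⟨b, l'⟩ _ h
  simpa using h

theorem foldr_D_comm (γ : κ) (l : List κ) (f : 𝒪.carrier) :
    𝒪.D γ (l.foldr (fun α g => 𝒪.D α g) f) = l.foldr (fun α g => 𝒪.D α g) (𝒪.D γ f) := by
  induction l with
  | nil => rfl
  | cons a l ih => rw [List.foldr_cons, 𝒪.D_comm, ih, List.foldr_cons]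

/-- Since partial derivatives commute, removing the head of the list is the recursion defining
`taylorTerm`. -/
theorem sum_lists_eq_taylorTerm (h : κ → Desc 𝒪) (n : ℕ) : ∀ f : 𝒪.carrier,
    ∑ l ∈ listsOfLength κ n,
      MvPowerSeries.C (l.foldr (fun α g => 𝒪.D α g) f) * (l.map h).prod =
        (n.factorial : ℂ) • taylorTerm h n f := by
  induction n with
  | zero => intro f; simp [listsOfLength, taylorTerm]
  | succ n ih =>
    intro f
    rw [sum_listsOfLength_succ, Nat.factorial_succ]
    push_cast
    rw [mul_comm, mul_smul, ← sum_mul_taylorTerm, Finset.smul_sum]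
    refine Finset.sum_congr rfl fun γ _ => ?_
    rw [← mul_smul_comm, ← ih, Finset.mul_sum]
    refine Finset.sum_congr rfl fun l _ => ?_
    rw [List.foldr_cons, foldr_D_comm, List.map_cons, List.prod_cons]
    ring

/-- The Taylor expansion of `f` with increments `h`. -/
theorem formalSum_list_sub_mem {h : κ → Desc 𝒪} (hh : ∀ γ, h γ ∈ degIdeal _ _ 1)
    (f : 𝒪.carrier) (k : ℕ) :
    formalSum (fun l : List κ => ((l.length.factorial : ℂ)⁻¹) •
      (MvPowerSeries.C (l.foldr (fun α g => 𝒪.D α g) f) * (l.map h).prod)) -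
        ∑ n ∈ Finset.range k, taylorTerm h n f ∈ degIdeal _ _ k := by
  intro m hm
  have hprod : ∀ l : List κ, (l.map h).prod ∈ degIdeal (κ × ℕ) 𝒪.carrier l.length := by
    intro l
    induction l with
    | nil => exact mem_degIdeal_zero _
    | cons a l ih =>
      rw [List.map_cons, List.prod_cons, List.length_cons, add_comm]
      exact mul_mem_degIdeal (hh a) ih
  -- A list of length `n` contributes only in degrees at least `n`, so below degree `k` the sum runs
  -- over lists shorter than `k`.
  rw [map_sub, coeff_formalSum, sub_eq_zero,
    finsum_eq_sum_of_support_subset (s := (Finset.range k).biUnion (listsOfLength κ)),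
    Finset.sum_biUnion, map_sum]
  · refine Finset.sum_congr rfl fun n _ => ?_
    have hne : (n.factorial : ℂ) ≠ 0 := Nat.cast_ne_zero.2 n.factorial_ne_zero
    have : taylorTerm h n f = ((n.factorial : ℂ)⁻¹) • ((n.factorial : ℂ) • taylorTerm h n f) := by
      rw [smul_smul, inv_mul_cancel₀ hne, one_smul]
    rw [this, ← sum_lists_eq_taylorTerm, Finset.smul_sum, map_sum]
    refine Finset.sum_congr rfl fun l hl => ?_
    rw [(mem_listsOfLength n l).1 hl]
  · intro a _ b _ hab
    rw [Function.onFun, Finset.disjoint_left]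
    intro l hl hl'
    rw [mem_listsOfLength] at hl hl'
    exact hab (hl.symm.trans hl')
  · intro l hl
    rw [Finset.coe_biUnion, Set.mem_iUnion₂]
    refine ⟨l.length, ?_, (mem_listsOfLength _ l).2 rfl⟩
    by_contra hcon
    refine hl (smul_mem_degIdeal _ (Ideal.mul_mem_left _ _ (hprod l)) m ?_)
    simp at hcon
    omega

/-! ### Substitution as a ring homomorphism, and the chain rule -/

section Subst

variable {Ω : ℕ → Matrix κ κ 𝒪.carrier} {e : κ} {v : κ → Desc 𝒪}

theorem increment_mem (hv : ∀ α, MvPowerSeries.constantCoeff (v α) = Ω 1 α e) (γ : κ) :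
    v γ - MvPowerSeries.C (Ω 1 γ e) ∈ degIdeal _ _ 1 := by
  rw [mem_degIdeal_one, map_sub, hv, MvPowerSeries.constantCoeff_C, sub_self]

variable (hv : ∀ α, MvPowerSeries.constantCoeff (v α) = Ω 1 α e)
include hv

theorem substAt_sub_mem (f : 𝒪.carrier) (k : ℕ) :
    substAt Ω e v f - ∑ n ∈ Finset.range k,
      taylorTerm (fun γ => v γ - MvPowerSeries.C (Ω 1 γ e)) n f ∈ degIdeal _ _ k :=
  formalSum_list_sub_mem (increment_mem hv) f k

theorem substAt_eq_of_sub_mem {f : 𝒪.carrier} {g : Desc 𝒪}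
    (h : ∀ k, g - ∑ n ∈ Finset.range k,
      taylorTerm (fun γ => v γ - MvPowerSeries.C (Ω 1 γ e)) n f ∈ degIdeal _ _ k) :
    substAt Ω e v f = g :=
  eq_of_sub_mem_degIdeal fun k => by
    have := Ideal.sub_mem _ (substAt_sub_mem hv f k) (h k)
    rwa [sub_sub_sub_cancel_right] at this

theorem substAt_add (f g : 𝒪.carrier) :
    substAt Ω e v (f + g) = substAt Ω e v f + substAt Ω e v g := by
  refine substAt_eq_of_sub_mem hv fun k => ?_
  simp only [taylorTerm_add, Finset.sum_add_distrib, add_sub_add_comm]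
  exact Ideal.add_mem _ (substAt_sub_mem hv f k) (substAt_sub_mem hv g k)

theorem substAt_algebraMap (c : ℂ) :
    substAt Ω e v (algebraMap ℂ 𝒪.carrier c) = algebraMap ℂ (Desc 𝒪) c := by
  refine substAt_eq_of_sub_mem hv fun k => ?_
  cases k with
  | zero => exact mem_degIdeal_zero _
  | succ k =>
    rw [Finset.sum_range_succ', Finset.sum_eq_zero fun n _ => taylorTerm_succ_algebraMap _ n c,
      zero_add, taylorTerm, MvPowerSeries.algebraMap_apply, sub_self]
    exact Ideal.zero_mem _

theorem substAt_mul (f g : 𝒪.carrier) :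
    substAt Ω e v (f * g) = substAt Ω e v f * substAt Ω e v g := by
  refine substAt_eq_of_sub_mem hv fun k => ?_
  set s := taylorTerm (fun γ => v γ - MvPowerSeries.C (Ω 1 γ e)) with hs
  have hs' : ∀ n f, s n f ∈ degIdeal _ _ n := fun n f =>
    taylorTerm_mem (increment_mem hv) n f
  have h1 : substAt Ω e v f * substAt Ω e v g -
      (∑ n ∈ Finset.range k, s n f) * (∑ n ∈ Finset.range k, s n g) ∈ degIdeal _ _ k := by
    have e1 : substAt Ω e v f * substAt Ω e v g -
        (∑ n ∈ Finset.range k, s n f) * (∑ n ∈ Finset.range k, s n g) =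
        substAt Ω e v f * (substAt Ω e v g - ∑ n ∈ Finset.range k, s n g) +
          (∑ n ∈ Finset.range k, s n g) * (substAt Ω e v f - ∑ n ∈ Finset.range k, s n f) := by
      ring
    rw [e1]
    exact Ideal.add_mem _ (Ideal.mul_mem_left _ _ (substAt_sub_mem hv g k))
      (Ideal.mul_mem_left _ _ (substAt_sub_mem hv f k))
  -- Besides the truncated expansion of `f * g`, the product of the truncations contains only terms
  -- with `p.1 + p.2 ≥ k`.
  have h2 : (∑ n ∈ Finset.range k, s n f) * (∑ n ∈ Finset.range k, s n g) -
      ∑ n ∈ Finset.range k, s n (f * g) ∈ degIdeal _ _ k := by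
    simp only [hs, taylorTerm_mul]
    rw [← hs, Finset.sum_mul_sum, ← Finset.sum_product', Finset.sum_sigma',
      ← Finset.sum_filter_add_sum_filter_not _ (fun p : ℕ × ℕ => p.1 + p.2 < k), add_sub_right_comm]
    have e2 : ∑ p ∈ (Finset.range k ×ˢ Finset.range k).filter (fun p => p.1 + p.2 < k),
        s p.1 f * s p.2 g = ∑ x ∈ (Finset.range k).sigma Finset.HasAntidiagonal.antidiagonal,
          s x.2.1 f * s x.2.2 g := by
      refine Finset.sum_bij' (fun p _ => ⟨p.1 + p.2, p⟩) (fun x _ => x.2) ?_ ?_ ?_ ?_ ?_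
      · intro p hp; simp at hp ⊢; omega
      · rintro ⟨n, p⟩ hp; simp at hp ⊢; omega
      · intro p _; rfl
      · rintro ⟨n, p⟩ hp
        simp only [Finset.mem_sigma, Finset.HasAntidiagonal.mem_antidiagonal] at hp
        simp [hp.2]
      · intro p _; rfl
    rw [e2, sub_self, zero_add]
    refine Ideal.sum_mem _ fun p hp => ?_
    simp only [Finset.mem_filter, not_lt] at hp
    exact degIdeal_mono hp.2 (mul_mem_degIdeal (hs' _ _) (hs' _ _))
  have := Ideal.add_mem _ h1 h2
  rwa [sub_add_sub_cancel] at this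

theorem substAt_congr {v' : κ → Desc 𝒪}
    (hv' : ∀ α, MvPowerSeries.constantCoeff (v' α) = Ω 1 α e) {k : ℕ} {𝒮 : Set 𝒪.carrier}
    (h𝒮 : ∀ f ∈ 𝒮, ∀ γ, 𝒪.D γ f ∈ 𝒮 ∧ (𝒪.D γ f = 0 ∨ v γ - v' γ ∈ degIdeal _ _ k))
    {f : 𝒪.carrier} (hf : f ∈ 𝒮) : substAt Ω e v f - substAt Ω e v' f ∈ degIdeal _ _ k := by
  have h1 := substAt_sub_mem hv f k
  have h2 := substAt_sub_mem hv' f k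
  have h3 : ∑ n ∈ Finset.range k, taylorTerm (fun γ => v γ - MvPowerSeries.C (Ω 1 γ e)) n f -
      ∑ n ∈ Finset.range k, taylorTerm (fun γ => v' γ - MvPowerSeries.C (Ω 1 γ e)) n f ∈
        degIdeal _ _ k := by
    rw [← Finset.sum_sub_distrib]
    refine Ideal.sum_mem _ fun n _ => taylorTerm_congr (𝒮 := 𝒮) (fun f hf γ => ?_) n f hf
    rw [sub_sub_sub_cancel_right]
    exact h𝒮 f hf γ
  have := Ideal.sub_mem _ (Ideal.add_mem _ h1 h3) h2
  convert this using 1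
  ring

/-- `f ↦ f|_{t = v}` as a ring homomorphism. -/
def substHom : 𝒪.carrier →+* Desc 𝒪 where
  toFun := substAt Ω e v
  map_one' := by simpa using substAt_algebraMap hv 1
  map_mul' := substAt_mul hv
  map_zero' := by simpa using substAt_algebraMap hv 0
  map_add' := substAt_add hv

theorem substHom_smul (c : ℂ) (f : 𝒪.carrier) :
    substHom hv (c • f) = c • substHom hv f := by
  rw [Algebra.smul_def, map_mul, Algebra.smul_def]
  congr 1
  exact substAt_algebraMap hv c

variable (hT : ∀ γ α, 𝒪.D γ (Ω 1 α e) = if α = γ then 1 else 0)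
include hT

theorem dDesc_C (i : κ × ℕ) (f : 𝒪.carrier) :
    dDesc (𝒪 := 𝒪) i (MvPowerSeries.C f) =
      ∑ γ, dDesc (𝒪 := 𝒪) i (MvPowerSeries.C (Ω 1 γ e)) * MvPowerSeries.C (𝒪.D γ f) := by
  obtain ⟨β, _ | k⟩ := i
  · simp [dDesc_zero_C, hT]
  · simp [dDesc_succ_C]

/-- The chain rule. -/
theorem dDesc_substHom (i : κ × ℕ) (f : 𝒪.carrier) :
    dDesc i (substHom hv f) = ∑ γ, dDesc i (v γ) * substHom hv (𝒪.D γ f) := by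
  refine eq_of_sub_mem_degIdeal fun k => ?_
  set h := fun γ => v γ - MvPowerSeries.C (Ω 1 γ e) with hh
  -- A formal derivative costs one degree, so the expansion is cut at order `k + 1` in order to
  -- control its derivative below degree `k`.
  have hd : ∀ {k : ℕ} {g : Desc 𝒪}, g ∈ degIdeal _ _ (k + 1) → dDesc i g ∈ degIdeal _ _ k := by
    intro k g hg
    obtain ⟨β, _ | l⟩ := i
    · exact degIdeal_mono (Nat.le_succ k) (coeffDeriv_mem_degIdeal _ hg)
    · exact formalDeriv_mem_degIdeal _ hg
  have h1 := hd (substAt_sub_mem hv f (k + 1))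
  rw [map_sub, map_sum, Finset.sum_range_succ'] at h1
  simp only [← hh] at h1
  simp only [dDesc_taylorTerm h i _ (dDesc_C hv hT i)] at h1
  have h0 : dDesc i (taylorTerm h 0 f) =
      ∑ γ, dDesc (𝒪 := 𝒪) i (MvPowerSeries.C (Ω 1 γ e)) * taylorTerm h 0 (𝒪.D γ f) :=
    dDesc_C hv hT i f
  have h2 : ∑ n ∈ Finset.range k,
      (∑ γ, dDesc (𝒪 := 𝒪) i (MvPowerSeries.C (Ω 1 γ e)) * taylorTerm h (n + 1) (𝒪.D γ f) +
        ∑ γ, dDesc i (h γ) * taylorTerm h n (𝒪.D γ f)) + dDesc i (taylorTerm h 0 f) =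
      ∑ γ, (dDesc (𝒪 := 𝒪) i (MvPowerSeries.C (Ω 1 γ e)) *
        (∑ n ∈ Finset.range (k + 1), taylorTerm h n (𝒪.D γ f)) +
          dDesc i (h γ) * ∑ n ∈ Finset.range k, taylorTerm h n (𝒪.D γ f)) := by
    rw [h0, Finset.sum_add_distrib, add_right_comm, Finset.sum_add_distrib]
    congr 1
    · rw [Finset.sum_comm, ← Finset.sum_add_distrib]
      refine Finset.sum_congr rfl fun γ _ => ?_
      rw [Finset.sum_range_succ', mul_add, Finset.mul_sum]
    · rw [Finset.sum_comm]
      exact Finset.sum_congr rfl fun γ _ => (Finset.mul_sum _ _ _).symm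
  rw [h2] at h1
  have h3 : ∑ γ, (dDesc (𝒪 := 𝒪) i (MvPowerSeries.C (Ω 1 γ e)) *
        (∑ n ∈ Finset.range (k + 1), taylorTerm h n (𝒪.D γ f)) +
          dDesc i (h γ) * ∑ n ∈ Finset.range k, taylorTerm h n (𝒪.D γ f)) -
      ∑ γ, dDesc i (v γ) * substHom hv (𝒪.D γ f) ∈ degIdeal _ _ k := by
    rw [← Finset.sum_sub_distrib]
    refine Ideal.sum_mem _ fun γ _ => ?_
    have e1 : dDesc i (v γ) = dDesc (𝒪 := 𝒪) i (MvPowerSeries.C (Ω 1 γ e)) + dDesc i (h γ) := by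
      rw [← map_add]; simp [hh]
    have h4 := degIdeal_mono (Nat.le_succ k) (substAt_sub_mem hv (𝒪.D γ f) (k + 1))
    have h5 := substAt_sub_mem hv (𝒪.D γ f) k
    have := Ideal.neg_mem_iff _ |>.2 (Ideal.add_mem _
      (Ideal.mul_mem_left _ (dDesc (𝒪 := 𝒪) i (MvPowerSeries.C (Ω 1 γ e))) h4)
      (Ideal.mul_mem_left _ (dDesc i (h γ)) h5))
    convert this using 1
    rw [e1]
    change _ = -(_ * (substHom hv _ - _) + _ * (substHom hv _ - _))
    ring
  have := Ideal.add_mem _ h1 h3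
  rwa [sub_add_sub_cancel] at this

theorem substHom_coord (α : κ) : substHom hv (Ω 1 α e) = v α := by
  refine substAt_eq_of_sub_mem hv fun k => ?_
  rcases k with _ | _ | k
  · exact mem_degIdeal_zero _
  · rw [Finset.sum_range_one]
    exact increment_mem hv α
  -- First derivatives of a flat coordinate are constants, so its expansion stops at order one.
  · have h0 : ∀ n, taylorTerm (fun γ => v γ - MvPowerSeries.C (Ω 1 γ e)) (n + 2) (Ω 1 α e) = 0 := by
      intro n
      rw [taylorTerm, Finset.sum_eq_zero, smul_zero]
      intro γ _
      have : 𝒪.D γ (Ω 1 α e) = algebraMap ℂ 𝒪.carrier (if α = γ then 1 else 0) := by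
        rw [hT]; split_ifs <;> simp
      rw [this, taylorTerm_succ_algebraMap, mul_zero]
    rw [Finset.sum_range_succ', Finset.sum_range_succ', Finset.sum_eq_zero fun n _ => h0 n]
    simp [taylorTerm, hT]

end Subst

end Taylor

/-! ### Sums against the dilaton-shifted variables -/

section ShiftedSum

variable {κ : Type} [Fintype κ] [DecidableEq κ] {𝒪 : FunctionSpace κ}

/-- The variables that can contribute to the monomial `n` of `∑ 𝕥_j g_j`. -/
def activeVars (e : κ) (n : κ × ℕ →₀ ℕ) : Finset (κ × ℕ) :=
  Finset.univ.image (fun α => (α, 0)) ∪ {(e, 1)} ∪ n.support.image fun j => (j.1, j.2 + 1)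

/-- Apart from the `t^α_0` and the dilaton-shifted variable `(e, 1)`, each `𝕥_j` is a formal
variable and must divide the monomial `n`. The index shift in `activeVars` is due to `X (α, k)`
being `t^α_{k+1}`. -/
theorem coeff_shifted_mul_eq_zero (Ω : ℕ → Matrix κ κ 𝒪.carrier) (e : κ) {n : κ × ℕ →₀ ℕ}
    {j : κ × ℕ} (hj : j ∉ activeVars e n) (g : Desc 𝒪) :
    MvPowerSeries.coeff n (shifted Ω e j * g) = 0 := by
  classical
  obtain ⟨α, _ | k⟩ := j
  · exact absurd (by simp [activeVars]) hj
  · have h1 : ¬(α = e ∧ k = 0) := by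
      rintro ⟨rfl, rfl⟩
      exact hj (by simp [activeVars])
    have h2 : n (α, k) = 0 := by
      by_contra hne
      refine hj (Finset.mem_union_right _ (Finset.mem_image.2 ⟨(α, k), ?_, rfl⟩))
      exact Finsupp.mem_support_iff.2 hne
    rw [shifted, if_neg h1, sub_zero, MvPowerSeries.X, MvPowerSeries.coeff_monomial_mul, if_neg]
    rw [Finsupp.single_le_iff]
    omega

theorem formallySummable_shifted (Ω : ℕ → Matrix κ κ 𝒪.carrier) (e : κ) {A B : Type}
    {ι : A → κ × ℕ} (hι : Function.Injective ι) (g : A → B → Desc 𝒪)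
    (hg : ∀ a, (Function.support (g a)).Finite) :
    FormallySummable fun p : A × B => shifted Ω e (ι p.1) * g p.1 p.2 := fun n => by
  have hA : (ι ⁻¹' (activeVars e n : Set (κ × ℕ))).Finite :=
    (Finset.finite_toSet _).preimage hι.injOn
  refine (hA.biUnion fun a _ => (hg a).image fun b => (a, b)).subset ?_
  rintro ⟨a, b⟩ hab
  refine Set.mem_iUnion₂.2 ⟨a, ?_, b, ?_, rfl⟩
  · by_contra hcon
    exact hab (coeff_shifted_mul_eq_zero Ω e hcon _)
  · intro hz
    exact hab (by simp only [hz, mul_zero, map_zero])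

theorem formallySummable_shifted_single (Ω : ℕ → Matrix κ κ 𝒪.carrier) (e : κ) {A : Type}
    {ι : A → κ × ℕ} (hι : Function.Injective ι) (g : A → Desc 𝒪) :
    FormallySummable fun a : A => shifted Ω e (ι a) * g a := fun n => by
  have hA : (ι ⁻¹' (activeVars e n : Set (κ × ℕ))).Finite :=
    (Finset.finite_toSet _).preimage hι.injOn
  refine hA.subset fun a ha => ?_
  by_contra hcon
  exact ha (coeff_shifted_mul_eq_zero Ω e hcon _)

theorem formallySummable_shifted_shifted (Ω : ℕ → Matrix κ κ 𝒪.carrier) (e : κ)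
    (g : κ × ℕ → κ × ℕ → Desc 𝒪) :
    FormallySummable fun p : (κ × ℕ) × (κ × ℕ) =>
      shifted Ω e p.1 * shifted Ω e p.2 * g p.1 p.2 := fun n => by
  refine ((activeVars e n ×ˢ activeVars e n).finite_toSet).subset ?_
  rintro ⟨a, b⟩ hab
  rw [Finset.coe_product]
  constructor
  · by_contra hcon
    exact hab (by simpa only [mul_assoc] using coeff_shifted_mul_eq_zero Ω e hcon _)
  · by_contra hcon
    exact hab (by simpa only [mul_assoc, mul_left_comm (shifted Ω e a)] using
      coeff_shifted_mul_eq_zero Ω e hcon _)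

variable (Ω : ℕ → Matrix κ κ 𝒪.carrier) (e : κ)

/-- `∑_j 𝕥_j g_j`. -/
def shiftedSum (g : κ × ℕ → Desc 𝒪) : Desc 𝒪 := formalSum fun j => shifted Ω e j * g j

theorem coeff_shiftedSum (g : κ × ℕ → Desc 𝒪) (n : κ × ℕ →₀ ℕ) {s : Finset (κ × ℕ)}
    (hs : activeVars e n ⊆ s) : MvPowerSeries.coeff n (shiftedSum Ω e g) =
      ∑ j ∈ s, MvPowerSeries.coeff n (shifted Ω e j * g j) := by
  rw [shiftedSum, coeff_formalSum]
  refine finsum_eq_sum_of_support_subset _ fun j hj => ?_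
  by_contra hcon
  exact hj (coeff_shifted_mul_eq_zero Ω e (fun h => hcon (hs h)) _)

theorem shiftedSum_add (g g' : κ × ℕ → Desc 𝒪) :
    shiftedSum Ω e (fun j => g j + g' j) = shiftedSum Ω e g + shiftedSum Ω e g' := by
  ext n
  rw [map_add, coeff_shiftedSum Ω e _ n subset_rfl, coeff_shiftedSum Ω e _ n subset_rfl,
    coeff_shiftedSum Ω e _ n subset_rfl, ← Finset.sum_add_distrib]
  simp only [mul_add, map_add]

theorem shiftedSum_zero : shiftedSum Ω e (fun _ => (0 : Desc 𝒪)) = 0 := by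
  simp only [shiftedSum, mul_zero, formalSum_zero]

theorem shiftedSum_sum {ι : Type} (s : Finset ι) (g : ι → κ × ℕ → Desc 𝒪) :
    shiftedSum Ω e (fun j => ∑ i ∈ s, g i j) = ∑ i ∈ s, shiftedSum Ω e (g i) := by
  classical
  induction s using Finset.induction_on with
  | empty => simp [shiftedSum_zero]
  | insert a s ha ih => simp only [Finset.sum_insert ha, shiftedSum_add, ih]

theorem shiftedSum_mul_left (f : Desc 𝒪) (g : κ × ℕ → Desc 𝒪) :
    shiftedSum Ω e (fun j => f * g j) = f * shiftedSum Ω e g := by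
  classical
  ext n
  rw [MvPowerSeries.coeff_mul]
  -- One finite index set valid for all second factors, so that the two sums can be exchanged.
  set s := (Finset.HasAntidiagonal.antidiagonal n).biUnion fun p => activeVars e p.2
  rw [coeff_shiftedSum Ω e _ n (s := activeVars e n ∪ s) Finset.subset_union_left]
  have h1 : ∀ p ∈ Finset.HasAntidiagonal.antidiagonal n,
      MvPowerSeries.coeff p.1 f * MvPowerSeries.coeff p.2 (shiftedSum Ω e g) =
      ∑ j ∈ activeVars e n ∪ s, MvPowerSeries.coeff p.1 f *
        MvPowerSeries.coeff p.2 (shifted Ω e j * g j) := by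
    intro p hp
    rw [coeff_shiftedSum Ω e g p.2 (s := activeVars e n ∪ s), Finset.mul_sum]
    exact (Finset.subset_biUnion_of_mem (fun p : (κ × ℕ →₀ ℕ) × (κ × ℕ →₀ ℕ) =>
      activeVars e p.2) hp).trans Finset.subset_union_right
  rw [Finset.sum_congr rfl h1, Finset.sum_comm]
  refine Finset.sum_congr rfl fun j _ => ?_
  rw [mul_left_comm, MvPowerSeries.coeff_mul]

theorem shiftedSum_neg (g : κ × ℕ → Desc 𝒪) :
    shiftedSum Ω e (fun j => -g j) = -shiftedSum Ω e g := by
  have := shiftedSum_mul_left Ω e (-1) g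
  simpa using this

theorem dDesc_shifted (hT : ∀ γ α, 𝒪.D γ (Ω 1 α e) = if α = γ then 1 else 0) (i j : κ × ℕ) :
    dDesc i (shifted Ω e j) = if i = j then 1 else 0 := by
  obtain ⟨β, _ | k⟩ := i <;> obtain ⟨α, _ | l⟩ := j
  · rw [shifted, dDesc_zero_C, hT]
    by_cases h : α = β
    · simp [h]
    · simp [h, Ne.symm h]
  · rw [shifted, map_sub]
    have h1 : dDesc (𝒪 := 𝒪) (β, 0) (MvPowerSeries.X (α, l)) = 0 := by
      classical
      ext n
      rw [coeff_dDesc_zero, MvPowerSeries.coeff_X]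
      split_ifs <;> simp
    rw [h1]
    split_ifs <;> simp_all
  · rw [shifted, dDesc_succ_C]
    simp
  · rw [shifted, map_sub]
    have h1 : dDesc (𝒪 := 𝒪) (β, k + 1) (MvPowerSeries.X (α, l)) =
        if (β, k) = (α, l) then 1 else 0 := by
      classical
      refine (MvPowerSeries.pderiv_X _ _).trans ?_
      rw [Pi.single_apply]
      simp only [eq_comm]
    rw [h1]
    split_ifs <;> simp_all

theorem dDesc_succ_shiftedSum (β : κ) (k : ℕ) (g : κ × ℕ → Desc 𝒪) :
    dDesc (β, k + 1) (shiftedSum Ω e g) =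
      formalSum fun j => dDesc (β, k + 1) (shifted Ω e j * g j) := by
  ext n
  have h := coeff_shiftedSum Ω e g (n + Finsupp.single (β, k) 1) subset_rfl
  change MvPowerSeries.coeff n (formalDeriv (β, k) _) = _
  rw [coeff_formalDeriv, h, coeff_formalSum, Finset.sum_mul,
    finsum_eq_sum_of_support_subset (s := activeVars e (n + Finsupp.single (β, k) 1))]
  · exact Finset.sum_congr rfl fun j _ => (coeff_formalDeriv _ _ _).symm
  · intro j hj
    by_contra hcon
    refine hj ((coeff_formalDeriv _ _ _).trans ?_)
    rw [coeff_shifted_mul_eq_zero Ω e hcon, zero_mul]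

theorem dDesc_zero_shiftedSum (β : κ) (g : κ × ℕ → Desc 𝒪) :
    dDesc (β, 0) (shiftedSum Ω e g) =
      formalSum fun j => dDesc (β, 0) (shifted Ω e j * g j) := by
  ext n
  rw [coeff_dDesc_zero, coeff_shiftedSum Ω e g n subset_rfl, coeff_formalSum, map_sum,
    finsum_eq_sum_of_support_subset (s := activeVars e n)]
  · rfl
  · intro j hj
    by_contra hcon
    refine hj ?_
    change MvPowerSeries.coeff n (dDesc (β, 0) (shifted Ω e j * g j)) = 0
    rw [coeff_dDesc_zero, coeff_shifted_mul_eq_zero Ω e hcon, map_zero]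

theorem dDesc_shiftedSum (hT : ∀ γ α, 𝒪.D γ (Ω 1 α e) = if α = γ then 1 else 0) (i : κ × ℕ)
    (g : κ × ℕ → Desc 𝒪) :
    dDesc i (shiftedSum Ω e g) = g i + shiftedSum Ω e fun j => dDesc i (g j) := by
  have h1 : dDesc i (shiftedSum Ω e g) = formalSum fun j => dDesc i (shifted Ω e j * g j) := by
    obtain ⟨β, _ | k⟩ := i
    · exact dDesc_zero_shiftedSum Ω e β g
    · exact dDesc_succ_shiftedSum Ω e β k g
  rw [h1]
  ext n
  -- The index `i` may be inactive for the monomial `n`, yet the explicit derivative `∂_i 𝕥_i = 1`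
  -- leaves the term `g i`.
  have hs : activeVars e n ⊆ insert i (activeVars e n) := Finset.subset_insert _ _
  rw [map_add, coeff_shiftedSum Ω e _ n hs, coeff_formalSum,
    finsum_eq_sum_of_support_subset (s := insert i (activeVars e n))]
  · simp only [Derivation.leibniz, smul_eq_mul, dDesc_shifted Ω e hT, map_add,
      Finset.sum_add_distrib]
    rw [add_comm]
    congr 1
    rw [Finset.sum_eq_single i]
    · simp
    · intro j _ hj
      simp [Ne.symm hj]
    · intro h
      exact absurd (Finset.mem_insert_self _ _) h
  · intro j hj
    by_contra hcon
    rw [Finset.mem_coe, Finset.mem_insert, not_or] at hcon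
    refine hj ?_
    change MvPowerSeries.coeff n (dDesc i (shifted Ω e j * g j)) = 0
    rw [Derivation.leibniz, smul_eq_mul, smul_eq_mul, dDesc_shifted Ω e hT,
      if_neg (Ne.symm hcon.1), mul_zero, add_zero, coeff_shifted_mul_eq_zero Ω e hcon.2]

end ShiftedSum

/-! ### Flat F-manifolds and the Euler-Lagrange equation -/

section Flat

variable {κ : Type} [Fintype κ] [DecidableEq κ] {𝒪 : FunctionSpace κ}

/-- `c α β γ = c^α_{βγ}` are the structure constants of a flat F-manifold with unit `∂_e`, and
`Ω` is a calibration of it. -/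
structure IsFlat (Ω : ℕ → Matrix κ κ 𝒪.carrier) (e : κ) (c : κ → κ → κ → 𝒪.carrier) : Prop where
  symm : ∀ α β γ, c α β γ = c α γ β
  comm : ∀ α β γ δ, ∑ μ, c α β μ * c μ γ δ = ∑ μ, c α γ μ * c μ β δ
  unit : ∀ α γ, c α e γ = if α = γ then 1 else 0
  Ω_zero : Ω 0 = 1
  D_Ω : ∀ k α β γ, 𝒪.D γ (Ω (k + 1) α β) = ∑ μ, c α γ μ * Ω k μ β

variable {Ω : ℕ → Matrix κ κ 𝒪.carrier} {e : κ} {c : κ → κ → κ → 𝒪.carrier}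

theorem IsFlat.D_coord (H : IsFlat Ω e c) (γ α : κ) :
    𝒪.D γ (Ω 1 α e) = if α = γ then 1 else 0 := by
  rw [← zero_add 1, H.D_Ω, H.Ω_zero]
  simp [Matrix.one_apply, H.symm α γ e, H.unit]

/-- The two corrections remove the dilaton shift and the terms with `t^α_0`. Every remaining term
carries a formal variable `t^α_d`, `d ≥ 1`, and so gains one degree. -/
theorem shiftedSum_sub_mem_succ {g : κ × ℕ → Desc 𝒪} {k : ℕ}
    (hg : ∀ α d, g (α, d + 1) ∈ degIdeal _ _ k) :
    shiftedSum Ω e g + g (e, 1) - ∑ α, MvPowerSeries.C (Ω 1 α e) * g (α, 0) ∈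
      degIdeal _ _ (k + 1) := by
  classical
  intro n hn
  have h1 : (e, 1) ∈ activeVars e n := by simp [activeVars]
  have h2 : ∑ j ∈ activeVars e n, MvPowerSeries.coeff n (if j = (e, 1) then g j else 0) =
      MvPowerSeries.coeff n (g (e, 1)) := by
    rw [Finset.sum_eq_single_of_mem _ h1]
    · simp
    · intro j _ hj; simp [hj]
  have h3 : ∑ j ∈ activeVars e n, MvPowerSeries.coeff n
      (if j.2 = 0 then MvPowerSeries.C (Ω 1 j.1 e) * g j else 0) =
      MvPowerSeries.coeff n (∑ α, MvPowerSeries.C (Ω 1 α e) * g (α, 0)) := by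
    rw [map_sum, ← Finset.sum_subset (s₁ := Finset.univ.image fun α => (α, 0))]
    · rw [Finset.sum_image (fun a _ b _ h => by simpa using h)]
      simp
    · intro j hj
      exact Finset.mem_union_left _ (Finset.mem_union_left _ hj)
    · intro j _ hj
      rw [if_neg, map_zero]
      intro h
      exact hj (Finset.mem_image.2 ⟨j.1, Finset.mem_univ _, Prod.ext rfl h.symm⟩)
  rw [map_sub, map_add, coeff_shiftedSum Ω e g n subset_rfl, ← h2, ← h3,
    ← Finset.sum_add_distrib, ← Finset.sum_sub_distrib]
  refine Finset.sum_eq_zero fun j _ => ?_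
  obtain ⟨α, _ | d⟩ := j
  · simp [shifted]
  · have h4 : shifted Ω e (α, d + 1) * g (α, d + 1) +
        (if (α, d + 1) = (e, 1) then g (α, d + 1) else 0) =
        MvPowerSeries.X (α, d) * g (α, d + 1) := by
      by_cases h : α = e ∧ d = 0
      · simp [shifted, h]; ring
      · have : (α, d + 1) ≠ (e, 1) := by simpa using h
        simp [shifted, h]
    rw [← map_add, h4]
    simp only [Nat.succ_ne_zero, if_false, map_zero, sub_zero]
    have := mul_mem_degIdeal (X_mem_degIdeal (R := 𝒪.carrier) (α, d)) (hg α d)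
    rw [add_comm] at this
    exact this n hn

/-- The left-hand side `∑ 𝕥^β_d Ω^α_{β,d-1}|_{t=v}` of the Euler–Lagrange equation. -/
def eulerLagrange (Ω : ℕ → Matrix κ κ 𝒪.carrier) (e : κ) (v : κ → Desc 𝒪) (α : κ) : Desc 𝒪 :=
  shiftedSum Ω e fun j => substAt Ω e v (Ω j.2 α j.1)

theorem eulerLagrange_add_mem (H : IsFlat Ω e c) {v : κ → Desc 𝒪}
    (hv : ∀ α, MvPowerSeries.constantCoeff (v α) = Ω 1 α e) (α : κ) :
    eulerLagrange Ω e v α + v α - MvPowerSeries.C (Ω 1 α e) ∈ degIdeal _ _ 1 := by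
  have h := shiftedSum_sub_mem_succ (Ω := Ω) (e := e) (k := 0)
    (g := fun j => substHom hv (Ω j.2 α j.1)) fun α d => mem_degIdeal_zero _
  have h2 : ∑ β, MvPowerSeries.C (Ω 1 β e) * substHom hv (Ω 0 α β) =
      MvPowerSeries.C (Ω 1 α e) := by
    rw [Finset.sum_eq_single α]
    · simp [H.Ω_zero]
    · intro β _ hβ
      simp [H.Ω_zero, Matrix.one_apply_ne' hβ]
    · simp
  rw [h2, substHom_coord hv H.D_coord] at h
  exact h

/-- Because `Ω 0 = 1` and `Ω 1 α e` is the coordinate `t^α`, the expression `eulerLagrange Ω e v α +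
v α` equals `t^α_0` plus terms in which a function of `v` is multiplied by some `t^β_d`, `d ≥ 1`.
The map `v ↦ eulerLagrange Ω e v + v` is thus a contraction for the degree filtration, and its fixed
points are the solutions. -/
theorem eulerLagrange_contract (H : IsFlat Ω e c) {v v' : κ → Desc 𝒪}
    (hv : ∀ α, MvPowerSeries.constantCoeff (v α) = Ω 1 α e)
    (hv' : ∀ α, MvPowerSeries.constantCoeff (v' α) = Ω 1 α e) {k : ℕ}
    (h : ∀ α, v α - v' α ∈ degIdeal _ _ k) (α : κ) :
    (eulerLagrange Ω e v α + v α) - (eulerLagrange Ω e v' α + v' α) ∈ degIdeal _ _ (k + 1) := by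
  have h1 := shiftedSum_sub_mem_succ (Ω := Ω) (e := e) (k := k)
    (g := fun j => substHom hv (Ω j.2 α j.1) - substHom hv' (Ω j.2 α j.1)) fun β d =>
      substAt_congr hv hv' (𝒮 := Set.univ) (fun f _ γ => ⟨trivial, Or.inr (h γ)⟩) trivial
  have h2 : ∑ β, MvPowerSeries.C (Ω 1 β e) * (substHom hv (Ω 0 α β) - substHom hv' (Ω 0 α β)) =
      0 := by
    refine Finset.sum_eq_zero fun β _ => ?_
    rw [H.Ω_zero, Matrix.one_apply]
    split_ifs <;> simp
  have h3 : shiftedSum Ω e (fun j => substHom hv (Ω j.2 α j.1) - substHom hv' (Ω j.2 α j.1)) =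
      eulerLagrange Ω e v α - eulerLagrange Ω e v' α := by
    simp only [sub_eq_add_neg, shiftedSum_add, shiftedSum_neg]
    rfl
  rw [h2, h3, substHom_coord hv H.D_coord, substHom_coord hv' H.D_coord, sub_zero] at h1
  convert h1 using 1
  ring

/-- The approximations to the solution of the Euler–Lagrange equation. -/
def eulerLagrangeIter (Ω : ℕ → Matrix κ κ 𝒪.carrier) (e : κ) : ℕ → κ → Desc 𝒪
  | 0 => fun α => MvPowerSeries.C (Ω 1 α e)
  | k + 1 => fun α => eulerLagrange Ω e (eulerLagrangeIter Ω e k) α + eulerLagrangeIter Ω e k α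

theorem exists_eulerLagrange (H : IsFlat Ω e c) : ∃ v : κ → Desc 𝒪,
    (∀ α, MvPowerSeries.constantCoeff (v α) = Ω 1 α e) ∧ ∀ α, eulerLagrange Ω e v α = 0 := by
  set V := eulerLagrangeIter Ω e with hV
  have hc : ∀ k α, MvPowerSeries.constantCoeff (V k α) = Ω 1 α e := by
    intro k
    induction k with
    | zero => intro α; exact MvPowerSeries.constantCoeff_C _
    | succ k ih =>
      intro α
      have := mem_degIdeal_one.1 (eulerLagrange_add_mem H ih α)
      rw [map_sub, sub_eq_zero, MvPowerSeries.constantCoeff_C] at this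
      exact this
  have h1 : ∀ k α, V (k + 1) α - V k α ∈ degIdeal _ _ (k + 1) := by
    intro k
    induction k with
    | zero => intro α; rw [mem_degIdeal_one, map_sub, hc, hc, sub_self]
    | succ k ih => exact fun α => eulerLagrange_contract H (hc (k + 1)) (hc k) ih α
  have h2 : ∀ k l α, V (k + l) α - V k α ∈ degIdeal _ _ (k + 1) := by
    intro k l α
    induction l with
    | zero => simp
    | succ l ih =>
      have := Ideal.add_mem _ (degIdeal_mono (by omega) (h1 (k + l) α)) ih
      rwa [sub_add_sub_cancel] at this
  -- By `h2` the coefficient at `n` no longer changes from the iterate `n.degree` on.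
  let v : κ → Desc 𝒪 := fun α n => MvPowerSeries.coeff n (V n.degree α)
  have h3 : ∀ k α, v α - V k α ∈ degIdeal _ _ (k + 1) := by
    intro k α n hn
    obtain ⟨l, rfl⟩ := exists_add_of_le (Nat.lt_succ_iff.1 hn)
    have := h2 n.degree l α n (Nat.lt_succ_self _)
    rw [map_sub, sub_eq_zero] at this ⊢
    exact this.symm
  have hvc : ∀ α, MvPowerSeries.constantCoeff (v α) = Ω 1 α e := by
    intro α
    have := mem_degIdeal_one.1 (h3 0 α)
    rw [map_sub, sub_eq_zero, hc] at this
    exact this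
  refine ⟨v, hvc, fun α => eq_of_sub_mem_degIdeal fun k => ?_⟩
  have h4 := eulerLagrange_contract H hvc (hc k) (h3 k) α
  have h5 := Ideal.sub_mem _ h4 (h3 (k + 1) α)
  rw [sub_zero]
  refine degIdeal_mono (show k ≤ k + 1 + 1 by omega) ?_
  convert h5 using 1
  change _ = _ - V (k + 1) α - (v α - V (k + 1) α)
  ring

end Flat

/-! ### The principal hierarchy: existence and uniqueness -/

section Hierarchy

variable {κ : Type} [Fintype κ] [DecidableEq κ] {𝒪 : FunctionSpace κ}
  {Ω : ℕ → Matrix κ κ 𝒪.carrier} {e : κ} {c : κ → κ → κ → 𝒪.carrier} {v : κ → Desc 𝒪}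
  (H : IsFlat Ω e c) (hv : ∀ α, MvPowerSeries.constantCoeff (v α) = Ω 1 α e)

/-- The matrix of multiplication by `a` at the point `v`. -/
def multMatrix (hv : ∀ α, MvPowerSeries.constantCoeff (v α) = Ω 1 α e)
    (c : κ → κ → κ → 𝒪.carrier) (a : κ → Desc 𝒪) : Matrix κ κ (Desc 𝒪) :=
  Matrix.of fun α β => ∑ μ, a μ * substHom hv (c α μ β)

include H

theorem multMatrix_mulVec_comm (a b : κ → Desc 𝒪) :
    multMatrix hv c a *ᵥ b = multMatrix hv c b *ᵥ a := by
  refine funext fun α => ?_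
  simp only [multMatrix, Matrix.mulVec, dotProduct, Matrix.of_apply, Finset.sum_mul]
  rw [Finset.sum_comm]
  refine Finset.sum_congr rfl fun μ _ => Finset.sum_congr rfl fun β _ => ?_
  rw [H.symm α μ β]
  ring

theorem multMatrix_comm (a b : κ → Desc 𝒪) :
    multMatrix hv c a * multMatrix hv c b = multMatrix hv c b * multMatrix hv c a := by
  refine Matrix.ext fun α δ => ?_
  have h : ∀ μ ν, ∑ β, substHom hv (c α μ β) * substHom hv (c β ν δ) =
      ∑ β, substHom hv (c α ν β) * substHom hv (c β μ δ) := by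
    intro μ ν
    simp only [← map_mul, ← map_sum, H.comm α μ ν δ]
  have h1 : ∀ a b : κ → Desc 𝒪, (multMatrix hv c a * multMatrix hv c b) α δ =
      ∑ μ, ∑ ν, a μ * b ν * ∑ β, substHom hv (c α μ β) * substHom hv (c β ν δ) := by
    intro a b
    simp only [Matrix.mul_apply, multMatrix, Matrix.of_apply, Finset.sum_mul_sum]
    rw [Finset.sum_comm]
    refine Finset.sum_congr rfl fun μ _ => ?_
    rw [Finset.sum_comm]
    refine Finset.sum_congr rfl fun ν _ => ?_
    rw [Finset.mul_sum]
    exact Finset.sum_congr rfl fun β _ => by ring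
  rw [h1 a b, h1 b a, Finset.sum_comm]
  refine Finset.sum_congr rfl fun μ _ => ?_
  refine Finset.sum_congr rfl fun ν _ => ?_
  rw [h, mul_comm (b μ)]

theorem multMatrix_unit : multMatrix hv c (Pi.single e 1) = 1 := by
  refine Matrix.ext fun α β => ?_
  simp only [multMatrix, Matrix.of_apply, Pi.single_apply, ite_mul, one_mul, zero_mul,
    Finset.sum_ite_eq', Finset.mem_univ, if_true, H.unit, Matrix.one_apply]
  split_ifs <;> simp

/-- Associativity of the product follows from its commutativity and the commutativity of the
multiplication operators. -/
theorem multMatrix_assoc (a b : κ → Desc 𝒪) :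
    multMatrix hv c (multMatrix hv c a *ᵥ b) = multMatrix hv c a * multMatrix hv c b := by
  refine Matrix.toLin'.injective (LinearMap.ext fun x => ?_)
  rw [Matrix.toLin'_apply, Matrix.toLin'_apply, multMatrix_mulVec_comm H hv, Matrix.mulVec_mulVec,
    multMatrix_comm H hv, ← Matrix.mulVec_mulVec, ← Matrix.mulVec_mulVec,
    multMatrix_mulVec_comm H hv x b]

/-- A solution of the Euler–Lagrange equation solves the principal hierarchy. -/
theorem isTopSolution_of_eulerLagrange
    (hv : ∀ α, MvPowerSeries.constantCoeff (v α) = Ω 1 α e) (hEL : ∀ α, eulerLagrange Ω e v α = 0) :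
    IsTopSolution Ω e v := by
  refine ⟨hv, ?_⟩
  -- The field `y` is chosen so that the derivative of the Euler-Lagrange equation along `t^i` reads
  -- `y · ∂_i v = Ω i.2 · i.1`, with the product at the point `v`. The indices with `j.2 = 0` drop
  -- out because `Ω 0` is constant.
  set y : κ → Desc 𝒪 := fun μ =>
    -shiftedSum Ω e fun j => if j.2 = 0 then 0 else substHom hv (Ω (j.2 - 1) μ j.1) with hy
  have h1 : ∀ i, multMatrix hv c y *ᵥ (fun δ => dDesc i (v δ)) =
      fun α => substHom hv (Ω i.2 α i.1) := by
    intro i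
    refine funext fun α => ?_
    have h2 : dDesc i (eulerLagrange Ω e v α) = 0 := by rw [hEL, map_zero]
    have h3 : ∀ j : κ × ℕ, dDesc i (substHom hv (Ω j.2 α j.1)) =
        ∑ δ, ∑ μ, (dDesc i (v δ) * substHom hv (c α δ μ)) *
          if j.2 = 0 then 0 else substHom hv (Ω (j.2 - 1) μ j.1) := by
      rintro ⟨β, _ | d⟩
      · rw [H.Ω_zero, Matrix.one_apply]
        simp only [if_true, mul_zero, Finset.sum_const_zero]
        split_ifs <;> simp
      · rw [dDesc_substHom hv H.D_coord]
        refine Finset.sum_congr rfl fun δ _ => ?_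
        rw [H.D_Ω, map_sum, Finset.mul_sum]
        refine Finset.sum_congr rfl fun μ _ => ?_
        rw [map_mul, mul_assoc]
        rfl
    have h4 : dDesc i (eulerLagrange Ω e v α) = substHom hv (Ω i.2 α i.1) +
        shiftedSum Ω e fun j => dDesc i (substHom hv (Ω j.2 α j.1)) :=
      dDesc_shiftedSum Ω e H.D_coord i _
    rw [h2] at h4
    simp only [h3, shiftedSum_sum, shiftedSum_mul_left] at h4
    rw [eq_comm, add_eq_zero_iff_eq_neg] at h4
    rw [h4]
    simp only [Matrix.mulVec, dotProduct, multMatrix, Matrix.of_apply, Finset.sum_mul]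
    rw [← Finset.sum_neg_distrib]
    refine Finset.sum_congr rfl fun δ _ => ?_
    rw [← Finset.sum_neg_distrib]
    refine Finset.sum_congr rfl fun μ _ => ?_
    rw [hy, H.symm α μ δ]
    ring
  -- For `i = (e, 0)` the right-hand side of `h1` is the unit, so `∂_x v` is the inverse of `y`.
  have h5 : multMatrix hv c (fun δ => dDesc (e, 0) (v δ)) * multMatrix hv c y = 1 := by
    rw [multMatrix_comm H hv, ← multMatrix_assoc H hv, h1, ← multMatrix_unit H hv]
    congr 1
    refine funext fun α => ?_
    rw [H.Ω_zero, Matrix.one_apply, Pi.single_apply]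
    split_ifs <;> simp
  intro α β d
  have h6 := congrArg (fun x => (multMatrix hv c (fun δ => dDesc (e, 0) (v δ)) *ᵥ x) α) (h1 (β, d))
  simp only [Matrix.mulVec_mulVec, h5, Matrix.one_mulVec] at h6
  rw [h6]
  -- Now `∂_i v` is the product of `∂_x v` with a column of `Ω d`. By `D_Ω` and the chain rule this
  -- is the `x`-derivative of the column of `Ω (d + 1)`.
  change _ = dDesc (e, 0) (substHom hv (Ω (d + 1) α β))
  rw [dDesc_substHom hv H.D_coord]
  simp only [H.D_Ω, map_sum, Matrix.mulVec, dotProduct, multMatrix, Matrix.of_apply,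
    Finset.sum_mul, map_mul, Finset.mul_sum]
  rw [Finset.sum_comm]
  refine Finset.sum_congr rfl fun μ _ => Finset.sum_congr rfl fun δ _ => by ring

/-- The variable `x` belongs to the coefficient ring, so `∂_x` preserves degrees. The hierarchy
therefore determines the derivatives in the formal variables below degree `k` from `v` below degree
`k`. -/
theorem isTopSolution_unique {v v' : κ → Desc 𝒪} (h : IsTopSolution Ω e v)
    (h' : IsTopSolution Ω e v') : v = v' := by
  refine eq_of_formalDeriv_congr (fun a => (h.1 a).trans (h'.1 a).symm) fun k hk a i => ?_
  have e1 := h.2 a i.1 (i.2 + 1)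
  have e2 := h'.2 a i.1 (i.2 + 1)
  change formalDeriv i (v a) = _ at e1
  change formalDeriv i (v' a) = _ at e2
  rw [e1, e2, ← map_sub]
  refine coeffDeriv_mem_degIdeal _ (substAt_congr h.1 h'.1 (𝒮 := Set.univ)
    (fun f _ γ => ⟨trivial, Or.inr (hk γ)⟩) trivial)

theorem existsUnique_isTopSolution : ∃! v, IsTopSolution Ω e v := by
  obtain ⟨v, hv, hEL⟩ := exists_eulerLagrange H
  exact ⟨v, isTopSolution_of_eulerLagrange H hv hEL,
    fun v' h' => isTopSolution_unique H h' (isTopSolution_of_eulerLagrange H hv hEL)⟩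

/-- The solution of the Euler-Lagrange equation constructed above is a topological solution, and
there is only one. -/
theorem IsFlat.eulerLagrange_eq_zero (h : IsTopSolution Ω e v) (α : κ) :
    eulerLagrange Ω e v α = 0 := by
  obtain ⟨v', hv', hEL⟩ := exists_eulerLagrange H
  rw [isTopSolution_unique H h (isTopSolution_of_eulerLagrange H hv' hEL)]
  exact hEL α

end Hierarchy

/-! ### Matrix-valued power series -/

section MatrixLemmas

variable {n R : Type} [Fintype n] [DecidableEq n] [CommRing R] [Algebra ℂ R]

theorem map_derivation_mul (d : Derivation ℂ R R) (A B : Matrix n n R) :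
    (A * B).map d = A.map d * B + A * B.map d := by
  refine Matrix.ext fun i j => ?_
  simp only [Matrix.map_apply, Matrix.mul_apply, Matrix.add_apply, map_sum, Derivation.leibniz,
    smul_eq_mul, Finset.sum_add_distrib]
  rw [add_comm]
  congr 1
  exact Finset.sum_congr rfl fun _ _ => mul_comm _ _

theorem map_coeff_mul (A B : Matrix n n (PowerSeries R)) (k : ℕ) :
    (A * B).map (PowerSeries.coeff k) = ∑ i ∈ Finset.range (k + 1),
      A.map (PowerSeries.coeff i) * B.map (PowerSeries.coeff (k - i)) := by
  refine Matrix.ext fun a b => ?_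
  simp only [Matrix.map_apply, Matrix.mul_apply, Matrix.sum_apply, map_sum, PowerSeries.coeff_mul]
  rw [Finset.sum_comm]
  refine Eq.trans ?_ (Finset.Nat.sum_antidiagonal_eq_sum_range_succ_mk
    (fun p : ℕ × ℕ => ∑ x, PowerSeries.coeff p.1 (A a x) * PowerSeries.coeff p.2 (B x b)) k)
  rfl

/-- A sequence of matrices as a matrix of power series. -/
def genMatrix (S : ℕ → Matrix n n R) : Matrix n n (PowerSeries R) :=
  Matrix.of fun a b => PowerSeries.mk fun k => S k a b

theorem genMatrix_map_coeff (S : ℕ → Matrix n n R) (k : ℕ) :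
    (genMatrix S).map (PowerSeries.coeff k) = S k := by
  refine Matrix.ext fun a b => ?_
  simp [genMatrix]

/-- One-sided inverses of matrix-valued power series are two-sided. -/
theorem convolution_inverse_comm (A B : ℕ → Matrix n n R) (h0 : A 0 * B 0 = 1)
    (h : ∀ k, 1 ≤ k → ∑ i ∈ Finset.range (k + 1), A i * B (k - i) = 0) (k : ℕ) (hk : 1 ≤ k) :
    ∑ i ∈ Finset.range (k + 1), B i * A (k - i) = 0 := by
  have h1 : genMatrix A * genMatrix B = 1 := by
    have h2 : ∀ k, (genMatrix A * genMatrix B).map (PowerSeries.coeff k) =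
        (1 : Matrix n n (PowerSeries R)).map (PowerSeries.coeff k) := by
      intro k
      rw [map_coeff_mul]
      simp only [genMatrix_map_coeff]
      rcases Nat.eq_zero_or_pos k with rfl | hk
      · rw [zero_add, Finset.sum_range_one, h0]
        refine Matrix.ext fun a b => ?_
        rw [Matrix.map_apply, Matrix.one_apply, Matrix.one_apply]
        split_ifs <;> simp
      · rw [h k hk]
        refine Matrix.ext fun a b => ?_
        rw [Matrix.map_apply, Matrix.one_apply, Matrix.zero_apply]
        split_ifs <;> simp [PowerSeries.coeff_one, hk.ne']
    refine Matrix.ext fun a b => PowerSeries.ext fun k => ?_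
    exact congrFun (congrFun (h2 k) a) b
  have h3 := map_coeff_mul (genMatrix B) (genMatrix A) k
  rw [mul_eq_one_comm.1 h1] at h3
  simp only [genMatrix_map_coeff] at h3
  rw [← h3]
  refine Matrix.ext fun a b => ?_
  rw [Matrix.map_apply, Matrix.one_apply, Matrix.zero_apply]
  split_ifs <;> simp [PowerSeries.coeff_one, Nat.one_le_iff_ne_zero.1 hk]

end MatrixLemmas

/-! ### The closed calibration and its two-point functions -/

section Base

variable {N : ℕ} [NeZero N] {𝒪 : FunctionSpace (Fin N)} {X : ConformalFrobenius 𝒪}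

theorem ConformalFrobenius.inv_mul_η (X : ConformalFrobenius 𝒪) : X.η⁻¹ * X.η = 1 :=
  Matrix.nonsing_inv_mul _ X.η_nondeg

theorem ConformalFrobenius.η_mul_inv (X : ConformalFrobenius 𝒪) : X.η * X.η⁻¹ = 1 :=
  Matrix.mul_nonsing_inv _ X.η_nondeg

theorem ConformalFrobenius.inv_symm (X : ConformalFrobenius 𝒪) : (X.η⁻¹)ᵀ = X.η⁻¹ := by
  rw [Matrix.transpose_nonsing_inv, X.η_symm]

/-- Raising an index with `η⁻¹` turns WDVV into `comm` and the condition on `∂³F/∂t¹∂t^α∂t^β` into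
`unit`. -/
theorem Calibration.isFlat (K : Calibration X) : IsFlat K.Ω 0 X.c where
  symm α β γ := by
    simp only [ConformalFrobenius.c]
    exact Finset.sum_congr rfl fun μ _ => by rw [𝒪.D_comm β γ]
  comm α β γ δ := by
    have key : ∀ β γ, ∑ μ, X.c α β μ * X.c μ γ δ = ∑ ρ, X.η⁻¹ α ρ • ∑ μ, ∑ ν,
        X.η⁻¹ μ ν • (𝒪.D β (𝒪.D ρ (𝒪.D μ X.F)) * 𝒪.D ν (𝒪.D δ (𝒪.D γ X.F))) := by
      intro β γ
      simp only [ConformalFrobenius.c, Finset.sum_mul_sum, Finset.smul_sum]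
      rw [Finset.sum_comm]
      refine Finset.sum_congr rfl fun ρ _ => ?_
      refine Finset.sum_congr rfl fun μ _ => ?_
      refine Finset.sum_congr rfl fun ν _ => ?_
      rw [smul_mul_smul_comm, mul_smul, 𝒪.D_comm ρ β, 𝒪.D_comm γ δ]
    rw [key, key]
    refine Finset.sum_congr rfl fun ρ _ => ?_
    rw [X.wdvv β ρ δ γ]
  unit α γ := by
    simp only [ConformalFrobenius.c]
    have h : ∀ μ, 𝒪.D μ (𝒪.D 0 (𝒪.D γ X.F)) = algebraMap ℂ 𝒪.carrier (X.η μ γ) := by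
      intro μ
      rw [𝒪.D_comm, X.unit]
    have h2 := congrFun (congrFun X.inv_mul_η α) γ
    rw [Matrix.mul_apply] at h2
    simp only [h, Algebra.smul_def, ← map_mul, ← map_sum, h2, Matrix.one_apply]
    split_ifs <;> simp
  Ω_zero := K.Ω_zero
  D_Ω := K.D_Ω

/-- Constant matrices. -/
def constMatrix {n : Type} (R : Type) [CommRing R] [Algebra ℂ R] (A : Matrix n n ℂ) :
    Matrix n n R := A.map (algebraMap ℂ R)

theorem constMatrix_mul {n : Type} [Fintype n] (R : Type) [CommRing R] [Algebra ℂ R]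
    (A B : Matrix n n ℂ) : constMatrix R (A * B) = constMatrix R A * constMatrix R B :=
  Matrix.map_mul

theorem constMatrix_one {n : Type} [DecidableEq n] (R : Type) [CommRing R] [Algebra ℂ R] :
    constMatrix R (1 : Matrix n n ℂ) = 1 := by
  rw [constMatrix, Matrix.map_one] <;> simp

/-- The matrix of multiplication by `∂_γ`. -/
def ConformalFrobenius.cMatrix (X : ConformalFrobenius 𝒪) (γ : Fin N) :
    Matrix (Fin N) (Fin N) 𝒪.carrier := Matrix.of fun α β => X.c α γ β

theorem ConformalFrobenius.η_mul_cMatrix (X : ConformalFrobenius 𝒪) (γ : Fin N) :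
    constMatrix 𝒪.carrier X.η * X.cMatrix γ =
      Matrix.of fun α β => 𝒪.D α (𝒪.D γ (𝒪.D β X.F)) := by
  refine Matrix.ext fun α β => ?_
  rw [Matrix.mul_apply, Matrix.of_apply]
  have h : ∀ μ, constMatrix 𝒪.carrier X.η α μ * X.cMatrix γ μ β =
      ∑ ν, (X.η α μ * X.η⁻¹ μ ν) • 𝒪.D ν (𝒪.D γ (𝒪.D β X.F)) := by
    intro μ
    rw [constMatrix, Matrix.map_apply, ← Algebra.smul_def, cMatrix, Matrix.of_apply, c,
      Finset.smul_sum]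
    exact Finset.sum_congr rfl fun ν _ => (mul_smul _ _ _).symm
  rw [Finset.sum_congr rfl fun μ _ => h μ, Finset.sum_comm]
  simp_rw [← Finset.sum_smul, ← Matrix.mul_apply, X.η_mul_inv, Matrix.one_apply, ite_smul,
    one_smul, zero_smul]
  simp

/-- Multiplication operators are self-adjoint for `η`, the third derivatives of `F` being symmetric.
-/
theorem ConformalFrobenius.cMatrix_transpose_mul_η (X : ConformalFrobenius 𝒪) (γ : Fin N) :
    (X.cMatrix γ)ᵀ * constMatrix 𝒪.carrier X.η = constMatrix 𝒪.carrier X.η * X.cMatrix γ := by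
  have h : (constMatrix 𝒪.carrier X.η)ᵀ = constMatrix 𝒪.carrier X.η := by
    rw [constMatrix, ← Matrix.transpose_map, X.η_symm]
  rw [← h, ← Matrix.transpose_mul, h, X.η_mul_cMatrix]
  refine Matrix.ext fun α β => ?_
  rw [Matrix.transpose_apply, Matrix.of_apply, Matrix.of_apply, 𝒪.D_comm γ α, 𝒪.D_comm β α,
    𝒪.D_comm β γ]

variable (K : Calibration X)

theorem Calibration.map_D_Ω (k : ℕ) (γ : Fin N) :
    (K.Ω (k + 1)).map (𝒪.D γ) = X.cMatrix γ * K.Ω k :=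
  Matrix.ext fun α β => K.D_Ω k α β γ

theorem Calibration.twoPoint_zero_right (p : ℕ) :
    K.twoPoint p 0 = (K.Ω (p + 1))ᵀ * constMatrix 𝒪.carrier X.η := by
  simp [twoPoint, K.Ω_zero, constMatrix]

/-- The last summand is split off. The inductions on the second index below rest on this recursion.
-/
theorem Calibration.twoPoint_succ (p q : ℕ) : K.twoPoint p (q + 1) =
    (K.Ω (p + 1))ᵀ * constMatrix 𝒪.carrier X.η * K.Ω (q + 1) - K.twoPoint (p + 1) q := by
  rw [twoPoint, Finset.sum_range_succ, twoPoint, sub_eq_neg_add, ← Finset.sum_neg_distrib]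
  congr 1
  · refine Finset.sum_congr rfl fun i hi => ?_
    have hi' : i ≤ q := Nat.lt_succ_iff.1 (Finset.mem_range.1 hi)
    rw [Nat.succ_sub hi', pow_succ, mul_neg_one, neg_smul,
      show p + (q + 1) - i + 1 = p + 1 + q - i + 1 by omega]
  · rw [Nat.sub_self, pow_zero, one_smul, show p + (q + 1) - (q + 1) + 1 = p + 1 by omega]
    rfl

/-- Of the two Leibniz terms in the recursion, one cancels the derivative of `K.twoPoint (p + 1) q`.
The right factor `K.Ω q` is the point: summed against `𝕥`, it falls under the Euler-Lagrange
equation. -/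
theorem Calibration.map_D_twoPoint (γ : Fin N) (p q : ℕ) : (K.twoPoint p q).map (𝒪.D γ) =
    (K.Ω p)ᵀ * constMatrix 𝒪.carrier X.η * X.cMatrix γ * K.Ω q := by
  have hη : (constMatrix 𝒪.carrier X.η).map (𝒪.D γ) = 0 :=
    Matrix.ext fun α β => (𝒪.D γ).map_algebraMap _
  have hT : ∀ p, ((K.Ω (p + 1))ᵀ * constMatrix 𝒪.carrier X.η).map (𝒪.D γ) =
      (K.Ω p)ᵀ * constMatrix 𝒪.carrier X.η * X.cMatrix γ := by
    intro p
    rw [map_derivation_mul, hη, mul_zero, add_zero, Matrix.transpose_map, K.map_D_Ω,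
      Matrix.transpose_mul, mul_assoc, X.cMatrix_transpose_mul_η, mul_assoc]
  induction q generalizing p with
  | zero => rw [K.twoPoint_zero_right, hT, K.Ω_zero, mul_one]
  | succ q ih =>
    rw [K.twoPoint_succ, Matrix.map_sub _ (fun a b => map_sub _ a b), ih, map_derivation_mul, hT,
      K.map_D_Ω]
    simp only [mul_assoc]
    abel

theorem Calibration.orthogonal_matrix (k : ℕ) (hk : 1 ≤ k) :
    ∑ i ∈ Finset.range (k + 1), ((-1 : ℂ) ^ i • K.Ω i) *
      (constMatrix 𝒪.carrier X.η⁻¹ * (K.Ω (k - i))ᵀ) = 0 := by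
  refine Matrix.ext fun α β => ?_
  rw [Matrix.zero_apply, ← K.orthogonal k hk α β, Matrix.sum_apply]
  refine Finset.sum_congr rfl fun i _ => ?_
  simp only [Matrix.mul_apply, Matrix.smul_apply, Matrix.transpose_apply, Finset.mul_sum]
  refine Finset.sum_congr rfl fun μ _ => ?_
  refine Finset.sum_congr rfl fun ν _ => ?_
  rw [constMatrix, Matrix.map_apply, ← Algebra.smul_def, mul_smul, smul_mul_assoc, mul_smul_comm]

/-- Orthogonality says `Ω(-z) · η⁻¹ Ω(z)ᵀ η = 1` for the generating series, and a one-sided inverse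
of a square matrix is two-sided. -/
theorem Calibration.orthogonal_matrix_left (k : ℕ) (hk : 1 ≤ k) :
    ∑ i ∈ Finset.range (k + 1), (-1 : ℂ) ^ (k - i) •
      ((K.Ω i)ᵀ * constMatrix 𝒪.carrier X.η * K.Ω (k - i)) = 0 := by
  have h1 : constMatrix 𝒪.carrier X.η⁻¹ * constMatrix 𝒪.carrier X.η = 1 := by
    rw [← constMatrix_mul, X.inv_mul_η, constMatrix_one]
  have h2 : constMatrix 𝒪.carrier X.η * constMatrix 𝒪.carrier X.η⁻¹ = 1 := by
    rw [← constMatrix_mul, X.η_mul_inv, constMatrix_one]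
  have h := convolution_inverse_comm (fun i => (-1 : ℂ) ^ i • K.Ω i)
    (fun i => constMatrix 𝒪.carrier X.η⁻¹ * (K.Ω i)ᵀ * constMatrix 𝒪.carrier X.η)
    (by simp [K.Ω_zero, h1])
    (fun k hk => by
      have := congrArg (· * constMatrix 𝒪.carrier X.η) (K.orthogonal_matrix k hk)
      simpa only [Finset.sum_mul, mul_assoc, zero_mul] using this) k hk
  have := congrArg (constMatrix 𝒪.carrier X.η * ·) h
  simp only [Finset.mul_sum, mul_zero, mul_smul_comm] at this
  rw [← this]
  refine Finset.sum_congr rfl fun i _ => ?_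
  congr 1
  simp only [← mul_assoc, h2, one_mul]

/-- In the reversed orthogonality relation of order `q + 1`, all terms but one assemble, up to sign,
into `K.twoPoint 0 q`. -/
theorem Calibration.twoPoint_zero_left (q : ℕ) :
    K.twoPoint 0 q = constMatrix 𝒪.carrier X.η * K.Ω (q + 1) := by
  have h := K.orthogonal_matrix_left (q + 1) (Nat.succ_pos q)
  rw [← Finset.sum_range_reflect, Finset.sum_range_succ] at h
  have h1 : ∑ i ∈ Finset.range (q + 1), (-1 : ℂ) ^ (q + 1 - (q + 1 + 1 - 1 - i)) •
      ((K.Ω (q + 1 + 1 - 1 - i))ᵀ * constMatrix 𝒪.carrier X.η *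
        K.Ω (q + 1 - (q + 1 + 1 - 1 - i))) = (-1 : ℂ) ^ q • K.twoPoint 0 q := by
    rw [twoPoint, Finset.smul_sum]
    refine Finset.sum_congr rfl fun i hi => ?_
    have hi' : i ≤ q := Nat.lt_succ_iff.1 (Finset.mem_range.1 hi)
    rw [smul_smul, ← pow_add, show q + 1 - (q + 1 + 1 - 1 - i) = i by omega,
      show q + 1 + 1 - 1 - i = 0 + q - i + 1 by omega]
    congr 1
    rw [show q + (q - i) = i + 2 * (q - i) by omega, pow_add, pow_mul]
    simp
  rw [h1, show q + 1 + 1 - 1 - (q + 1) = 0 by omega, K.Ω_zero, Nat.sub_zero,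
    Matrix.transpose_one, one_mul, pow_succ, mul_neg_one, neg_smul, ← sub_eq_add_neg,
    ← smul_sub, smul_eq_zero_iff_right (pow_ne_zero _ (by norm_num)), sub_eq_zero] at h
  exact h

/-- The recursion is compatible with transposition. Orthogonality enters in the base case, which
compares `K.twoPoint p 0` with `K.twoPoint 0 p`. -/
theorem Calibration.twoPoint_transpose (p q : ℕ) : (K.twoPoint p q)ᵀ = K.twoPoint q p := by
  have hη : (constMatrix 𝒪.carrier X.η)ᵀ = constMatrix 𝒪.carrier X.η := by
    rw [constMatrix, ← Matrix.transpose_map, X.η_symm]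
  induction q generalizing p with
  | zero =>
    rw [K.twoPoint_zero_right, K.twoPoint_zero_left, Matrix.transpose_mul,
      Matrix.transpose_transpose, hη]
  | succ q ih =>
    rw [K.twoPoint_succ, Matrix.transpose_sub, ih, K.twoPoint_succ, Matrix.transpose_mul,
      Matrix.transpose_mul, Matrix.transpose_transpose, hη, mul_assoc, sub_sub_cancel]

/-- Induction on `a`: the recursion replaces `K.twoPoint (d + 1) q` by a product of calibration
matrices minus `K.twoPoint d (q + 1)`. The products sum up by orthogonality, and the rest is the
case `a` with `q + 1`. This identity later converts the contribution of `∂ℱ` into single entries of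
the calibration. -/
theorem Calibration.sum_Ω_mul_twoPoint (a q : ℕ) :
    ∑ d ∈ Finset.range (a + 1), (-1 : ℂ) ^ d •
      (K.Ω (a - d) * constMatrix 𝒪.carrier X.η⁻¹ * K.twoPoint d q) = K.Ω (q + a + 1) := by
  have h1 : constMatrix 𝒪.carrier X.η⁻¹ * constMatrix 𝒪.carrier X.η = 1 := by
    rw [← constMatrix_mul, X.inv_mul_η, constMatrix_one]
  induction a generalizing q with
  | zero =>
    simp only [zero_add, Finset.sum_range_one, pow_zero, one_smul, K.Ω_zero, one_mul,
      K.twoPoint_zero_left, ← mul_assoc, h1, add_zero]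
  | succ a ih =>
    have h2 := K.orthogonal_matrix (a + 1) (Nat.succ_pos a)
    rw [← Finset.sum_range_reflect, Finset.sum_range_succ'] at h2
    have h3 : ∀ d ∈ Finset.range (a + 1), (-1 : ℂ) ^ (d + 1) •
        (K.Ω (a + 1 - (d + 1)) * constMatrix 𝒪.carrier X.η⁻¹ * K.twoPoint (d + 1) q) =
        (-1 : ℂ) ^ d • (K.Ω (a - d) * constMatrix 𝒪.carrier X.η⁻¹ * K.twoPoint d (q + 1)) +
        (-1 : ℂ) ^ (a + 1) • (((-1 : ℂ) ^ (a + 1 + 1 - 1 - (d + 1)) •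
          K.Ω (a + 1 + 1 - 1 - (d + 1)) * (constMatrix 𝒪.carrier X.η⁻¹ *
          (K.Ω (a + 1 - (a + 1 + 1 - 1 - (d + 1))))ᵀ)) *
            (constMatrix 𝒪.carrier X.η * K.Ω (q + 1))) := by
      intro d hd
      have hd' : d ≤ a := Nat.lt_succ_iff.1 (Finset.mem_range.1 hd)
      rw [K.twoPoint_succ, show a + 1 + 1 - 1 - (d + 1) = a - d by omega,
        show a + 1 - (a - d) = d + 1 by omega, show a + 1 - (d + 1) = a - d by omega,
        smul_mul_assoc, smul_mul_assoc, smul_smul, ← pow_add,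
        show a + 1 + (a - d) = d + 1 + 2 * (a - d) by omega, pow_add _ (d + 1), pow_mul,
        neg_one_sq, one_pow]
      simp only [mul_one, mul_sub, pow_succ, mul_neg, neg_smul,
        smul_sub, mul_assoc]
      abel
    rw [Finset.sum_range_succ', Finset.sum_congr rfl h3, Finset.sum_add_distrib, ih (q + 1),
      ← Finset.smul_sum, ← Finset.sum_mul, eq_neg_of_add_eq_zero_left h2, add_assoc]
    convert add_zero _ using 2
    · have h4 : ((-1 : ℂ) ^ (a + 1)) * (-1) ^ (a + 1) = 1 := by
        rw [← pow_add, ← two_mul, pow_mul]; simp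
      rw [K.twoPoint_zero_left, show a + 1 + 1 - 1 - 0 = a + 1 by omega, Nat.sub_self, K.Ω_zero,
        Matrix.transpose_one, mul_one, neg_mul, smul_mul_assoc, smul_mul_assoc, smul_neg,
        smul_smul, h4, one_smul, pow_zero, one_smul, Nat.sub_zero, neg_add_cancel]
    · congr 1; omega

end Base

/-! ### Pull-back from `M` to `M × U` -/

section Pull

variable {N : ℕ} (P : FunctionPair N)

/-- The embedding of the variables `t^{≤N}_{≥1}` into the variables `t^{≤N+1}_{≥1}`. -/
def varEmb (N : ℕ) : Fin N × ℕ ↪ (Fin N ⊕ Unit) × ℕ :=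
  (Function.Embedding.inl (α := Fin N) (β := Unit)).prodMap (Function.Embedding.refl ℕ)

theorem varEmb_apply (j : Fin N × ℕ) : varEmb N j = (.inl j.1, j.2) := rfl

theorem inr_notMem_range_varEmb (u : Unit) (k : ℕ) :
    ((.inr u, k) : (Fin N ⊕ Unit) × ℕ) ∉ Set.range (varEmb N) := by
  rintro ⟨j, hj⟩
  simp [varEmb_apply] at hj

/-- `pullDesc` as a ring homomorphism. -/
def pullDescHom : Desc P.base →+* Desc P.total :=
  (MvPowerSeries.rename (varEmb N) : MvPowerSeries _ P.total.carrier →ₐ[P.total.carrier] _).toRingHom.comp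
    (MvPowerSeries.map (P.pull : P.base.carrier →+* P.total.carrier))

theorem pullDesc_eq (f : Desc P.base) : pullDesc P f = pullDescHom P f := rfl

theorem coeff_pullDescHom_emb (f : Desc P.base) (n : Fin N × ℕ →₀ ℕ) :
    MvPowerSeries.coeff (n.mapDomain (varEmb N)) (pullDescHom P f) =
      P.pull (MvPowerSeries.coeff n f) := by
  rw [← Finsupp.embDomain_eq_mapDomain]
  exact (MvPowerSeries.coeff_embDomain_rename (varEmb N) _ n).trans
    (MvPowerSeries.coeff_map _ _ _)

theorem coeff_pullDescHom_of_notMem (f : Desc P.base) {n : (Fin N ⊕ Unit) × ℕ →₀ ℕ}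
    (hn : n ∉ Set.range (Finsupp.mapDomain (varEmb N))) :
    MvPowerSeries.coeff n (pullDescHom P f) = 0 :=
  MvPowerSeries.coeff_rename_eq_zero _ _ hn

theorem pullDescHom_C (f : P.base.carrier) :
    pullDescHom P (MvPowerSeries.C f) = MvPowerSeries.C (P.pull f) := by
  change MvPowerSeries.rename _ (MvPowerSeries.map _ (MvPowerSeries.C f)) = _
  rw [MvPowerSeries.map_C, MvPowerSeries.rename_C]
  rfl

theorem pullDescHom_X (j : Fin N × ℕ) :
    pullDescHom P (MvPowerSeries.X j) = MvPowerSeries.X (varEmb N j) := by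
  change MvPowerSeries.rename _ (MvPowerSeries.map _ (MvPowerSeries.X j)) = _
  rw [MvPowerSeries.map_X, MvPowerSeries.rename_X]

theorem pullDescHom_smul (a : ℂ) (f : Desc P.base) :
    pullDescHom P (a • f) = a • pullDescHom P f := by
  rw [Algebra.smul_def, Algebra.smul_def, map_mul]
  congr 1
  rw [MvPowerSeries.algebraMap_apply, MvPowerSeries.algebraMap_apply, pullDescHom_C,
    AlgHom.commutes]

theorem pullDescHom_mem_degIdeal {k : ℕ} {f : Desc P.base} (hf : f ∈ degIdeal _ _ k) :
    pullDescHom P f ∈ degIdeal _ _ k := by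
  intro n hn
  by_cases h : n ∈ Set.range (Finsupp.mapDomain (varEmb N))
  · obtain ⟨m, rfl⟩ := h
    rw [coeff_pullDescHom_emb, hf m, map_zero]
    rwa [Finsupp.degree_mapDomain] at hn
  · exact coeff_pullDescHom_of_notMem P f h

theorem dDesc_inl_pullDescHom (α : Fin N) (d : ℕ) (f : Desc P.base) :
    dDesc (.inl α, d) (pullDescHom P f) = pullDescHom P (dDesc (α, d) f) := by
  ext n
  rcases d with _ | k
  · change P.total.D (.inl α) (MvPowerSeries.coeff n (pullDescHom P f)) = _
    by_cases h : n ∈ Set.range (Finsupp.mapDomain (varEmb N))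
    · obtain ⟨m, rfl⟩ := h
      rw [coeff_pullDescHom_emb, coeff_pullDescHom_emb, P.D_inl_pull, coeff_dDesc_zero]
    · rw [coeff_pullDescHom_of_notMem P f h, coeff_pullDescHom_of_notMem P _ h, map_zero]
  · change MvPowerSeries.coeff n (formalDeriv (varEmb N (α, k)) (pullDescHom P f)) =
      MvPowerSeries.coeff n (pullDescHom P (formalDeriv (α, k) f))
    rw [coeff_formalDeriv]
    by_cases h : n ∈ Set.range (Finsupp.mapDomain (varEmb N))
    · obtain ⟨m, rfl⟩ := h
      have e1 : Finsupp.mapDomain (varEmb N) m + Finsupp.single (varEmb N (α, k)) 1 =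
          Finsupp.mapDomain (varEmb N) (m + Finsupp.single (α, k) 1) := by
        rw [Finsupp.mapDomain_add, Finsupp.mapDomain_single]
      rw [e1, coeff_pullDescHom_emb, coeff_pullDescHom_emb, coeff_formalDeriv,
        Finsupp.mapDomain_apply (varEmb N).injective]
      simp
    · rw [coeff_pullDescHom_of_notMem P _ h, coeff_pullDescHom_of_notMem, zero_mul]
      rintro ⟨m, hm⟩
      refine h ⟨m - Finsupp.single (α, k) 1, ?_⟩
      have hmi : Finsupp.single (α, k) 1 ≤ m := by
        rw [Finsupp.single_le_iff]
        have := DFunLike.congr_fun hm (varEmb N (α, k))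
        rw [Finsupp.mapDomain_apply (varEmb N).injective] at this
        simp at this
        omega
      refine add_right_cancel (b := Finsupp.single (varEmb N (α, k)) 1) ?_
      rw [← hm, ← Finsupp.mapDomain_single (f := varEmb N), ← Finsupp.mapDomain_add,
        tsub_add_cancel_of_le hmi]

theorem dDesc_inr_pullDescHom (u : Unit) (d : ℕ) (f : Desc P.base) :
    dDesc (.inr u, d) (pullDescHom P f) = 0 := by
  ext n
  rw [map_zero]
  rcases d with _ | k
  · change P.total.D (.inr u) (MvPowerSeries.coeff n (pullDescHom P f)) = _
    by_cases h : n ∈ Set.range (Finsupp.mapDomain (varEmb N))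
    · obtain ⟨m, rfl⟩ := h
      rw [coeff_pullDescHom_emb]
      exact P.D_inr_pull _
    · rw [coeff_pullDescHom_of_notMem P f h, map_zero]
  · change MvPowerSeries.coeff n (formalDeriv ((.inr u, k) : (Fin N ⊕ Unit) × ℕ) _) = 0
    rw [coeff_formalDeriv, coeff_pullDescHom_of_notMem, zero_mul]
    rintro ⟨m, hm⟩
    have := DFunLike.congr_fun hm (.inr u, k)
    rw [Finsupp.mapDomain_of_notMem_range _ _ (inr_notMem_range_varEmb u k)] at this
    simp at this

theorem pullDescHom_formalSum {J : Type} {f : J → Desc P.base} (hf : FormallySummable f) :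
    pullDescHom P (formalSum f) = formalSum fun j => pullDescHom P (f j) := by
  ext n
  rw [coeff_formalSum]
  by_cases h : n ∈ Set.range (Finsupp.mapDomain (varEmb N))
  · obtain ⟨m, rfl⟩ := h
    simp only [coeff_pullDescHom_emb, coeff_formalSum]
    exact AddMonoidHom.map_finsum (P.pull : P.base.carrier →+ P.total.carrier) (hf m)
  · simp only [coeff_pullDescHom_of_notMem P _ h, finsum_zero]

theorem formalSum_comp_of_injective {σ R J J' : Type} [CommRing R] {ι : J → J'}
    (hι : Function.Injective ι) {f : J' → MvPowerSeries σ R} (hf : ∀ j ∉ Set.range ι, f j = 0) :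
    formalSum (fun j => f (ι j)) = formalSum f := by
  ext n
  refine (finsum_mem_range (f := fun j => MvPowerSeries.coeff n (f j)) hι).symm.trans
    ((finsum_mem_inter_support_eq _ _ Set.univ ?_).trans (finsum_mem_univ _))
  ext j
  constructor
  · exact fun h => ⟨trivial, h.2⟩
  · refine fun h => ⟨?_, h.2⟩
    by_contra hcon
    exact h.2 (by simp only [hf j hcon, map_zero])

/-- Extension by zero of a family indexed by `t^{≤N}` to one indexed by `t^{≤N+1}`. -/
def extendFamily {A : Type} [Zero A] (g : Fin N × ℕ → A) : (Fin N ⊕ Unit) × ℕ → A :=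
  fun j => Sum.elim (fun α => g (α, j.2)) (fun _ => 0) j.1

section Taylor

variable {P}

theorem pullDescHom_taylorTerm {h : Fin N → Desc P.base} {h' : Fin N ⊕ Unit → Desc P.total}
    (hh : ∀ γ, h' (.inl γ) = pullDescHom P (h γ)) (n : ℕ) : ∀ f : P.base.carrier,
    pullDescHom P (taylorTerm h n f) = taylorTerm h' n (P.pull f) := by
  induction n with
  | zero => intro f; exact pullDescHom_C P f
  | succ n ih =>
    intro f
    rw [taylorTerm, taylorTerm, pullDescHom_smul, Fintype.sum_sum_type, map_sum]
    simp only [map_mul, ih, hh, P.D_inl_pull, P.D_inr_pull, taylorTerm_zero, mul_zero,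
      Finset.sum_const_zero, add_zero, Finset.univ_unique]

variable {Ω : ℕ → Matrix (Fin N) (Fin N) P.base.carrier} {e : Fin N}
  {Ω' : ℕ → Matrix (Fin N ⊕ Unit) (Fin N ⊕ Unit) P.total.carrier}
  {v : Fin N → Desc P.base} {w : Fin N ⊕ Unit → Desc P.total}
  (hΩ : ∀ α, Ω' 1 (.inl α) (.inl e) = P.pull (Ω 1 α e))
  (hv : ∀ α, MvPowerSeries.constantCoeff (v α) = Ω 1 α e)
  (hw : ∀ α, MvPowerSeries.constantCoeff (w α) = Ω' 1 α (.inl e))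

-- Pulled-back functions have no `s`-derivative, so only the first `N` increments enter their Taylor
-- expansion.
include hΩ in
theorem pullDescHom_substHom (hvw : ∀ α, w (.inl α) = pullDescHom P (v α)) (f : P.base.carrier) :
    pullDescHom P (substHom hv f) = substHom hw (P.pull f) := by
  symm
  refine substAt_eq_of_sub_mem hw fun k => ?_
  have h := pullDescHom_mem_degIdeal P (substAt_sub_mem hv f k)
  rw [map_sub, map_sum] at h
  rwa [Finset.sum_congr rfl fun n _ => pullDescHom_taylorTerm
    (h' := fun γ => w γ - MvPowerSeries.C (Ω' 1 γ (.inl e)))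
    (fun γ => by rw [map_sub, pullDescHom_C, hvw, hΩ]) n f] at h

include hΩ in
theorem pullDescHom_shifted (j : Fin N × ℕ) :
    pullDescHom P (shifted Ω e j) = shifted Ω' (.inl e) (.inl j.1, j.2) := by
  obtain ⟨α, _ | k⟩ := j
  · rw [shifted, shifted, pullDescHom_C, hΩ]
  · rw [shifted, shifted, map_sub, pullDescHom_X]
    simp only [Sum.inl.injEq]
    split_ifs <;> simp [varEmb_apply]

include hΩ in
theorem pullDescHom_shiftedSum (g : Fin N × ℕ → Desc P.base) :
    pullDescHom P (shiftedSum Ω e g) =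
      shiftedSum Ω' (.inl e) (extendFamily fun j => pullDescHom P (g j)) := by
  have hs : FormallySummable fun j => shifted Ω e j * g j :=
    formallySummable_shifted_single Ω e (ι := id) Function.injective_id g
  rw [shiftedSum, pullDescHom_formalSum P hs]
  simp only [map_mul, pullDescHom_shifted hΩ]
  exact formalSum_comp_of_injective (varEmb N).injective
    (f := fun j => shifted Ω' (.inl e) j * extendFamily (fun j => pullDescHom P (g j)) j) (by
      rintro ⟨α | u, k⟩ hj
      · exact absurd ⟨(α, k), rfl⟩ hj
      · exact mul_zero _)

end Taylor

end Pull

/-! ### The flat F-manifold structure on `M × U` -/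

section Open

variable {N : ℕ} [NeZero N] {P : FunctionPair N} {X : ConformalFrobenius P.base}

/-- The structure constants of the flat F-manifold `M × U`. -/
def OpenPotential.ct (Y : OpenPotential P X) (α β γ : Fin N ⊕ Unit) : P.total.carrier :=
  Sum.elim
    (fun α => Sum.elim (fun β => Sum.elim (fun γ => P.pull (X.c α β γ)) (fun _ => 0) γ)
      (fun _ => 0) β)
    (fun _ => P.total.D β (P.total.D γ Y.Fo)) α

variable (Y : OpenPotential P X)

theorem OpenPotential.ct_inl (α β γ : Fin N) :
    Y.ct (.inl α) (.inl β) (.inl γ) = P.pull (X.c α β γ) := rfl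

theorem OpenPotential.ct_inl_inr (α : Fin N) (u : Unit) (γ) : Y.ct (.inl α) (.inr u) γ = 0 := rfl

theorem OpenPotential.ct_inl_inr' (α : Fin N) (u : Unit) (β) : Y.ct (.inl α) β (.inr u) = 0 := by
  rcases β with β | u' <;> rfl

theorem OpenPotential.ct_inr (u : Unit) (β γ) :
    Y.ct (.inr u) β γ = P.total.D β (P.total.D γ Y.Fo) := rfl

theorem OpenPotential.sum_D_D_mul_c (β : Fin N ⊕ Unit) (γ' δ' : Fin N) :
    ∑ ν, P.total.D β (P.total.D (.inl ν) Y.Fo) * P.pull (X.c ν γ' δ') =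
    ∑ μ, ∑ ν, X.η⁻¹ μ ν • (P.pull (P.base.D γ' (P.base.D δ' (P.base.D μ X.F))) *
        P.total.D (.inl ν) (P.total.D β Y.Fo)) := by
  rw [Finset.sum_comm]
  refine Finset.sum_congr rfl fun ν _ => ?_
  rw [ConformalFrobenius.c, map_sum, Finset.mul_sum]
  refine Finset.sum_congr rfl fun μ _ => ?_
  have h : X.η⁻¹ ν μ = X.η⁻¹ μ ν := congrFun (congrFun X.inv_symm μ) ν
  rw [map_smul, h, mul_smul_comm, P.total.D_comm β, mul_comm, P.base.D_comm μ γ',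
    P.base.D_comm μ δ']

variable {Y} {K : Calibration X}

/-- The rows `α ≤ N` reduce to the closed theory. In the last row, associativity amounts to the
first open WDVV equation when all three remaining indices are at most `N`, to the second when one of
the two exchanged indices is `N + 1`, and to commutativity of the ring otherwise. -/
theorem OpenCalibration.isFlat (J : OpenCalibration K Y) : IsFlat J.Ωt (.inl 0) Y.ct where
  symm α β γ := by
    rcases α with α | u
    · rcases β with β | u <;> rcases γ with γ | u'
      · rw [Y.ct_inl, Y.ct_inl, K.isFlat.symm]
      all_goals simp only [Y.ct_inl_inr, Y.ct_inl_inr']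
    · exact P.total.D_comm β γ Y.Fo
  comm α β γ δ := by
    rw [Fintype.sum_sum_type, Fintype.sum_sum_type]
    simp only [Finset.univ_unique, Finset.sum_singleton]
    rcases α with α | u
    · simp only [Y.ct_inl_inr', zero_mul, add_zero]
      rcases β with β | ⟨⟩ <;> rcases γ with γ | ⟨⟩
      · rcases δ with δ | ⟨⟩
        · simp only [Y.ct_inl, ← map_mul, ← map_sum, K.isFlat.comm]
        · simp only [Y.ct_inl_inr', mul_zero]
      all_goals simp only [Y.ct_inl_inr, zero_mul, mul_zero]
    · rcases β with β | ⟨⟩ <;> rcases γ with γ | ⟨⟩ <;> rcases δ with δ | ⟨⟩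
      · simp only [Y.ct_inr, Y.ct_inl, Y.sum_D_D_mul_c]
        have := Y.open_wdvv_1 γ δ β
        rw [P.total.D_comm (.inl β) (.inr _), P.total.D_comm (.inl γ) (.inr _)]
        convert this using 2 <;> exact mul_comm _ _
      · simp only [Y.ct_inr, Y.ct_inl_inr', mul_zero, Finset.sum_const_zero, zero_add]
        exact mul_comm _ _
      · simp only [Y.ct_inr, Y.ct_inl, Y.ct_inl_inr, Y.sum_D_D_mul_c, mul_zero,
          Finset.sum_const_zero, zero_add]
        rw [P.total.D_comm (.inl β) (.inr _)]
        linear_combination -Y.open_wdvv_2 β δ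
      · simp only [Y.ct_inr, Y.ct_inl_inr, Y.ct_inl_inr', mul_zero, Finset.sum_const_zero, zero_add]
        exact mul_comm _ _
      · simp only [Y.ct_inr, Y.ct_inl, Y.ct_inl_inr, Y.sum_D_D_mul_c, mul_zero,
          Finset.sum_const_zero, zero_add]
        rw [P.total.D_comm (.inl γ) (.inr _)]
        linear_combination Y.open_wdvv_2 γ δ
      · simp only [Y.ct_inr, Y.ct_inl_inr, Y.ct_inl_inr', mul_zero, Finset.sum_const_zero, zero_add]
        exact mul_comm _ _
      · rfl
      · rfl
  unit α γ := by
    rcases α with α | u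
    · rcases γ with γ | u
      · rw [Y.ct_inl, K.isFlat.unit]
        simp only [Sum.inl.injEq]
        split_ifs <;> simp
      · simp [Y.ct_inl_inr']
    · rw [Y.ct_inr]
      rcases γ with γ | u
      · simp [Y.unit_t]
      · simp [Y.unit_s]
  Ω_zero := by
    refine Matrix.ext fun α β => ?_
    rcases α with α | u
    · rcases β with β | u
      · change P.pull (K.Ω 0 α β) = _
        rw [K.Ω_zero, Matrix.one_apply, Matrix.one_apply]
        simp only [Sum.inl.injEq]
        split_ifs <;> simp
      · simp [OpenCalibration.Ωt, Calibration.Ωext]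
    · change J.Φ 0 β = _
      rw [J.Φ_zero, Matrix.one_apply]
      simp only [eq_comm]
  D_Ω k α β γ := by
    rw [Fintype.sum_sum_type]
    rcases α with α | u
    · simp only [Finset.univ_unique, Finset.sum_singleton, Y.ct_inl_inr', zero_mul, add_zero]
      rcases β with β | u
      · change P.total.D γ (P.pull (K.Ω (k + 1) α β)) =
          ∑ μ, Y.ct (.inl α) γ (.inl μ) * P.pull (K.Ω k μ β)
        rcases γ with γ | u
        · rw [P.D_inl_pull, K.D_Ω]
          simp [Y.ct_inl]
        · rw [P.D_inr_pull]
          simp [Y.ct_inl_inr]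
      · change P.total.D γ 0 = ∑ μ, Y.ct (.inl α) γ (.inl μ) * 0
        simp
    · refine (J.D_Φ k β γ).trans ?_
      simp only [Finset.univ_unique, Finset.sum_singleton]
      rfl

end Open

/-! ### First derivatives of the closed potential -/

section BasePotential

variable {N : ℕ} [NeZero N] {𝒪 : FunctionSpace (Fin N)} {X : ConformalFrobenius 𝒪}
  (K : Calibration X) {v : Fin N → Desc 𝒪}
  (hv : ∀ α, MvPowerSeries.constantCoeff (v α) = K.Ω 1 α 0)

theorem Calibration.potential_eq : K.potential v = (1 / 2 : ℂ) •
    shiftedSum K.Ω 0 fun j => shiftedSum K.Ω 0 fun j' =>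
      substHom hv (K.twoPoint j.2 j'.2 j.1 j'.1) := by
  refine congrArg ((1 / 2 : ℂ) • ·) ((formalSum_prod (formallySummable_shifted_shifted K.Ω 0
    fun j j' => substHom hv (K.twoPoint j.2 j'.2 j.1 j'.1))).trans ?_)
  refine congrArg formalSum ?_
  funext j
  rw [← shiftedSum_mul_left]
  refine congrArg formalSum (funext fun j' => ?_)
  rw [mul_left_comm, mul_assoc]

/-- Any derivative of a two-point function has a column of `K.Ω` as right factor, so differentiating
through `v` contributes zero by `hEL`. The two explicit derivatives agree by symmetry and absorb the
factor `1/2`. -/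
theorem Calibration.dDesc_potential (hEL : ∀ α, eulerLagrange K.Ω 0 v α = 0)
    (i : Fin N × ℕ) : dDesc i (K.potential v) =
      shiftedSum K.Ω 0 fun j => substHom hv (K.twoPoint i.2 j.2 i.1 j.1) := by
  have h1 : ∀ j : Fin N × ℕ, (shiftedSum K.Ω 0 fun j' =>
      dDesc i (substHom hv (K.twoPoint j.2 j'.2 j.1 j'.1))) = 0 := by
    intro j
    have h2 : ∀ j' : Fin N × ℕ, dDesc i (substHom hv (K.twoPoint j.2 j'.2 j.1 j'.1)) =
        ∑ γ, ∑ ν, (dDesc i (v γ) * substHom hv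
          (((K.Ω j.2)ᵀ * constMatrix 𝒪.carrier X.η * X.cMatrix γ) j.1 ν)) *
            substHom hv (K.Ω j'.2 ν j'.1) := by
      intro j'
      rw [dDesc_substHom hv K.isFlat.D_coord]
      refine Finset.sum_congr rfl fun γ _ => ?_
      have h3 := congrFun (congrFun (K.map_D_twoPoint γ j.2 j'.2) j.1) j'.1
      rw [Matrix.map_apply] at h3
      rw [h3, Matrix.mul_apply, map_sum, Finset.mul_sum]
      refine Finset.sum_congr rfl fun ν _ => ?_
      rw [map_mul, ← mul_assoc]
    simp only [h2, shiftedSum_sum, shiftedSum_mul_left]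
    refine Finset.sum_eq_zero fun γ _ => Finset.sum_eq_zero fun ν _ => ?_
    have h4 : (shiftedSum K.Ω 0 fun j' => substHom hv (K.Ω j'.2 ν j'.1)) = 0 := hEL ν
    rw [h4, mul_zero]
  rw [K.potential_eq hv, Derivation.map_smul, dDesc_shiftedSum _ _ K.isFlat.D_coord]
  simp only [dDesc_shiftedSum _ _ K.isFlat.D_coord, h1, add_zero]
  have h5 : ∀ j : Fin N × ℕ, K.twoPoint j.2 i.2 j.1 i.1 = K.twoPoint i.2 j.2 i.1 j.1 := by
    intro j
    rw [← K.twoPoint_transpose, Matrix.transpose_apply]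
  simp only [h5]
  rw [← two_smul ℂ, smul_smul]
  norm_num

end BasePotential

/-! ### First derivatives of the open potential -/

section OpenPotential

variable {N : ℕ} [NeZero N] {P : FunctionPair N} {X : ConformalFrobenius P.base}
  {K : Calibration X} {Y : OpenPotential P X} {J : OpenCalibration K Y}
  {v : Fin N → Desc P.base} {w : Fin N ⊕ Unit → Desc P.total}

theorem constantCoeff_pullDescHom (f : Desc P.base) :
    MvPowerSeries.constantCoeff (pullDescHom P f) = P.pull (MvPowerSeries.constantCoeff f) := by
  have := coeff_pullDescHom_emb P f 0
  rwa [Finsupp.mapDomain_zero] at this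

/-- The closed part of the topological solution of the extended hierarchy. -/
theorem OpenCalibration.isTop_inl (hv : K.IsTop v) (hw : J.IsTop w) (α : Fin N) :
    w (.inl α) = pullDescHom P (v α) := by
  -- Completing `v` with the last component of `w` gives a point of `M × U` at which the hierarchy
  -- of `v` can be written.
  set w' : Fin N ⊕ Unit → Desc P.total :=
    Sum.elim (fun α => pullDescHom P (v α)) (fun u => w (.inr u)) with hw'
  have hc : ∀ α, MvPowerSeries.constantCoeff (w' α) = J.Ωt 1 α (.inl 0) := by
    rintro (α | u)
    · change MvPowerSeries.constantCoeff (pullDescHom P (v α)) = _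
      rw [constantCoeff_pullDescHom, hv.1]
      rfl
    · exact hw.1 _
  suffices (fun α => w (.inl α)) = fun α => pullDescHom P (v α) from congrFun this α
  refine eq_of_formalDeriv_congr
    (fun α => (hw.1 (.inl α)).trans (hc (.inl α)).symm) fun k hk α i => ?_
  obtain ⟨β, d⟩ := i
  have e1 : formalDeriv (β, d) (w (.inl α)) =
      dDesc (.inl 0, 0) (substHom hw.1 (J.Ωt (d + 2) (.inl α) β)) := hw.2 (.inl α) β (d + 1)
  have e2 : formalDeriv (β, d) (pullDescHom P (v α)) =
      dDesc (.inl 0, 0) (substHom hc (J.Ωt (d + 2) (.inl α) β)) := by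
    change dDesc (β, d + 1) (pullDescHom P (v α)) = _
    rcases β with β | u
    · rw [dDesc_inl_pullDescHom, hv.2, ← dDesc_inl_pullDescHom]
      exact congrArg _ (pullDescHom_substHom (fun _ => rfl) hv.1 hc (fun _ => rfl) _)
    · rw [dDesc_inr_pullDescHom]
      change _ = dDesc (.inl 0, 0) (substHom hc 0)
      rw [map_zero, map_zero]
  rw [e1, e2, ← map_sub]
  refine coeffDeriv_mem_degIdeal _ ?_
  rcases β with β | u
  -- The functions `Ω^{α,0}_{β,d}`, `α ≤ N`, do not depend on `s`, so agreement of the first `N`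
  -- components suffices.
  · refine substAt_congr hw.1 hc (𝒮 := Set.range P.pull) ?_ ⟨K.Ω (d + 2) α β, rfl⟩
    rintro _ ⟨f, rfl⟩ (γ | u)
    · exact ⟨⟨_, (P.D_inl_pull γ f).symm⟩, Or.inr (hk γ)⟩
    · exact ⟨⟨0, by rw [map_zero]; exact (P.D_inr_pull f).symm⟩, Or.inl (P.D_inr_pull f)⟩
  · change substHom hw.1 0 - substHom hc 0 ∈ _
    simp

/-- Derivatives of `Φ_{β,d}` along `M × U` are combinations of the entries of the column `β` of
`J.Ωt d`, so the dependence through `w` is killed by the Euler-Lagrange equation. -/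
theorem OpenCalibration.dDesc_potential (hw : J.IsTop w) (i : (Fin N ⊕ Unit) × ℕ) :
    dDesc i (J.potential w) = substHom hw.1 (J.Φ (i.2 + 1) i.1) := by
  have hp : J.potential w =
      shiftedSum J.Ωt (.inl 0) fun j => substHom hw.1 (J.Φ (j.2 + 1) j.1) := rfl
  rw [hp, dDesc_shiftedSum _ _ J.isFlat.D_coord]
  have h2 : ∀ j : (Fin N ⊕ Unit) × ℕ, dDesc i (substHom hw.1 (J.Φ (j.2 + 1) j.1)) =
      ∑ γ, ∑ ν, (dDesc i (w γ) * substHom hw.1 (Y.ct (.inr ()) γ ν)) *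
        substHom hw.1 (J.Ωt j.2 ν j.1) := by
    intro j
    rw [dDesc_substHom hw.1 J.isFlat.D_coord]
    refine Finset.sum_congr rfl fun γ _ => ?_
    have h3 : P.total.D γ (J.Φ (j.2 + 1) j.1) = _ := J.isFlat.D_Ω j.2 (.inr ()) j.1 γ
    rw [h3, map_sum, Finset.mul_sum]
    refine Finset.sum_congr rfl fun ν _ => ?_
    rw [map_mul, mul_assoc]
  simp only [h2, shiftedSum_sum, shiftedSum_mul_left]
  rw [Finset.sum_eq_zero, add_zero]
  refine fun γ _ => Finset.sum_eq_zero fun ν _ => ?_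
  have h4 : (shiftedSum J.Ωt (.inl 0) fun j => substHom hw.1 (J.Ωt j.2 ν j.1)) = 0 :=
    J.isFlat.eulerLagrange_eq_zero hw ν
  rw [h4, mul_zero]

/-- The entry `Ω_{α,p;β,q}`, extended by zero to `β = N + 1`. -/
def Calibration.twoPointExt (K : Calibration X) (p q : ℕ) (α : Fin N) (β : Fin N ⊕ Unit) :
    P.total.carrier :=
  Sum.elim (fun β => P.pull (K.twoPoint p q α β)) (fun _ => 0) β

theorem OpenCalibration.dDesc_pull_potential (hv : K.IsTop v) (hw : J.IsTop w)
    (i : Fin N × ℕ) : dDesc (.inl i.1, i.2) (pullDesc P (K.potential v)) =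
      shiftedSum J.Ωt (.inl 0) fun j => substHom hw.1 (K.twoPointExt i.2 j.2 i.1 j.1) := by
  rw [pullDesc_eq, dDesc_inl_pullDescHom,
    K.dDesc_potential hv.1 (K.isFlat.eulerLagrange_eq_zero hv),
    pullDescHom_shiftedSum (Ω' := J.Ωt) (fun _ => rfl)]
  congr 1
  funext ⟨β, q⟩
  rcases β with β | u
  · exact pullDescHom_substHom (fun _ => rfl) hv.1 hw.1 (J.isTop_inl hv hw) _
  · exact (map_zero _).symm

theorem OpenCalibration.dDesc_inr_pull_potential (u : Unit) (d : ℕ) :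
    dDesc (.inr u, d) (pullDesc P (K.potential v)) = 0 :=
  dDesc_inr_pullDescHom P u d _

end OpenPotential

/-! ### Gradings and the operator behind `P_m` -/

section Weights

variable {κ : Type} [Fintype κ] [DecidableEq κ] (μ : κ → ℂ)

open Classical in
/-- The integer `μ^α - μ^β`, if it is one. -/
def wt (α β : κ) : ℤ := if h : ∃ n : ℤ, μ α - μ β = n then h.choose else 0

variable {μ}

theorem wt_eq {α β : κ} {n : ℤ} (h : μ α - μ β = n) : wt μ α β = n := by
  have h' : ∃ n : ℤ, μ α - μ β = n := ⟨n, h⟩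
  rw [wt, dif_pos h']
  exact_mod_cast h'.choose_spec.symm.trans h

variable (μ) in
/-- All entries have non-negative integer degree. -/
def IsGraded (A : Matrix κ κ ℂ) : Prop := ∀ α β, A α β ≠ 0 → ∃ n : ℕ, μ α - μ β = n

theorem IsGraded.wt_spec {A : Matrix κ κ ℂ} (hA : IsGraded μ A) {α β : κ} (h : A α β ≠ 0) :
    μ α - μ β = (wt μ α β : ℂ) ∧ 0 ≤ wt μ α β := by
  obtain ⟨n, hn⟩ := hA α β h
  have : wt μ α β = (n : ℤ) := wt_eq (by rw [hn]; simp)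
  rw [this, hn]
  exact ⟨by simp, by positivity⟩

theorem virAux_succ_apply (R : Matrix κ κ ℂ) (a : ℂ) (M : ℕ) (α β : κ) :
    virAux (Matrix.diagonal μ + a • 1) R (M + 1) α β =
      ∑ γ, R α γ * virAux (Matrix.diagonal μ + a • 1) R M γ β +
        virAux (Matrix.diagonal μ + a • 1) R M α β * (μ β + a + (M - 1 / 2)) := by
  have h : Matrix.diagonal μ + a • 1 + ((M : ℂ) - 1 / 2) • 1 =
      Matrix.diagonal fun β => μ β + a + ((M : ℂ) - 1 / 2) := by
    refine Matrix.ext fun i j => ?_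
    by_cases hij : i = j
    · subst hij; simp
    · simp [hij]
  rw [virAux, Matrix.add_apply, Matrix.mul_apply, h, Matrix.mul_diagonal]

/-- Degrees add under multiplication by `R` and are unchanged by the diagonal factors. -/
theorem isGraded_virAux {R : Matrix κ κ ℂ} (hR : IsGraded μ R) (a : ℂ) (M : ℕ) :
    IsGraded μ (virAux (Matrix.diagonal μ + a • 1) R M) := by
  induction M with
  | zero =>
    intro α β h
    rw [virAux, Matrix.one_apply] at h
    obtain rfl : α = β := by by_contra hne; exact h (if_neg hne)
    exact ⟨0, by simp⟩
  | succ M ih =>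
    intro α β h
    rw [virAux_succ_apply] at h
    by_cases h1 : ∑ γ, R α γ * virAux (Matrix.diagonal μ + a • 1) R M γ β = 0
    · rw [h1, zero_add] at h
      exact ih α β (left_ne_zero_of_mul h)
    · obtain ⟨γ, _, h2⟩ := Finset.exists_ne_zero_of_sum_ne_zero h1
      obtain ⟨k, hk⟩ := hR α γ (left_ne_zero_of_mul h2)
      obtain ⟨l, hl⟩ := ih γ β (right_ne_zero_of_mul h2)
      exact ⟨k + l, by push_cast; rw [← hk, ← hl]; ring⟩

/-- Each non-zero entry of `P_m` sits in exactly one degree. Where `μ^α - μ^β` is not an integer the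
entry is zero, so the default value of `wt` does no harm. -/
theorem virCoef_apply {R : Matrix κ κ ℂ} (hR : IsGraded μ R) (m a p : ℤ) (α β : κ) :
    virCoef μ R m a p α β =
      if p = wt μ α β then
        virAux (Matrix.diagonal μ + (a : ℂ) • 1) R (m + 1).toNat α β else 0 := by
  rw [virCoef, bracket, Matrix.of_apply, virP]
  by_cases h : virAux (Matrix.diagonal μ + (a : ℂ) • 1) R (m + 1).toNat α β = 0
  · simp [h]
  · rw [((isGraded_virAux hR _ _).wt_spec h).1]
    simp only [Int.cast_inj, eq_comm]

/-- Makes the bounds on the summation indices in the operators automatic. -/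
theorem virCoef_of_neg {R : Matrix κ κ ℂ} (hR : IsGraded μ R) (m a : ℤ) {p : ℤ} (hp : p < 0) :
    virCoef μ R m a p = 0 := by
  refine Matrix.ext fun α β => ?_
  rw [virCoef_apply hR, Matrix.zero_apply]
  split_ifs with h
  · by_contra hne
    have := ((isGraded_virAux hR _ _).wt_spec hne).2
    omega
  · rfl

section Operator

variable {A : Type} [AddCommGroup A] [Module ℂ A]

/-- The operator `z⁻¹ (z ∂_z + μ + R - 1/2)` on sequences of row vectors, where `f q` is the
coefficient of `z^q`. -/
def rowOp (μ : κ → ℂ) (R : Matrix κ κ ℂ) (f : ℤ → κ → A) (q : ℤ) (β : κ) : A :=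
  ((q : ℂ) + 1 / 2 + μ β) • f (q + 1) β + ∑ γ, R γ β • f (q + 1 - wt μ γ β) γ

/-- One step of the recursion for `P_m` is one application of `rowOp` to `f`; additivity of weights
turns the shift by the weight from `γ` to `β` into two successive shifts. The case `n = q + 1` gives
the coefficients at `𝕥_q`, the case `n = -d` those at `∂/∂t_d`. -/
theorem sum_virAux_smul {R : Matrix κ κ ℂ} (hR : IsGraded μ R) (n : ℤ) (M : ℕ)
    (f : ℤ → κ → A) (β : κ) :
    ∑ γ, virAux (Matrix.diagonal μ + (n : ℂ) • 1) R M γ β • f (n + M - 1 - wt μ γ β) γ =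
      (rowOp μ R)^[M] f (n - 1) β := by
  induction M generalizing f with
  | zero =>
    rw [Finset.sum_eq_single β]
    · have : wt μ β β = 0 := wt_eq (by simp)
      simp [virAux, this]
    · intro γ _ h
      simp [virAux, h]
    · simp
  | succ M ih =>
    rw [Function.iterate_succ_apply, ← ih (rowOp μ R f)]
    rw [Finset.sum_congr rfl fun γ _ => by rw [virAux_succ_apply, add_smul]]
    simp only [rowOp, smul_add, Finset.sum_add_distrib, Finset.sum_smul, Finset.smul_sum]
    rw [add_comm]
    congr 1
    · refine Finset.sum_congr rfl fun γ _ => ?_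
      by_cases h : virAux (Matrix.diagonal μ + (n : ℂ) • 1) R M γ β = 0
      · simp [h]
      · have h1 := ((isGraded_virAux hR _ _).wt_spec h).1
        rw [smul_smul, show n + (M + 1 : ℕ) - 1 - wt μ γ β = n + M - 1 - wt μ γ β + 1 by
          push_cast; ring]
        congr 2
        push_cast
        rw [← h1]
        ring
    · rw [Finset.sum_comm]
      refine Finset.sum_congr rfl fun δ _ => ?_
      refine Finset.sum_congr rfl fun γ _ => ?_
      by_cases h : virAux (Matrix.diagonal μ + (n : ℂ) • 1) R M δ β = 0
      · simp [h]
      by_cases h' : R γ δ = 0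
      · simp [h']
      have h1 := ((isGraded_virAux hR _ _).wt_spec h).1
      have h2 := (hR.wt_spec h').1
      have h3 : wt μ γ β = wt μ γ δ + wt μ δ β := wt_eq (by push_cast; rw [← h1, ← h2]; ring)
      rw [smul_smul, mul_comm, h3]
      congr 2
      push_cast
      ring

end Operator

section GradedSum

variable {Rs : ℕ → Matrix κ κ ℂ}
  (hRs : ∀ n, 1 ≤ n → Matrix.diagonal μ * Rs n - Rs n * Matrix.diagonal μ = (n : ℂ) • Rs n)
include hRs

theorem weight_of_ne_zero {n : ℕ} (hn : 1 ≤ n) {α β : κ} (h : Rs n α β ≠ 0) :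
    μ α - μ β = n := by
  have h1 := congrFun (congrFun (hRs n hn) α) β
  rw [Matrix.sub_apply, Matrix.diagonal_mul, Matrix.mul_diagonal, Matrix.smul_apply,
    smul_eq_mul] at h1
  refine mul_right_cancel₀ h ?_
  rw [← h1]; ring

/-- A non-zero `R_n` forces `n` to be one of the finitely many differences `μ^α - μ^β`. -/
theorem finite_support_grading : (Function.support fun n => Rs (n + 1)).Finite := by
  have h : (Function.support fun n => Rs (n + 1)) ⊆
      ⋃ p : κ × κ, {n : ℕ | μ p.1 - μ p.2 = ((n + 1 : ℕ) : ℂ)} := by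
    intro n hn
    obtain ⟨α, hα⟩ := Function.ne_iff.1 hn
    obtain ⟨β, hβ⟩ := Function.ne_iff.1 hα
    exact Set.mem_iUnion.2 ⟨(α, β), weight_of_ne_zero hRs (Nat.succ_pos n) hβ⟩
  refine (Set.finite_iUnion fun p => Set.Subsingleton.finite ?_).subset h
  intro a ha b hb
  have : ((a + 1 : ℕ) : ℂ) = ((b + 1 : ℕ) : ℂ) := ha.symm.trans hb
  have := Nat.cast_injective this
  omega

theorem finsum_grading_apply (α β : κ) :
    (∑ᶠ n : ℕ, Rs (n + 1)) α β = ∑ᶠ n : ℕ, Rs (n + 1) α β :=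
  AddMonoidHom.map_finsum
    (⟨⟨fun A : Matrix κ κ ℂ => A α β, rfl⟩, fun _ _ => rfl⟩ : Matrix κ κ ℂ →+ ℂ)
    (finite_support_grading hRs)

theorem finsum_grading_of_weight {α β : κ} {n : ℕ} (h : μ α - μ β = ((n + 1 : ℕ) : ℂ)) :
    (∑ᶠ n : ℕ, Rs (n + 1)) α β = Rs (n + 1) α β := by
  rw [finsum_grading_apply hRs, finsum_eq_single _ n]
  intro k hk
  by_contra hne
  have h2 := weight_of_ne_zero hRs (Nat.succ_pos k) hne
  rw [h] at h2
  have := Nat.cast_injective h2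
  omega

theorem weight_of_finsum_ne_zero {α β : κ} (h : (∑ᶠ n : ℕ, Rs (n + 1)) α β ≠ 0) :
    ∃ n : ℕ, μ α - μ β = ((n + 1 : ℕ) : ℂ) := by
  rw [finsum_grading_apply hRs] at h
  obtain ⟨n, hn⟩ : ∃ n, Rs (n + 1) α β ≠ 0 := by
    by_contra hcon
    push Not at hcon
    exact h (by simp only [hcon, finsum_zero])
  exact ⟨n, weight_of_ne_zero hRs (Nat.succ_pos n) hn⟩

theorem isGraded_finsum : IsGraded μ (∑ᶠ n : ℕ, Rs (n + 1)) := fun _ _ h =>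
  let ⟨n, hn⟩ := weight_of_finsum_ne_zero hRs h
  ⟨n + 1, hn⟩

/-- Extension by zero of a sequence to negative indices. -/
def zext {A : Type} [Zero A] (s : ℕ → A) (q : ℤ) : A := if 0 ≤ q then s q.toNat else 0

omit hRs [Fintype κ] [DecidableEq κ] in
theorem zext_natCast {A : Type} [Zero A] (s : ℕ → A) (n : ℕ) : zext s n = s n := by
  rw [zext, if_pos (by positivity), Int.toNat_natCast]

omit hRs [Fintype κ] [DecidableEq κ] in
theorem zext_neg {A : Type} [Zero A] (s : ℕ → A) {q : ℤ} (hq : q < 0) : zext s q = 0 :=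
  if_neg (not_le.2 hq)

/-- The sums over the homogeneous components `R_i` in the homogeneity conditions. -/
theorem sum_Icc_grading {A : Type} [AddCommGroup A] [Module ℂ A] (f : ℕ → κ → A) (k : ℕ)
    (β : κ) : ∑ i ∈ Finset.Icc 1 k, ∑ γ, Rs i γ β • f (k - i) γ =
      ∑ γ, (∑ᶠ n : ℕ, Rs (n + 1)) γ β • zext (fun k => f k γ) (k - wt μ γ β) := by
  rw [Finset.sum_comm]
  refine Finset.sum_congr rfl fun γ _ => ?_
  by_cases h : ∃ n : ℕ, μ γ - μ β = ((n + 1 : ℕ) : ℂ)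
  · obtain ⟨n, hn⟩ := h
    have hw : wt μ γ β = ((n + 1 : ℕ) : ℤ) := wt_eq (by rw [hn]; simp)
    rw [finsum_grading_of_weight hRs hn, hw]
    have h0 : ∀ i ∈ Finset.Icc 1 k, i ≠ n + 1 → Rs i γ β • f (k - i) γ = 0 := by
      intro i hi hne
      by_contra hcon
      have h2 := weight_of_ne_zero hRs (Finset.mem_Icc.1 hi).1 (left_ne_zero_of_smul hcon)
      exact hne (Nat.cast_injective (h2.symm.trans hn))
    by_cases hk : n + 1 ≤ k
    · rw [Finset.sum_eq_single_of_mem (n + 1) (Finset.mem_Icc.2 ⟨by omega, hk⟩) h0,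
        ← Nat.cast_sub hk, zext_natCast]
    · rw [zext_neg _ (by omega), smul_zero]
      refine Finset.sum_eq_zero fun i hi => h0 i hi ?_
      have := (Finset.mem_Icc.1 hi).2
      omega
  · have h1 : (∑ᶠ n : ℕ, Rs (n + 1)) γ β = 0 := by
      by_contra hne
      exact h (weight_of_finsum_ne_zero hRs hne)
    rw [h1, zero_smul]
    refine Finset.sum_eq_zero fun i hi => ?_
    by_contra hcon
    obtain ⟨k, rfl⟩ := Nat.exists_eq_add_of_le' (Finset.mem_Icc.1 hi).1
    exact h ⟨k, weight_of_ne_zero hRs (Nat.succ_pos k) (left_ne_zero_of_smul hcon)⟩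

end GradedSum

end Weights

/-! ### Symmetry of the second-order coefficients -/

section Columns

variable {κ : Type} [Fintype κ] [DecidableEq κ] {μ : κ → ℂ}

open Polynomial

/-- `∏_{i < M} (X + c + i - 1/2)`. -/
def shiftPoly (c : ℂ) (M : ℕ) : ℂ[X] := ∏ i ∈ Finset.range M, (X + C (c + i - 1 / 2))

/-- Right multiplication by a diagonal matrix scales each column, so column `β` of `P_m` is the
column of a polynomial in `R` that depends on `β` only through `μ β + a`. -/
theorem virAux_eq_aeval (R : Matrix κ κ ℂ) (a : ℂ) (M : ℕ) (α β : κ) :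
    virAux (Matrix.diagonal μ + a • 1) R M α β = aeval R (shiftPoly (μ β + a) M) α β := by
  induction M generalizing α with
  | zero => simp [virAux, shiftPoly]
  | succ M ih =>
    have h : shiftPoly (μ β + a) (M + 1) =
        (X + C (μ β + a + M - 1 / 2)) * shiftPoly (μ β + a) M := by
      rw [shiftPoly, Finset.prod_range_succ, mul_comm]
      rfl
    rw [virAux_succ_apply, h, map_mul, map_add, aeval_X, aeval_C, add_mul, Matrix.add_apply,
      Matrix.mul_apply, ← Algebra.smul_def, Matrix.smul_apply, smul_eq_mul, ih]
    simp only [ih]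
    ring

/-- The substitution `X ↦ -X` changes the sign of each factor and reverses the arithmetic
progression of constants. -/
theorem shiftPoly_comp_neg (c : ℂ) (M : ℕ) :
    (shiftPoly c M).comp (-X) = (-1) ^ M * shiftPoly (-c - M + 2) M := by
  have h : ∀ i ∈ Finset.range M, (X + C (c + i - 1 / 2) : ℂ[X]).comp (-X) =
      (-1) * (X + C (-c - M + 2 + ((M - 1 - i : ℕ) : ℂ) - 1 / 2)) := by
    intro i hi
    have hi' := Finset.mem_range.1 hi
    have : ((M - 1 - i : ℕ) : ℂ) = M - 1 - i := by
      rw [Nat.sub_sub, Nat.cast_sub (by omega)]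
      push_cast; ring
    rw [this, add_comp, X_comp, C_comp, mul_add, neg_one_mul, neg_one_mul, ← C_neg]
    congr 2
    ring
  rw [shiftPoly, shiftPoly, prod_comp, Finset.prod_congr rfl h, Finset.prod_mul_distrib,
    Finset.prod_const, Finset.card_range,
    Finset.prod_range_reflect (fun i => (X + C (-c - M + 2 + (i : ℂ) - 1 / 2) : ℂ[X]))]

theorem aeval_mul_of_intertwine {A B H : Matrix κ κ ℂ} (h : A * H = H * B) (f : ℂ[X]) :
    aeval A f * H = H * aeval B f := by
  induction f using Polynomial.induction_on' with
  | add p q hp hq => rw [map_add, map_add, add_mul, mul_add, hp, hq]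
  | monomial n a =>
    have hn : A ^ n * H = H * B ^ n := by
      induction n with
      | zero => simp
      | succ n ih => rw [pow_succ, mul_assoc, h, ← mul_assoc, ih, mul_assoc, ← pow_succ]
    rw [aeval_monomial, aeval_monomial, mul_assoc, hn, ← Algebra.smul_def, ← Algebra.smul_def,
      mul_smul_comm]

theorem aeval_transpose (A : Matrix κ κ ℂ) (f : ℂ[X]) : (aeval A f)ᵀ = aeval Aᵀ f := by
  induction f using Polynomial.induction_on' with
  | add p q hp hq => rw [map_add, map_add, Matrix.transpose_add, hp, hq]
  | monomial n a =>
    rw [aeval_monomial, aeval_monomial, ← Algebra.smul_def, ← Algebra.smul_def,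
      Matrix.transpose_smul, Matrix.transpose_pow]

/-- `exp(iπμ)`. -/
def phase (μ : κ → ℂ) : Matrix κ κ ℂ :=
  Matrix.diagonal fun α => Complex.exp (Real.pi * Complex.I * μ α)

/-- `exp(-iπμ)`. -/
def phaseInv (μ : κ → ℂ) : Matrix κ κ ℂ :=
  Matrix.diagonal fun α => Complex.exp (-(Real.pi * Complex.I * μ α))

theorem phaseInv_mul_phase : phaseInv μ * phase μ = 1 := by
  rw [phaseInv, phase, Matrix.diagonal_mul_diagonal, ← Matrix.diagonal_one]
  congr 1
  funext α
  rw [← Complex.exp_add, neg_add_cancel, Complex.exp_zero]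

theorem exp_pi_int (p : ℤ) : Complex.exp (Real.pi * Complex.I * p) = (-1 : ℂ) ^ p := by
  rw [mul_comm, Complex.exp_int_mul, Complex.exp_pi_mul_I]

/-- The `μ`-anti-adjointness of `R` with respect to `H`. -/
theorem aeval_mul_apply_swap {R H : Matrix κ κ ℂ} (hH : ∀ α β, H α β ≠ 0 → μ α + μ β = 0)
    (hs : Hᵀ = H) (hR : R * H = H * (phase μ * (-R) * phaseInv μ)ᵀ) (f : ℂ[X]) (α β : κ) :
    (aeval R f * H) α β = Complex.exp (Real.pi * Complex.I * (μ α + μ β)) *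
      (aeval R (f.comp (-X)) * H) β α := by
  have h1 : aeval (phase μ * (-R) * phaseInv μ) f * phase μ = phase μ * aeval (-R) f :=
    aeval_mul_of_intertwine (by rw [mul_assoc, phaseInv_mul_phase, mul_one]) f
  have h2 : aeval (-R) f = aeval R (f.comp (-X)) := by
    rw [aeval_comp, map_neg, aeval_X]
  rw [aeval_mul_of_intertwine hR, ← aeval_transpose, Matrix.mul_apply, Matrix.mul_apply,
    Finset.mul_sum]
  refine Finset.sum_congr rfl fun γ _ => ?_
  have hsym : H γ α = H α γ := congrFun (congrFun hs α) γ
  rw [hsym]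
  by_cases hz : H α γ = 0
  · simp [hz]
  rw [h2] at h1
  generalize aeval (phase μ * -R * phaseInv μ) f = B at h1 ⊢
  have h3 := congrFun (congrFun h1 β) γ
  rw [phase, Matrix.mul_diagonal, Matrix.diagonal_mul] at h3
  have h4 : μ γ = -μ α := eq_neg_of_add_eq_zero_right (hH α γ hz)
  have h5 : Complex.exp (Real.pi * Complex.I * μ γ) *
      Complex.exp (Real.pi * Complex.I * μ α) = 1 := by
    rw [← Complex.exp_add, h4, mul_neg, neg_add_cancel, Complex.exp_zero]
  rw [Matrix.transpose_apply, mul_add, Complex.exp_add]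
  linear_combination H α γ * Complex.exp (Real.pi * Complex.I * μ α) * h3 - H α γ * B β γ * h5

/-- Exchanging the indices replaces `R` by `-R` up to the sign `exp(iπ(μ α + μ β))`, and the degree
condition identifies the reflected polynomial with the one belonging to the exchanged indices. The
resulting symmetry of the `ε²` terms of `L_m` compensates their factor `1/2`. -/
theorem virCoef_mul_apply_swap {R H : Matrix κ κ ℂ} (hH : ∀ α β, H α β ≠ 0 → μ α + μ β = 0)
    (hs : Hᵀ = H) (hR : R * H = H * (phase μ * (-R) * phaseInv μ)ᵀ) (M d₁ d₂ : ℕ) (α β : κ) :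
    (-1 : ℂ) ^ (d₂ + 1) * (virCoef μ R ((M : ℤ) - 1) (-d₂) ((M : ℤ) - 1 - 1 - d₁ - d₂) * H) α β =
    (-1 : ℂ) ^ (d₁ + 1) *
      (virCoef μ R ((M : ℤ) - 1) (-d₁) ((M : ℤ) - 1 - 1 - d₁ - d₂) * H) β α := by
  -- Whenever `H γ β ≠ 0` one has `μ γ = -μ β`, so the polynomial and the degree condition no longer
  -- depend on the summation index `γ`.
  have key : ∀ (d : ℕ) (p : ℤ) (α β : κ), (virCoef μ R ((M : ℤ) - 1) (-d) p * H) α β =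
      if μ α + μ β = p then (aeval R (shiftPoly (-μ β - d) M) * H) α β else 0 := by
    intro d p α β
    have hsum : (if μ α + μ β = p then (aeval R (shiftPoly (-μ β - d) M) * H) α β else 0) =
        ∑ γ, if μ α + μ β = p then aeval R (shiftPoly (-μ β - d) M) α γ * H γ β else 0 := by
      split_ifs
      · exact Matrix.mul_apply
      · simp
    rw [hsum, Matrix.mul_apply]
    refine Finset.sum_congr rfl fun γ _ => ?_
    by_cases hz : H γ β = 0
    · simp [hz]
    have h4 : μ γ = -μ β := eq_neg_of_add_eq_zero_left (hH γ β hz)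
    rw [virCoef, bracket, Matrix.of_apply, virP, virAux_eq_aeval, h4, sub_neg_eq_add,
      sub_add_cancel, Int.toNat_natCast, ite_mul, zero_mul]
    push_cast
    rfl
  rw [key, key, add_comm (μ β)]
  split_ifs with h
  · rw [aeval_mul_apply_swap hH hs hR, shiftPoly_comp_neg, h, exp_pi_int]
    -- The degree condition `μ α + μ β = M - 2 - d₁ - d₂` is just what matches the two progressions.
    have hc : -(-μ β - (d₂ : ℂ)) - M + 2 = -μ α - d₁ := by
      push_cast at h
      linear_combination h
    have hm : aeval R ((-1) ^ M * shiftPoly (-(-μ β - (d₂ : ℂ)) - M + 2) M) =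
        (-1 : ℂ) ^ M • aeval R (shiftPoly (-μ α - d₁) M) := by
      rw [hc, map_mul, map_pow, map_neg, map_one, Algebra.smul_def, map_pow, map_neg, map_one]
    rw [hm, Matrix.smul_mul, Matrix.smul_apply, smul_eq_mul, ← mul_assoc, ← mul_assoc]
    congr 1
    have hne : (-1 : ℂ) ≠ 0 := by norm_num
    rw [← zpow_natCast, ← zpow_natCast, ← zpow_natCast, ← zpow_add₀ hne, ← zpow_add₀ hne]
    have : ((d₂ + 1 : ℕ) : ℤ) + ((M : ℤ) - 1 - 1 - d₁ - d₂) + M =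
        ((d₁ + 1 : ℕ) : ℤ) + 2 * (M - 1 - d₁) := by
      push_cast; ring
    rw [this, zpow_add₀ hne, zpow_mul]
    norm_num
  · simp

end Columns

/-! ### Compatibility of `η` with `μ` and `R` -/

section Frobenius

variable {N : ℕ} [NeZero N] {𝒪 : FunctionSpace (Fin N)} {X : ConformalFrobenius 𝒪}

theorem FunctionSpace.D_x_algebraMap {κ : Type} [DecidableEq κ] (𝒪 : FunctionSpace κ) (i j : κ) :
    𝒪.D i (𝒪.x j) = algebraMap ℂ 𝒪.carrier (if i = j then 1 else 0) := by
  rw [𝒪.D_x]; split_ifs <;> simp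

theorem ConformalFrobenius.D_E (X : ConformalFrobenius 𝒪) (α γ : Fin N) :
    𝒪.D α (X.E γ) = if α = γ then algebraMap ℂ 𝒪.carrier (1 - X.q γ) else 0 := by
  rw [E, map_add, Derivation.map_smul, Derivation.map_algebraMap, 𝒪.D_x, add_zero]
  split_ifs <;> simp [Algebra.smul_def]

theorem ConformalFrobenius.D_sum_E_mul (X : ConformalFrobenius 𝒪) (α : Fin N) (f : 𝒪.carrier) :
    𝒪.D α (∑ γ, X.E γ * 𝒪.D γ f) =
      (1 - X.q α) • 𝒪.D α f + ∑ γ, X.E γ * 𝒪.D γ (𝒪.D α f) := by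
  rw [map_sum]
  simp only [Derivation.leibniz, smul_eq_mul, X.D_E, Finset.sum_add_distrib]
  rw [add_comm]
  congr 1
  · simp [Algebra.smul_def, mul_comm]
  · exact Finset.sum_congr rfl fun γ _ => by rw [𝒪.D_comm]

/-- Three derivatives, one of them along the unit, remove the quadratic ambiguity in the homogeneity
of `F` and leave `(δ - q^α - q^β) η_{αβ} = 0`. Nontriviality makes the constants embed in the ring.
-/
theorem ConformalFrobenius.μ_add_of_η [Nontrivial 𝒪.carrier] (X : ConformalFrobenius 𝒪)
    (α β : Fin N) (h : X.η α β ≠ 0) : X.μ α + X.μ β = 0 := by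
  obtain ⟨A, B, C, hF⟩ := X.homogeneous
  have h1 := congrArg (fun f => 𝒪.D 0 (𝒪.D α (𝒪.D β f))) hF
  change 𝒪.D 0 (𝒪.D α (𝒪.D β (∑ γ, X.E γ * 𝒪.D γ X.F))) = _ at h1
  rw [X.D_sum_E_mul, map_add, X.D_sum_E_mul, map_add, map_add, X.D_sum_E_mul] at h1
  simp only [map_add, Derivation.map_smul, map_sum, Derivation.leibniz, smul_eq_mul,
    𝒪.D_x_algebraMap, Derivation.map_algebraMap, X.unit, X.q_unit, mul_zero, add_zero, smul_zero,
    map_zero, Finset.sum_const_zero] at h1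
  simp only [Algebra.smul_def, ← map_mul, ← map_add] at h1
  have h2 := (algebraMap ℂ 𝒪.carrier).injective h1
  refine mul_right_cancel₀ h ?_
  rw [ConformalFrobenius.μ, ConformalFrobenius.μ]
  linear_combination -h2

theorem ConformalFrobenius.μ_add_of_inv [Nontrivial 𝒪.carrier] (X : ConformalFrobenius 𝒪)
    (α β : Fin N) (h : X.η⁻¹ α β ≠ 0) : X.μ α + X.μ β = 0 := by
  have h1 : Matrix.diagonal X.μ * X.η = -(X.η * Matrix.diagonal X.μ) := by
    refine Matrix.ext fun α β => ?_
    rw [Matrix.diagonal_mul, Matrix.neg_apply, Matrix.mul_diagonal]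
    by_cases hz : X.η α β = 0
    · simp [hz]
    · rw [eq_neg_of_add_eq_zero_left (X.μ_add_of_η α β hz)]
      ring
  have h2 : X.η⁻¹ * Matrix.diagonal X.μ = -(Matrix.diagonal X.μ * X.η⁻¹) := by
    have := congrArg (fun A => X.η⁻¹ * A * X.η⁻¹) h1
    simp only [mul_neg, neg_mul] at this
    rw [← mul_assoc, mul_assoc, X.η_mul_inv, mul_one, ← mul_assoc, X.inv_mul_η, one_mul] at this
    exact this
  have h3 := congrFun (congrFun h2 α) β
  rw [Matrix.mul_diagonal, Matrix.neg_apply, Matrix.diagonal_mul] at h3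
  refine mul_right_cancel₀ h ?_
  linear_combination h3

/-- Conjugation by `exp(iπμ)` multiplies `R_n` by `(-1)^n`. The signs in the adjointness relations
of the `R_n` are thereby absorbed into one relation for the sum. -/
theorem Calibration.Rsum_mul_inv (K : Calibration X) : K.Rsum * X.η⁻¹ =
    X.η⁻¹ * (phase X.μ * (-K.Rsum) * phaseInv X.μ)ᵀ := by
  have h1 : ∀ n, K.R (n + 1) * X.η⁻¹ - X.η⁻¹ * (phase X.μ * (-K.R (n + 1)) * phaseInv X.μ)ᵀ = 0 := by
    intro n
    have h2 : phase X.μ * (-K.R (n + 1)) * phaseInv X.μ = (-1 : ℂ) ^ n • K.R (n + 1) := by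
      refine Matrix.ext fun α β => ?_
      rw [phase, phaseInv, Matrix.mul_diagonal, Matrix.diagonal_mul, Matrix.neg_apply,
        Matrix.smul_apply, smul_eq_mul]
      by_cases hz : K.R (n + 1) α β = 0
      · simp [hz]
      have h3 := weight_of_ne_zero K.R_comm (Nat.succ_pos n) hz
      have h4 : Complex.exp (Real.pi * Complex.I * X.μ α) *
          Complex.exp (-(Real.pi * Complex.I * X.μ β)) = (-1) ^ (n + 1) := by
        rw [← Complex.exp_add, ← mul_neg, ← mul_add, ← sub_eq_add_neg, h3]
        have := exp_pi_int (n + 1 : ℕ)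
        rw [zpow_natCast] at this
        rw [← this]
        simp
      linear_combination (-K.R (n + 1) α β) * h4
    have h5 := congrArg (X.η⁻¹ * ·) (K.R_adj (n + 1) (Nat.succ_pos n))
    simp only [Nat.add_sub_cancel] at h5
    rw [mul_assoc, ← mul_assoc X.η⁻¹, X.inv_mul_η, one_mul] at h5
    rw [h2, h5, Matrix.transpose_smul, sub_self]
  have h2 := AddMonoidHom.map_finsum
    (⟨⟨fun A : Matrix (Fin N) (Fin N) ℂ => A * X.η⁻¹ -
      X.η⁻¹ * (phase X.μ * (-A) * phaseInv X.μ)ᵀ, by simp⟩, fun A B => by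
        simp only [neg_add, mul_add, add_mul, Matrix.transpose_add]; abel⟩ :
      Matrix (Fin N) (Fin N) ℂ →+ Matrix (Fin N) (Fin N) ℂ) (finite_support_grading K.R_comm)
  have h3 : ∀ n, (⟨⟨fun A : Matrix (Fin N) (Fin N) ℂ => A * X.η⁻¹ -
      X.η⁻¹ * (phase X.μ * (-A) * phaseInv X.μ)ᵀ, by simp⟩, fun A B => by
        simp only [neg_add, mul_add, add_mul, Matrix.transpose_add]; abel⟩ :
      Matrix (Fin N) (Fin N) ℂ →+ Matrix (Fin N) (Fin N) ℂ) (K.R (n + 1)) = 0 := h1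
  simp only [h3, finsum_zero] at h2
  exact sub_eq_zero.1 h2

end Frobenius

/-! ### Iterating the operator on the last row of the calibration -/

section Rows

variable {N : ℕ} [NeZero N] {P : FunctionPair N} {X : ConformalFrobenius P.base}
  {K : Calibration X} {Y : OpenPotential P X} (J : OpenCalibration K Y)

theorem OpenCalibration.isGraded_Rtsum : IsGraded X.μt J.Rtsum := isGraded_finsum J.Rt_comm

theorem Calibration.isGraded_Rsum (K : Calibration X) : IsGraded X.μ K.Rsum :=
  isGraded_finsum K.R_comm

theorem OpenCalibration.Rtsum_inl (α β : Fin N) : J.Rtsum (.inl α) (.inl β) = K.Rsum α β := by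
  rw [Rtsum, finsum_grading_apply J.Rt_comm, Calibration.Rsum, finsum_grading_apply K.R_comm]
  exact finsum_congr fun n => J.Rt_inl (n + 1) (Nat.succ_pos n) α β

theorem OpenCalibration.Rtsum_inr (α : Fin N ⊕ Unit) (u : Unit) : J.Rtsum α (.inr u) = 0 := by
  rw [Rtsum, finsum_grading_apply J.Rt_comm]
  simp only [J.Rt_inr _ (Nat.succ_pos _), finsum_zero]

/-- The vanishing last column makes `R̃` block triangular, and this persists in `P_m`. -/
theorem OpenCalibration.virAux_inl_inr (a : ℂ) (M : ℕ) (α : Fin N) (u : Unit) :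
    virAux (Matrix.diagonal X.μt + a • 1) J.Rtsum M (.inl α) (.inr u) = 0 := by
  induction M generalizing α with
  | zero => simp [virAux]
  | succ M ih =>
    rw [virAux_succ_apply, ih, zero_mul, add_zero, Fintype.sum_sum_type]
    simp [ih, J.Rtsum_inr]

theorem OpenCalibration.virAux_inl_inl (a : ℂ) (M : ℕ) (α β : Fin N) :
    virAux (Matrix.diagonal X.μt + a • 1) J.Rtsum M (.inl α) (.inl β) =
      virAux (Matrix.diagonal X.μ + a • 1) K.Rsum M α β := by
  induction M generalizing α with
  | zero => simp [virAux, Matrix.one_apply]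
  | succ M ih =>
    rw [virAux_succ_apply, virAux_succ_apply, Fintype.sum_sum_type]
    simp only [J.Rtsum_inr, J.Rtsum_inl, ih, zero_mul, Finset.sum_const_zero, add_zero]
    rfl

theorem OpenCalibration.virCoef_inl_inl (m a p : ℤ) (α β : Fin N) :
    virCoef X.μt J.Rtsum m a p (.inl α) (.inl β) = virCoef X.μ K.Rsum m a p α β := by
  rw [virCoef, virCoef, bracket, bracket, Matrix.of_apply, Matrix.of_apply, virP, virP,
    J.virAux_inl_inl]
  rfl

theorem OpenCalibration.virCoef_inl_inr (m a p : ℤ) (α : Fin N) (u : Unit) :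
    virCoef X.μt J.Rtsum m a p (.inl α) (.inr u) = 0 := by
  rw [virCoef, bracket, Matrix.of_apply, virP, J.virAux_inl_inr, ite_self]

theorem OpenCalibration.Ωt_inl_inl (k : ℕ) (α β : Fin N) :
    J.Ωt k (.inl α) (.inl β) = P.pull (K.Ω k α β) := rfl

theorem OpenCalibration.Ωt_inl_inr (k : ℕ) (α : Fin N) (u : Unit) :
    J.Ωt k (.inl α) (.inr u) = 0 := rfl

/-- Homogeneity of the extended calibration. -/
theorem OpenCalibration.homogeneous_Ωt (k : ℕ) (α β : Fin N ⊕ Unit) :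
    ∑ θ, Y.E θ * P.total.D θ (J.Ωt k α β) =
      ((k : ℂ) + X.μt β - X.μt α) • J.Ωt k α β +
        ∑ i ∈ Finset.Icc 1 k, ∑ γ, J.Rt i γ β • J.Ωt (k - i) α γ := by
  rcases α with α | u
  · rcases β with β | u
    · have h := congrArg P.pull (K.homogeneous k α β)
      rw [map_sum, map_add, map_smul, map_sum] at h
      rw [Fintype.sum_sum_type]
      simp only [J.Ωt_inl_inl, P.D_inl_pull, P.D_inr_pull, mul_zero, Finset.sum_const_zero,
        add_zero]
      refine Eq.trans (Finset.sum_congr rfl fun θ _ => ?_) (h.trans ?_)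
      · exact (map_mul _ _ _).symm
      · congr 1
        refine Finset.sum_congr rfl fun i hi => ?_
        rw [map_sum, Fintype.sum_sum_type]
        simp only [J.Ωt_inl_inl, J.Ωt_inl_inr, smul_zero, Finset.sum_const_zero, add_zero, map_smul,
          J.Rt_inl i (Finset.mem_Icc.1 hi).1]
    · simp only [J.Ωt_inl_inr, map_zero, mul_zero, Finset.sum_const_zero, smul_zero, zero_add]
      refine (Finset.sum_eq_zero fun i hi => Finset.sum_eq_zero fun γ _ => ?_).symm
      rw [J.Rt_inr i (Finset.mem_Icc.1 hi).1, zero_smul]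
  · have h := J.homogeneous k β
    have e : (k : ℂ) + X.μt β - X.μt (.inr u) = k - 1 / 2 + X.μt β := by
      change (k : ℂ) + X.μt β - 1 / 2 = _
      ring
    rw [e]
    exact h

/-- Multiplication by the Euler vector field. -/
def OpenPotential.eulerMatrix (Y : OpenPotential P X) (α β : Fin N ⊕ Unit) : P.total.carrier :=
  ∑ δ, Y.E δ * Y.ct α δ β

theorem OpenPotential.eulerMatrix_inl_inr (Y : OpenPotential P X) (α : Fin N) (u : Unit) :
    Y.eulerMatrix (.inl α) (.inr u) = 0 := by
  simp [eulerMatrix, Y.ct_inl_inr']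

/-- The row `α` of the generating function of the extended calibration. -/
def OpenCalibration.rowSeq (α : Fin N ⊕ Unit) (q : ℤ) (β : Fin N ⊕ Unit) : P.total.carrier :=
  zext (fun k => J.Ωt k α β) q

/-- Homogeneity with the derivative along `E` rewritten, by flatness, as multiplication by `E` on
the preceding coefficient. The `z⁻¹` term is absent for the last row, as `μ^{N+1} = 1/2`. -/
theorem OpenCalibration.rowOp_rowSeq (α : Fin N ⊕ Unit) (q : ℤ) (β : Fin N ⊕ Unit) :
    rowOp X.μt J.Rtsum (J.rowSeq α) q β =
      ∑ δ, Y.eulerMatrix α δ * J.rowSeq δ q β + (X.μt α - 1 / 2) • J.rowSeq α (q + 1) β := by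
  by_cases hq : 0 ≤ q + 1
  · obtain ⟨k, hk⟩ := Int.eq_ofNat_of_zero_le hq
    have h := J.homogeneous_Ωt k α β
    rw [sum_Icc_grading J.Rt_comm (fun k => J.Ωt k α)] at h
    have h1 : ∑ θ, Y.E θ * P.total.D θ (J.Ωt k α β) =
        ∑ δ, Y.eulerMatrix α δ * J.rowSeq δ q β := by
      rcases k with _ | k
      · have h0 : ∀ θ, P.total.D θ (J.Ωt 0 α β) = 0 := by
          intro θ
          rw [J.isFlat.Ω_zero, Matrix.one_apply]
          split_ifs <;> simp
        simp only [h0, mul_zero, rowSeq, Finset.sum_const_zero]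
        refine (Finset.sum_eq_zero fun δ _ => ?_).symm
        rw [zext_neg _ (by omega), mul_zero]
      · have hq' : q = (k : ℕ) := by omega
        simp only [J.isFlat.D_Ω, Finset.mul_sum, OpenPotential.eulerMatrix, Finset.sum_mul, hq',
          rowSeq, zext_natCast]
        rw [Finset.sum_comm]
        simp only [mul_assoc]
    rw [← h1, h, rowOp, hk]
    have h2 : (q : ℂ) = k - 1 := by
      have : q = (k : ℤ) - 1 := by omega
      rw [this]; push_cast; ring
    simp only [rowSeq, zext_natCast, Rtsum, h2]
    generalize (∑ γ : Fin N ⊕ Unit, _ : P.total.carrier) = S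
    module
  · have h1 : ∀ γ, J.Rtsum γ β • J.rowSeq α (q + 1 - wt X.μt γ β) γ = 0 := by
      intro γ
      by_cases hR : J.Rtsum γ β = 0
      · rw [hR, zero_smul]
      · have := (J.isGraded_Rtsum.wt_spec hR).2
        rw [rowSeq, zext_neg _ (by omega), smul_zero]
    rw [rowOp, Finset.sum_eq_zero fun γ _ => h1 γ, Finset.sum_eq_zero]
    · rw [rowSeq, zext_neg _ (by omega)]
      simp
    · intro δ _
      rw [rowSeq, zext_neg _ (by omega), mul_zero]

/-- The coefficients of `z^{-a}` of `h_M`, where `h_M(z) S(z)` is the `M`-th iterate of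
`z⁻¹(z∂_z + μ + R - 1/2)` applied to the last row of the generating function `S(z)`. -/
def OpenPotential.rowCoef (Y : OpenPotential P X) : ℕ → ℕ → Fin N ⊕ Unit → P.total.carrier
  | 0, 0 => Pi.single (.inr ()) 1
  | 0, _ + 1 => 0
  | M + 1, 0 => fun β => ∑ α, rowCoef Y M 0 α * Y.eulerMatrix α β
  | M + 1, a + 1 => fun β => ∑ α, rowCoef Y M (a + 1) α * Y.eulerMatrix α β +
      (X.μt β - 1 / 2 - a) • rowCoef Y M a β

theorem OpenPotential.rowCoef_eq_zero (Y : OpenPotential P X) (M a : ℕ) (h : M < a) :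
    Y.rowCoef M a = 0 := by
  induction M generalizing a with
  | zero =>
    obtain ⟨a, rfl⟩ := Nat.exists_eq_add_of_lt h
    rw [zero_add]; rfl
  | succ M ih =>
    obtain ⟨a, rfl⟩ := Nat.exists_eq_add_of_lt h
    funext β
    change ∑ α, Y.rowCoef M (M + 1 + a + 1) α * _ + (_ : ℂ) • Y.rowCoef M (M + 1 + a) β = 0
    rw [ih _ (by omega), ih _ (by omega)]
    simp

/-- The last column of the Euler matrix vanishes above its last entry, and the factor `μ^{N+1} - 1/2
- a` vanishes at `a = 0`, so a last component never arises at negative powers of `z`. Hence only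
closed rows need to be cancelled by the two-point functions. -/
theorem OpenPotential.rowCoef_inr (Y : OpenPotential P X) (M a : ℕ) (u : Unit) :
    Y.rowCoef M (a + 1) (.inr u) = 0 := by
  induction M generalizing a with
  | zero => rfl
  | succ M ih =>
    change ∑ α, Y.rowCoef M (a + 1) α * Y.eulerMatrix α (.inr u) +
      ((1 : ℂ) / 2 - 1 / 2 - a) • Y.rowCoef M a (.inr u) = 0
    rw [Fintype.sum_sum_type]
    simp only [Y.eulerMatrix_inl_inr, ih, mul_zero, zero_mul, Finset.sum_const_zero, zero_add]
    cases a with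
    | zero => simp
    | succ a => rw [ih, smul_zero]

theorem OpenCalibration.rowOp_iterate (M : ℕ) (q : ℤ) (β : Fin N ⊕ Unit) :
    (rowOp X.μt J.Rtsum)^[M] (J.rowSeq (.inr ())) q β =
      ∑ a ∈ Finset.range (M + 1), ∑ α, Y.rowCoef M a α * J.rowSeq α (q + a) β := by
  induction M generalizing q β with
  | zero =>
    simp [OpenPotential.rowCoef]
  | succ M ih =>
    rw [Function.iterate_succ_apply']
    have ih' : (rowOp X.μt J.Rtsum)^[M] (J.rowSeq (.inr ())) = fun q β =>
        ∑ a ∈ Finset.range (M + 1), ∑ α, Y.rowCoef M a α * J.rowSeq α (q + a) β :=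
      funext fun q => funext fun β => ih q β
    -- Passing the operator through `z^{-a}` produces the correction `-a z^{-a-1}`; the entries of
    -- `rowCoef` are scalars for it.
    have h1 : rowOp X.μt J.Rtsum (fun q β =>
        ∑ a ∈ Finset.range (M + 1), ∑ α, Y.rowCoef M a α * J.rowSeq α (q + a) β) q β =
        ∑ a ∈ Finset.range (M + 1), ∑ α, Y.rowCoef M a α *
          (rowOp X.μt J.Rtsum (J.rowSeq α) (q + a) β - (a : ℂ) • J.rowSeq α (q + a + 1) β) := by
      have e : ∀ a : ℕ, ∀ α, Y.rowCoef M a α *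
          (rowOp X.μt J.Rtsum (J.rowSeq α) (q + a) β - (a : ℂ) • J.rowSeq α (q + a + 1) β) =
          ((q : ℂ) + 1 / 2 + X.μt β) • (Y.rowCoef M a α * J.rowSeq α (q + 1 + a) β) +
          ∑ γ, J.Rtsum γ β • (Y.rowCoef M a α *
            J.rowSeq α (q + 1 - wt X.μt γ β + a) γ) := by
        intro a α
        have h2 : ∀ γ, q + a + 1 - wt X.μt γ β = q + 1 - wt X.μt γ β + a := fun γ => by ring
        have h4 : q + a + 1 = q + 1 + a := by ring
        simp only [rowOp, ← mul_smul_comm, ← Finset.mul_sum]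
        simp only [h2]
        rw [h4]
        rw [← mul_add]
        congr 1
        push_cast
        generalize (∑ γ : Fin N ⊕ Unit, _ : P.total.carrier) = S
        module
      simp only [e, Finset.sum_add_distrib, ← Finset.smul_sum]
      rw [rowOp]
      congr 1
      simp only [Finset.smul_sum]
      rw [Finset.sum_comm]
      exact Finset.sum_congr rfl fun a _ => Finset.sum_comm
    rw [ih', h1]
    simp only [J.rowOp_rowSeq]
    have h3 : ∀ a : ℕ, ∑ α, Y.rowCoef M a α *
        (∑ δ, Y.eulerMatrix α δ * J.rowSeq δ (q + a) β +
          (X.μt α - 1 / 2) • J.rowSeq α (q + a + 1) β - (a : ℂ) • J.rowSeq α (q + a + 1) β) =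
        ∑ δ, (∑ α, Y.rowCoef M a α * Y.eulerMatrix α δ) * J.rowSeq δ (q + a) β +
        ∑ α, ((X.μt α - 1 / 2 - a) • Y.rowCoef M a α) * J.rowSeq α (q + (a + 1 : ℕ)) β := by
      intro a
      simp only [Finset.sum_mul]
      rw [Finset.sum_comm, ← Finset.sum_add_distrib]
      refine Finset.sum_congr rfl fun α _ => ?_
      have h4 : q + ((a + 1 : ℕ) : ℤ) = q + a + 1 := by push_cast; ring
      simp only [h4, mul_assoc, ← Finset.mul_sum, smul_mul_assoc, ← mul_smul_comm]
      rw [← mul_add]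
      congr 1
      module
    simp only [h3, Finset.sum_add_distrib]
    rw [Finset.sum_range_succ' _ (M + 1)]
    have h5 : ∀ a : ℕ, ∑ α, Y.rowCoef (M + 1) (a + 1) α * J.rowSeq α (q + (a + 1 : ℕ)) β =
        ∑ α, (∑ δ, Y.rowCoef M (a + 1) δ * Y.eulerMatrix δ α) * J.rowSeq α (q + (a + 1 : ℕ)) β +
        ∑ α, ((X.μt α - 1 / 2 - a) • Y.rowCoef M a α) * J.rowSeq α (q + (a + 1 : ℕ)) β := by
      intro a
      rw [← Finset.sum_add_distrib]
      exact Finset.sum_congr rfl fun α _ => add_mul _ _ _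
    simp only [h5, Finset.sum_add_distrib]
    rw [add_right_comm]
    congr 1
    rw [Finset.sum_range_succ', Finset.sum_range_succ _ M, Y.rowCoef_eq_zero M (M + 1) (by omega)]
    simp only [Pi.zero_apply, zero_mul, Finset.sum_const_zero, add_zero]
    rfl

/-- This is `Calibration.sum_Ω_mul_twoPoint` with the range enlarged to one independent of `a`; the
extra terms have a negative index and vanish. -/
theorem OpenCalibration.sum_rowSeq_mul_twoPointExt {a M : ℕ} (h : a < M) (q : ℕ) (δ : Fin N)
    (β : Fin N ⊕ Unit) :
    ∑ d ∈ Finset.range M, ∑ μ, ∑ α, ((-1) ^ d * X.η⁻¹ α μ) •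
      (J.rowSeq (.inl δ) ((a : ℤ) - d) (.inl α) * K.twoPointExt d q μ β) =
        J.Ωt (q + a + 1) (.inl δ) β := by
  rcases β with β | u
  · have h1 := congrArg P.pull (congrFun₂ (K.sum_Ω_mul_twoPoint a q) δ β)
    rw [J.Ωt_inl_inl, ← h1, Matrix.sum_apply, map_sum]
    symm
    refine Eq.trans (Finset.sum_congr rfl fun d hd => ?_) (Finset.sum_subset
      (Finset.range_subset_range.2 (Nat.succ_le_of_lt h)) fun d _ hd => ?_)
    · have hd' : d ≤ a := Nat.lt_succ_iff.1 (Finset.mem_range.1 hd)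
      rw [Matrix.smul_apply, map_smul, Matrix.mul_apply, map_sum, Finset.smul_sum]
      refine Finset.sum_congr rfl fun μ _ => ?_
      rw [Matrix.mul_apply, Finset.sum_mul, map_sum, Finset.smul_sum]
      refine Finset.sum_congr rfl fun α _ => ?_
      rw [rowSeq, ← Nat.cast_sub hd', zext_natCast, J.Ωt_inl_inl, mul_smul]
      congr 1
      rw [map_mul, map_mul, mul_comm (P.pull (K.Ω _ _ _)), mul_assoc, Algebra.smul_def]
      congr 1
      exact P.pull.commutes _
    · have hd' : (a : ℤ) - d < 0 := by
        have := (Finset.mem_range (n := a + 1) (m := d)).not.1 hd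
        omega
      refine Finset.sum_eq_zero fun μ _ => Finset.sum_eq_zero fun α _ => ?_
      rw [rowSeq, zext_neg _ hd', zero_mul, smul_zero]
  · rw [J.Ωt_inl_inr]
    refine Finset.sum_eq_zero fun d _ => Finset.sum_eq_zero fun μ _ =>
      Finset.sum_eq_zero fun α _ => ?_
    rw [show K.twoPointExt d q μ (.inr u) = 0 from rfl, mul_zero, smul_zero]

theorem OpenCalibration.rowOp_iterate_neg (M d : ℕ) (α : Fin N) :
    (rowOp X.μt J.Rtsum)^[M] (J.rowSeq (.inr ())) (-d - 1) (.inl α) =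
      ∑ a ∈ Finset.range M, ∑ δ, Y.rowCoef M (a + 1) (.inl δ) *
        J.rowSeq (.inl δ) ((a : ℤ) - d) (.inl α) := by
  rw [J.rowOp_iterate, Finset.sum_range_succ', Finset.sum_eq_zero (s := Finset.univ), add_zero]
  · refine Finset.sum_congr rfl fun a _ => ?_
    rw [Fintype.sum_sum_type]
    simp only [Y.rowCoef_inr, zero_mul, Finset.sum_const_zero, add_zero]
    have h : -(d : ℤ) - 1 + (a + 1 : ℕ) = a - d := by push_cast; ring
    simp only [h]
  · intro δ _
    rw [rowSeq, zext_neg _ (by push_cast; omega), mul_zero]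

/-- The identity behind the open Virasoro constraints: the contributions to the coefficient of
`𝕥^β_q` add up to a linear combination of the entries of the extended calibration. -/
theorem OpenCalibration.rowOp_iterate_add_loop (M q : ℕ) (β : Fin N ⊕ Unit) :
    (rowOp X.μt J.Rtsum)^[M] (J.rowSeq (.inr ())) q β +
      ∑ d ∈ Finset.range M, ∑ μ, ∑ α, ((-1) ^ (d + 1) * X.η⁻¹ α μ) •
        ((rowOp X.μt J.Rtsum)^[M] (J.rowSeq (.inr ())) (-d - 1) (.inl α) *
          K.twoPointExt d q μ β) =
      ∑ δ, Y.rowCoef M 0 δ * J.Ωt q δ β := by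
  have h1 : (rowOp X.μt J.Rtsum)^[M] (J.rowSeq (.inr ())) q β =
      ∑ a ∈ Finset.range M, ∑ δ, Y.rowCoef M (a + 1) (.inl δ) * J.Ωt (q + a + 1) (.inl δ) β +
        ∑ δ, Y.rowCoef M 0 δ * J.Ωt q δ β := by
    rw [J.rowOp_iterate, Finset.sum_range_succ']
    congr 1
    · refine Finset.sum_congr rfl fun a _ => ?_
      rw [Fintype.sum_sum_type]
      simp only [Y.rowCoef_inr, zero_mul, Finset.sum_const_zero, add_zero, ← Nat.cast_add, rowSeq,
        zext_natCast, add_assoc]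
  -- After the `a`-sum is moved outside, the inner sum is the one evaluated by
  -- `sum_rowSeq_mul_twoPointExt`. The extra sign makes it cancel the terms `a + 1` of `h1`.
  have h2 : ∑ d ∈ Finset.range M, ∑ μ, ∑ α, ((-1) ^ (d + 1) * X.η⁻¹ α μ) •
        ((rowOp X.μt J.Rtsum)^[M] (J.rowSeq (.inr ())) (-d - 1) (.inl α) *
          K.twoPointExt d q μ β) =
      -∑ a ∈ Finset.range M, ∑ δ, Y.rowCoef M (a + 1) (.inl δ) *
        ∑ d ∈ Finset.range M, ∑ μ, ∑ α, ((-1) ^ d * X.η⁻¹ α μ) •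
          (J.rowSeq (.inl δ) ((a : ℤ) - d) (.inl α) * K.twoPointExt d q μ β) := by
    simp only [J.rowOp_iterate_neg, Finset.sum_mul, Finset.mul_sum, Finset.smul_sum, pow_succ,
      mul_neg_one, neg_mul, neg_smul, Finset.sum_neg_distrib]
    congr 1
    have e : ∀ f : ℕ → Fin N → Fin N → ℕ → Fin N → P.total.carrier,
        ∑ d ∈ Finset.range M, ∑ μ, ∑ α, ∑ a ∈ Finset.range M, ∑ δ, f d μ α a δ =
        ∑ a ∈ Finset.range M, ∑ δ, ∑ d ∈ Finset.range M, ∑ μ, ∑ α, f d μ α a δ := by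
      intro f
      simp only [← Finset.sum_product']
      refine Finset.sum_nbij' (fun x => (x.2.2.2.1, x.2.2.2.2, x.1, x.2.1, x.2.2.1))
        (fun x => (x.2.2.1, x.2.2.2.1, x.2.2.2.2, x.1, x.2.1)) ?_ ?_ ?_ ?_ ?_ <;>
        simp +contextual
    rw [e]
    simp only [mul_smul_comm, mul_assoc]
  rw [h1, h2, add_right_comm, add_eq_right, add_neg_eq_zero]
  refine Finset.sum_congr rfl fun a ha => Finset.sum_congr rfl fun δ _ => ?_
  rw [J.sum_rowSeq_mul_twoPointExt (Finset.mem_range.1 ha)]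

end Rows

/-! ### Sums of graded pieces -/

section Grading

variable {κ : Type} [Fintype κ] [DecidableEq κ] {μ : κ → ℂ} {A : Type} [AddCommGroup A]
  [Module ℂ A]

/-- An entry lives in a single degree, so at most one term of the sum survives. The bound `n < k`
ensures that its index is in range. -/
theorem sum_virCoef_smul {R : Matrix κ κ ℂ} (hR : IsGraded μ R) (m a : ℤ) {n : ℤ} {k : ℕ}
    (hn : n < k) (s : ℕ → A) (γ β : κ) :
    ∑ i ∈ Finset.range k, virCoef μ R m a (n - i) γ β • s i =
      virAux (Matrix.diagonal μ + (a : ℂ) • 1) R (m + 1).toNat γ β • zext s (n - wt μ γ β) := by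
  simp only [virCoef_apply hR]
  by_cases h : virAux (Matrix.diagonal μ + (a : ℂ) • 1) R (m + 1).toNat γ β = 0
  · simp [h]
  · have h1 := ((isGraded_virAux hR _ _).wt_spec h).2
    by_cases h2 : 0 ≤ n - wt μ γ β
    · obtain ⟨i, hi⟩ := Int.eq_ofNat_of_zero_le h2
      rw [hi, zext_natCast, Finset.sum_eq_single i]
      · rw [if_pos (by omega)]
      · intro j _ hj
        rw [if_neg (by omega), zero_smul]
      · intro hi'
        rw [Finset.mem_range] at hi'
        omega
    · rw [zext_neg _ (by omega), smul_zero]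
      refine Finset.sum_eq_zero fun i _ => ?_
      rw [if_neg (by omega), zero_smul]

end Grading

section FormalSum

theorem formalSum_mul_left {σ R J : Type} [CommRing R] (c : MvPowerSeries σ R)
    {f : J → MvPowerSeries σ R} (s : Finset J) (h : ∀ j ∉ s, f j = 0) :
    formalSum (fun j => c * f j) = c * ∑ j ∈ s, f j := by
  rw [formalSum_eq_sum s fun j hj => by rw [h j hj, mul_zero], Finset.mul_sum]

end FormalSum

/-! ### Action of the operators on the exponential -/

section Action

variable {κ : Type} [DecidableEq κ] {𝒪 : FunctionSpace κ}

/-- `Coef_{ε^n} ((L e^S) / e^S)` is well defined and equal to `f`. -/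
def DiffOp.HasCoefOnExp (L : DiffOp (κ × ℕ) (Desc 𝒪)) (S : LaurentSeries (Desc 𝒪)) (n : ℤ)
    (f : Desc 𝒪) : Prop :=
  FormallySummable (fun j : L.Idx => ((L.term j).onExp S).coeff n) ∧ L.coefOnExp S n = f

theorem DiffOp.HasCoefOnExp.add {L L' : DiffOp (κ × ℕ) (Desc 𝒪)} {S : LaurentSeries (Desc 𝒪)}
    {n : ℤ} {f f' : Desc 𝒪} (h : L.HasCoefOnExp S n f) (h' : L'.HasCoefOnExp S n f') :
    (L + L').HasCoefOnExp S n (f + f') :=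
  ⟨FormallySummable.sumElim (J := L.Idx) (J' := L'.Idx) h.1 h'.1, by
    rw [← h.2, ← h'.2]
    exact formalSum_sum (J := L.Idx) (J' := L'.Idx) h.1 h'.1⟩

theorem DiffOp.hasCoefOnExp_zero {L : DiffOp (κ × ℕ) (Desc 𝒪)} {S : LaurentSeries (Desc 𝒪)}
    {n : ℤ} (h : ∀ j, ((L.term j).onExp S).coeff n = 0) : L.HasCoefOnExp S n 0 := by
  have : (fun j : L.Idx => ((L.term j).onExp S).coeff n) = fun _ => 0 := funext h
  refine ⟨?_, ?_⟩
  · rw [this]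
    exact formallySummable_of_finite_support (by simp)
  · rw [DiffOp.coefOnExp, this, formalSum_zero]

theorem DiffOp.hasCoefOnExp_sum {L : DiffOp (κ × ℕ) (Desc 𝒪)} {S : LaurentSeries (Desc 𝒪)}
    {n : ℤ} (s : Finset L.Idx) {g : L.Idx → Desc 𝒪}
    (h : ∀ j, ((L.term j).onExp S).coeff n = g j) (hg : ∀ j ∉ s, g j = 0) :
    L.HasCoefOnExp S n (∑ j ∈ s, g j) := by
  obtain rfl : (fun j => ((L.term j).onExp S).coeff n) = g := funext h
  refine ⟨formallySummable_of_finite_support (s.finite_toSet.subset fun j hj => ?_),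
    formalSum_eq_sum s hg⟩
  by_contra hcon
  exact hj (hg j hcon)

theorem dLaurent_single (i : κ × ℕ) (n : ℤ) (f : Desc 𝒪) :
    dLaurent i (HahnSeries.single n f) = HahnSeries.single n (dDesc i f) := by
  refine HahnSeries.ext (funext fun k => ?_)
  change dDesc i ((HahnSeries.single n f).coeff k) = _
  rw [HahnSeries.coeff_single, HahnSeries.coeff_single]
  split_ifs
  · rfl
  · exact map_zero _

theorem dLaurent_add (i : κ × ℕ) (g g' : LaurentSeries (Desc 𝒪)) :
    dLaurent i (g + g') = dLaurent i g + dLaurent i g' := by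
  refine HahnSeries.ext (funext fun n => ?_)
  exact map_add (dDesc i) _ _

theorem dLaurent_one (i : κ × ℕ) : dLaurent i (1 : LaurentSeries (Desc 𝒪)) = 0 := by
  rw [← HahnSeries.single_zero_one, dLaurent_single, Derivation.map_one_eq_zero, map_zero]

theorem twisted_one (S : LaurentSeries (Desc 𝒪)) (i : κ × ℕ) : twisted S i 1 = dLaurent i S := by
  rw [twisted, dLaurent_one, zero_add, mul_one]

variable (F G c : Desc 𝒪)

theorem coeff_onExp_nil (S : LaurentSeries (Desc 𝒪)) (n k : ℤ) :
    ((DiffTerm.mk n c []).onExp S).coeff k = if k = n then c else 0 := by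
  rw [DiffTerm.onExp, List.foldr_nil, mul_one, HahnSeries.coeff_single]
  split_ifs <;> rfl

theorem coeff_onExp_single (i : κ × ℕ) :
    ((DiffTerm.mk 0 c [i]).onExp (HahnSeries.single (-2) F + HahnSeries.single (-1) G)).coeff (-1) =
      c * dDesc i G := by
  rw [DiffTerm.onExp, List.foldr_cons, List.foldr_nil, twisted_one, dLaurent_add, dLaurent_single,
    dLaurent_single, mul_add, HahnSeries.single_mul_single, HahnSeries.single_mul_single,
    HahnSeries.coeff_add, HahnSeries.coeff_single, HahnSeries.coeff_single]
  simp

theorem coeff_onExp_single_of_one (i : κ × ℕ) :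
    ((DiffTerm.mk 1 c [i]).onExp (HahnSeries.single (-2) F + HahnSeries.single (-1) G)).coeff (-1) =
      c * dDesc i F := by
  rw [DiffTerm.onExp, List.foldr_cons, List.foldr_nil, twisted_one, dLaurent_add, dLaurent_single,
    dLaurent_single, mul_add, HahnSeries.single_mul_single, HahnSeries.single_mul_single,
    HahnSeries.coeff_add, HahnSeries.coeff_single, HahnSeries.coeff_single]
  simp

/-- Second derivatives of the exponent, multiplied by `ε²`, start at `ε⁰`, and products of two
derivatives of `F` or two of `G` land at `ε^{-2}` or `ε⁰`. Only mixed products reach `ε^{-1}`. -/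
theorem coeff_onExp_pair (i j : κ × ℕ) :
    ((DiffTerm.mk 2 c [i, j]).onExp
        (HahnSeries.single (-2) F + HahnSeries.single (-1) G)).coeff (-1) =
      c * (dDesc i F * dDesc j G + dDesc i G * dDesc j F) := by
  rw [DiffTerm.onExp, List.foldr_cons, List.foldr_cons, List.foldr_nil, twisted_one, twisted,
    dLaurent_add, dLaurent_add, dLaurent_add]
  simp only [dLaurent_single, mul_add, add_mul, HahnSeries.single_mul_single, HahnSeries.coeff_add,
    HahnSeries.coeff_single]
  simp
  ring

end Action

/-! ### Assembling the constraints -/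

section Constraints

variable {N : ℕ} [NeZero N] {P : FunctionPair N} {X : ConformalFrobenius P.base}
  {K : Calibration X} {Y : OpenPotential P X} (J : OpenCalibration K Y)
  {v : Fin N → Desc P.base} {w : Fin N ⊕ Unit → Desc P.total}

theorem OpenCalibration.hasCoef_L₁ (m : ℤ) : (J.L₁ m).HasCoefOnExp (J.exponent v w) (-1) 0 :=
  DiffOp.hasCoefOnExp_zero fun _ => (coeff_onExp_nil _ _ _ _).trans (if_neg (by decide))

theorem OpenCalibration.hasCoef_L₄ (m : ℤ) : (J.L₄ m).HasCoefOnExp (J.exponent v w) (-1) 0 :=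
  DiffOp.hasCoefOnExp_zero fun _ => (coeff_onExp_nil _ _ _ _).trans (if_neg (by decide))

theorem OpenCalibration.hasCoef_Lo₃ (m : ℤ) : (J.Lo₃ m).HasCoefOnExp (J.exponent v w) (-1) 0 :=
  DiffOp.hasCoefOnExp_zero fun _ => (coeff_onExp_nil _ _ _ _).trans (if_neg (by decide))

/-- The closed potential does not depend on the variables `t^{N+1}_d`. -/
theorem OpenCalibration.hasCoef_Lo₅ (m : ℤ) : (J.Lo₅ m).HasCoefOnExp (J.exponent v w) (-1) 0 :=
  DiffOp.hasCoefOnExp_zero fun _ => (coeff_onExp_single_of_one _ _ _ _).trans (by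
    rw [OpenCalibration.dDesc_inr_pull_potential, mul_zero])

theorem OpenCalibration.hasCoef_Lo₁ (m : ℤ) : (J.Lo₁ m).HasCoefOnExp (J.exponent v w) (-1)
    (shiftedSum J.Ωt (.inl 0) fun j =>
      virCoef X.μt J.Rtsum m (j.2 + 1) (m + j.2 + 1) (.inr ()) j.1 • 1) := by
  have h : (fun j => (((J.Lo₁ m).term j).onExp (J.exponent v w)).coeff (-1)) =
      fun j : (Fin N ⊕ Unit) × ℕ => shifted J.Ωt (.inl 0) j *
        (virCoef X.μt J.Rtsum m (j.2 + 1) (m + j.2 + 1) (.inr ()) j.1 • 1) := by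
    funext j
    refine (coeff_onExp_nil _ _ _ _).trans ?_
    rw [if_pos rfl, mul_smul_comm, mul_one]
    rfl
  refine ⟨?_, ?_⟩
  · rw [h]
    exact formallySummable_shifted_single J.Ωt (.inl 0) (ι := id) Function.injective_id _
  · rw [DiffOp.coefOnExp, h]
    rfl

variable (hw : J.IsTop w)

/-- The contribution of the first-order part of the operators to the coefficient of `𝕥^β_q`. -/
def OpenCalibration.firstOrderTerm (m : ℤ) (γ : Fin N ⊕ Unit) (j : (Fin N ⊕ Unit) × ℕ) (k : ℕ) :
    Desc P.total :=
  virCoef X.μt J.Rtsum m (j.2 + 1) (m + j.2 - k) γ j.1 • substHom hw.1 (J.Φ (k + 1) γ)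

theorem OpenCalibration.firstOrderTerm_eq_zero {m : ℤ} (γ : Fin N ⊕ Unit)
    (j : (Fin N ⊕ Unit) × ℕ) {k : ℕ} (h : ¬(k : ℤ) ≤ m + j.2) :
    J.firstOrderTerm hw m γ j k = 0 := by
  rw [firstOrderTerm, virCoef_of_neg J.isGraded_Rtsum _ _ (by omega), Matrix.zero_apply, zero_smul]

theorem OpenCalibration.finite_support_firstOrderTerm (m : ℤ) (γ : Fin N ⊕ Unit)
    (j : (Fin N ⊕ Unit) × ℕ) : (Function.support (J.firstOrderTerm hw m γ j)).Finite := by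
  refine (Finset.range (m + j.2 + 1).toNat).finite_toSet.subset fun k hk => ?_
  rw [Finset.coe_range, Set.mem_Iio]
  by_contra hcon
  exact hk (J.firstOrderTerm_eq_zero hw γ j (by omega))

theorem OpenCalibration.hasCoef_Lo₂ (m : ℤ) : (J.Lo₂ m).HasCoefOnExp (J.exponent v w) (-1)
    (shiftedSum J.Ωt (.inl 0) fun j =>
      ∑ k ∈ Finset.range (m + j.2 + 1).toNat, J.firstOrderTerm hw m (.inr ()) j k) := by
  have h : (fun p => (((J.Lo₂ m).term p).onExp (J.exponent v w)).coeff (-1)) =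
      fun p : ((Fin N ⊕ Unit) × ℕ) × ℕ => shifted J.Ωt (.inl 0) (id p.1) *
        J.firstOrderTerm hw m (.inr ()) p.1 p.2 := by
    funext p
    refine (coeff_onExp_single _ _ _ _).trans ?_
    rw [J.dDesc_potential hw]
    by_cases hk : (p.2 : ℤ) ≤ m + p.1.2
    · rw [if_pos hk, firstOrderTerm, mul_smul_comm, smul_mul_assoc]
      rfl
    · rw [if_neg hk, J.firstOrderTerm_eq_zero hw _ _ hk, zero_mul, mul_zero]
  have hs := formallySummable_shifted J.Ωt (.inl 0) Function.injective_id _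
    (J.finite_support_firstOrderTerm hw m (.inr ()))
  refine ⟨?_, ?_⟩
  · rw [h]
    exact hs
  · rw [DiffOp.coefOnExp, h]
    refine (formalSum_prod hs).trans (congrArg formalSum (funext fun j => ?_))
    refine formalSum_mul_left (shifted J.Ωt (.inl 0) j) _ fun k hk =>
      J.firstOrderTerm_eq_zero hw _ j ?_
    rw [Finset.mem_range] at hk
    omega

theorem OpenCalibration.firstOrderTerm_inr (m : ℤ) (γ : Fin N) (u : Unit) (q k : ℕ) :
    J.firstOrderTerm hw m (.inl γ) (.inr u, q) k = 0 := by
  rw [firstOrderTerm, J.virCoef_inl_inr, zero_smul]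

theorem OpenCalibration.hasCoef_L₂ (m : ℤ) : (J.L₂ m).HasCoefOnExp (J.exponent v w) (-1)
    (shiftedSum J.Ωt (.inl 0) fun j => ∑ γ : Fin N,
      ∑ k ∈ Finset.range (m + j.2 + 1).toNat, J.firstOrderTerm hw m (.inl γ) j k) := by
  set ι : Fin N × ℕ → (Fin N ⊕ Unit) × ℕ := fun a => (.inl a.1, a.2) with hι
  have hinj : Function.Injective ι := fun a b hab => by
    simpa [hι, Prod.ext_iff] using hab
  have h : (fun p => (((J.L₂ m).term p).onExp (J.exponent v w)).coeff (-1)) =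
      fun p : (Fin N × ℕ) × (Fin N × ℕ) => shifted J.Ωt (.inl 0) (ι p.1) *
        J.firstOrderTerm hw m (.inl p.2.1) (ι p.1) p.2.2 := by
    funext p
    refine (coeff_onExp_single _ _ _ _).trans ?_
    rw [J.dDesc_potential hw]
    by_cases hk : (p.2.2 : ℤ) ≤ m + p.1.2
    · rw [if_pos hk, firstOrderTerm, mul_smul_comm, smul_mul_assoc, J.virCoef_inl_inl]
      rfl
    · rw [if_neg hk, J.firstOrderTerm_eq_zero hw _ _ hk, zero_mul, mul_zero]
  have h0 : ∀ (a : Fin N × ℕ) (b : Fin N × ℕ),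
      b ∉ Finset.univ ×ˢ Finset.range (m + a.2 + 1).toNat →
      J.firstOrderTerm hw m (.inl b.1) (ι a) b.2 = 0 := by
    intro a b hb
    refine J.firstOrderTerm_eq_zero hw _ _ ?_
    rw [Finset.mem_product, Finset.mem_range] at hb
    simp only [Finset.mem_univ, true_and] at hb
    change ¬(b.2 : ℤ) ≤ m + a.2
    omega
  have hs := formallySummable_shifted J.Ωt (.inl 0) hinj
    (fun a (b : Fin N × ℕ) => J.firstOrderTerm hw m (.inl b.1) (ι a) b.2) fun a =>
      (Finset.univ ×ˢ Finset.range (m + a.2 + 1).toNat).finite_toSet.subset fun b hb => by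
        by_contra hcon
        exact hb (h0 a b hcon)
  refine ⟨?_, ?_⟩
  · rw [h]
    exact hs
  · rw [DiffOp.coefOnExp, h]
    refine (formalSum_prod hs).trans ?_
    refine Eq.trans (congrArg formalSum (funext fun a =>
      formalSum_mul_left (shifted J.Ωt (.inl 0) (ι a)) _ (h0 a))) ?_
    simp only [Finset.sum_product]
    refine formalSum_comp_of_injective hinj (f := fun j => shifted J.Ωt (.inl 0) j * ∑ γ : Fin N,
      ∑ k ∈ Finset.range (m + j.2 + 1).toNat, J.firstOrderTerm hw m (.inl γ) j k) ?_
    rintro ⟨α | u, q⟩ hj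
    · exact absurd ⟨(α, q), rfl⟩ hj
    · simp only [J.firstOrderTerm_inr, Finset.sum_const_zero, mul_zero]

/-- Since `Φ_{γ,-1} = δ_{γ,N+1}`, the `ε^{-1}` part of the operator is the term `k = -1` missing
from the first-order sums. -/
theorem OpenCalibration.sum_firstOrderTerm (M : ℕ) (j : (Fin N ⊕ Unit) × ℕ) :
    ∑ γ, ∑ k ∈ Finset.range ((M : ℤ) - 1 + j.2 + 1).toNat,
        J.firstOrderTerm hw ((M : ℤ) - 1) γ j k +
      virCoef X.μt J.Rtsum ((M : ℤ) - 1) (j.2 + 1) ((M : ℤ) - 1 + j.2 + 1) (.inr ()) j.1 • 1 =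
    substHom hw.1 ((rowOp X.μt J.Rtsum)^[M] (J.rowSeq (.inr ())) j.2 j.1) := by
  obtain ⟨β, q⟩ := j
  have h1 := sum_virAux_smul J.isGraded_Rtsum (q + 1) M (J.rowSeq (.inr ())) β
  rw [add_sub_cancel_right] at h1
  rw [← h1, map_sum]
  have h2 : virCoef X.μt J.Rtsum ((M : ℤ) - 1) (q + 1) ((M : ℤ) - 1 + q + 1) (.inr ()) β •
      (1 : Desc P.total) = ∑ γ, virCoef X.μt J.Rtsum ((M : ℤ) - 1) (q + 1)
        ((M : ℤ) - 1 + q + 1) γ β • substHom hw.1 (J.Φ 0 γ) := by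
    rw [Finset.sum_eq_single (.inr ())]
    · rw [J.Φ_zero, if_pos rfl, map_one]
    · intro γ _ hγ
      rw [J.Φ_zero, if_neg hγ, map_zero, smul_zero]
    · simp
  rw [h2, ← Finset.sum_add_distrib]
  refine Finset.sum_congr rfl fun γ _ => ?_
  have h3 := sum_virCoef_smul J.isGraded_Rtsum ((M : ℤ) - 1) (q + 1)
    (n := (M : ℤ) - 1 + q + 1) (k := ((M : ℤ) - 1 + q + 1).toNat + 1) (by omega)
    (fun k => J.Φ k γ) γ β
  rw [Finset.sum_range_succ', sub_add_cancel, Int.toNat_natCast] at h3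
  have h4 : (q : ℤ) + 1 + M - 1 - wt X.μt γ β = (M : ℤ) - 1 + q + 1 - wt X.μt γ β := by ring
  rw [h4, rowSeq]
  refine Eq.trans ?_ (congrArg (substHom hw.1) h3)
  rw [map_add, map_sum, substHom_smul, Nat.cast_zero, sub_zero]
  congr 1
  refine Finset.sum_congr rfl fun k _ => ?_
  have h5 : (M : ℤ) - 1 + q + 1 - (k + 1 : ℕ) = (M : ℤ) - 1 + q - k := by push_cast; ring
  rw [firstOrderTerm, substHom_smul, h5]

variable (v) in
/-- The contribution of the part of the operators that differentiates the closed potential. -/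
def OpenCalibration.loopTerm (m : ℤ) (γ : Fin N ⊕ Unit) (k : ℕ) (p : Fin N × ℕ) : Desc P.total :=
  ((-1) ^ (p.2 + 1) * ∑ α : Fin N,
    virCoef X.μt J.Rtsum m (-p.2) (m - p.2 - k) γ (.inl α) * X.η⁻¹ α p.1) •
      (substHom hw.1 (J.Φ k γ) * dDesc (.inl p.1, p.2) (pullDesc P (K.potential v)))

theorem OpenCalibration.loopTerm_eq_zero {m : ℤ} (γ : Fin N ⊕ Unit) {k : ℕ} {p : Fin N × ℕ}
    (h : ¬(k : ℤ) + p.2 ≤ m) : J.loopTerm v hw m γ k p = 0 := by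
  simp only [loopTerm, virCoef_of_neg J.isGraded_Rtsum m _ (p := m - p.2 - k) (by omega),
    Matrix.zero_apply, zero_mul, Finset.sum_const_zero, mul_zero, zero_smul]

variable (N) in
/-- The variables `t^α_d` with `d < M`. -/
def lowVars (M : ℕ) : Finset (Fin N × ℕ) := Finset.univ ×ˢ Finset.range M

theorem mem_lowVars {M : ℕ} {p : Fin N × ℕ} : p ∈ lowVars N M ↔ p.2 < M := by
  simp [lowVars]

theorem OpenCalibration.hasCoef_Lo₄ (M : ℕ) :
    (J.Lo₄ ((M : ℤ) - 1)).HasCoefOnExp (J.exponent v w) (-1)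
      (∑ p ∈ lowVars N M, J.loopTerm v hw ((M : ℤ) - 1) (.inr ()) 0 p) := by
  have h : ∀ p : Fin N × ℕ,
      (((J.Lo₄ ((M : ℤ) - 1)).term p).onExp (J.exponent v w)).coeff (-1) =
        J.loopTerm v hw ((M : ℤ) - 1) (.inr ()) 0 p := by
    intro p
    refine (coeff_onExp_single_of_one _ _ _ _).trans ?_
    by_cases hp : (p.2 : ℤ) ≤ (M : ℤ) - 1
    · rw [if_pos hp, loopTerm, J.Φ_zero, if_pos rfl, map_one, one_mul, Nat.cast_zero, sub_zero,
        ← Algebra.smul_def]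
    · rw [if_neg hp, zero_mul, J.loopTerm_eq_zero hw _ (by push_cast; omega)]
  refine DiffOp.hasCoefOnExp_sum (L := J.Lo₄ ((M : ℤ) - 1)) (lowVars N M) h fun p hp =>
    J.loopTerm_eq_zero hw _ ?_
  have := (mem_lowVars (p := p)).not.1 hp
  push_cast
  omega

theorem OpenCalibration.hasCoef_Lo₆ (M : ℕ) :
    (J.Lo₆ ((M : ℤ) - 1)).HasCoefOnExp (J.exponent v w) (-1)
      (∑ k ∈ Finset.range M, ∑ p ∈ lowVars N M,
        J.loopTerm v hw ((M : ℤ) - 1) (.inr ()) (k + 1) p) := by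
  have h : ∀ p : ℕ × (Fin N × ℕ),
      (((J.Lo₆ ((M : ℤ) - 1)).term p).onExp (J.exponent v w)).coeff (-1) =
        J.loopTerm v hw ((M : ℤ) - 1) (.inr ()) (p.1 + 1) p.2 := by
    rintro ⟨k, p⟩
    refine (coeff_onExp_pair _ _ _ _ _).trans ?_
    rw [dDesc_inr_pull_potential, zero_mul, zero_add, J.dDesc_potential hw]
    by_cases hp : (k : ℤ) + p.2 ≤ (M : ℤ) - 1 - 1
    · have h1 : (M : ℤ) - 1 - p.2 - (k + 1 : ℕ) = (M : ℤ) - 1 - 1 - k - p.2 := by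
        push_cast; ring
      rw [if_pos hp, loopTerm, h1, ← Algebra.smul_def]
    · rw [if_neg hp, zero_mul, J.loopTerm_eq_zero hw _ (by push_cast; omega)]
  rw [← Finset.sum_product' (f := fun k p => J.loopTerm v hw ((M : ℤ) - 1) (.inr ()) (k + 1) p)]
  refine DiffOp.hasCoefOnExp_sum (L := J.Lo₆ ((M : ℤ) - 1)) (Finset.range M ×ˢ lowVars N M) h
    fun p hp => J.loopTerm_eq_zero hw _ ?_
  have := (Finset.mem_product (p := p)).not.1 hp
  rw [mem_lowVars, Finset.mem_range] at this
  push_cast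
  omega

/-- The Leibniz rule gives each pair of indices twice, with `C a b` and `C b a`. As `C` is
symmetric, the factor `1/2` disappears. -/
theorem OpenCalibration.hasCoef_L₃ [Nontrivial P.base.carrier] (M : ℕ) :
    (J.L₃ ((M : ℤ) - 1)).HasCoefOnExp (J.exponent v w) (-1)
      (∑ a ∈ lowVars N M, ∑ p ∈ lowVars N M,
        J.loopTerm v hw ((M : ℤ) - 1) (.inl a.1) (a.2 + 1) p) := by
  set F : Fin N × ℕ → Desc P.total := fun p =>
    dDesc (.inl p.1, p.2) (pullDesc P (K.potential v)) with hF
  set G : Fin N × ℕ → Desc P.total := fun p => substHom hw.1 (J.Φ (p.2 + 1) (.inl p.1)) with hG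
  set C : Fin N × ℕ → Fin N × ℕ → ℂ := fun a b => (-1) ^ (b.2 + 1) *
    (virCoef X.μ K.Rsum ((M : ℤ) - 1) (-b.2) ((M : ℤ) - 1 - 1 - a.2 - b.2) * X.η⁻¹) a.1 b.1 with hC
  have hsymm : ∀ a b, C a b = C b a := by
    intro a b
    have h := virCoef_mul_apply_swap X.μ_add_of_inv X.inv_symm K.Rsum_mul_inv M a.2 b.2 a.1 b.1
    rw [hC]
    simp only
    rw [h, sub_right_comm]
  have hloop : ∀ a p, J.loopTerm v hw ((M : ℤ) - 1) (.inl a.1) (a.2 + 1) p =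
      C a p • (G a * F p) := by
    intro a p
    have h1 : (M : ℤ) - 1 - p.2 - (a.2 + 1 : ℕ) = (M : ℤ) - 1 - 1 - a.2 - p.2 := by
      push_cast; ring
    simp only [loopTerm, h1, J.virCoef_inl_inl, hC, Matrix.mul_apply, hG, hF]
  have h : ∀ q : (Fin N × ℕ) × (Fin N × ℕ),
      (((J.L₃ ((M : ℤ) - 1)).term q).onExp (J.exponent v w)).coeff (-1) =
        (1 / 2 : ℂ) • (C q.1 q.2 • (G q.1 * F q.2) + C q.2 q.1 • (G q.2 * F q.1)) := by
    rintro ⟨a, b⟩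
    refine (coeff_onExp_pair _ _ _ _ _).trans ?_
    rw [J.dDesc_potential hw, J.dDesc_potential hw, hsymm b a, ← smul_add, smul_smul]
    by_cases hp : (a.2 : ℤ) + b.2 ≤ (M : ℤ) - 1 - 1
    · rw [if_pos hp, ← Algebra.smul_def, mul_assoc]
      exact congrArg _ ((add_comm _ _).trans (congrArg _ (mul_comm _ _)))
    · rw [if_neg hp, zero_mul, hC]
      simp only
      rw [virCoef_of_neg K.isGraded_Rsum _ _ (by omega), zero_mul, Matrix.zero_apply, mul_zero,
        mul_zero, zero_smul]
  have hzero : ∀ a b, ¬(a.2 + b.2 + 1 < M) → C a b = 0 := by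
    intro a b hab
    rw [hC]
    simp only
    rw [virCoef_of_neg K.isGraded_Rsum _ _ (by omega), zero_mul, Matrix.zero_apply, mul_zero]
  have h1 := DiffOp.hasCoefOnExp_sum (L := J.L₃ ((M : ℤ) - 1)) (lowVars N M ×ˢ lowVars N M) h
    fun q hq => (by
      have := (Finset.mem_product (p := q)).not.1 hq
      rw [mem_lowVars, mem_lowVars] at this
      rw [hzero _ _ (by omega), hzero _ _ (by omega), zero_smul, zero_smul, add_zero, smul_zero])
  have h2 : ∑ q ∈ lowVars N M ×ˢ lowVars N M,
      (1 / 2 : ℂ) • (C q.1 q.2 • (G q.1 * F q.2) + C q.2 q.1 • (G q.2 * F q.1)) =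
      ∑ a ∈ lowVars N M, ∑ p ∈ lowVars N M,
        J.loopTerm v hw ((M : ℤ) - 1) (.inl a.1) (a.2 + 1) p := by
    rw [← Finset.smul_sum, Finset.sum_add_distrib,
      Finset.sum_product, Finset.sum_product_right]
    simp only [hloop]
    rw [← two_smul ℂ, smul_smul]
    norm_num
  exact h2 ▸ h1

/-- All coefficients multiplying a given `∂ℱ/∂t^μ_d` together form one coefficient of the iterated
operator, taken at the negative power `z^{-d-1}`. -/
theorem OpenCalibration.sum_loopTerm (M : ℕ) {p : Fin N × ℕ} :
    ∑ γ, ∑ k ∈ Finset.range (M + 1), J.loopTerm v hw ((M : ℤ) - 1) γ k p =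
      ∑ α, ((-1) ^ (p.2 + 1) * X.η⁻¹ α p.1) •
        (substHom hw.1 ((rowOp X.μt J.Rtsum)^[M] (J.rowSeq (.inr ())) (-p.2 - 1) (.inl α)) *
          dDesc (.inl p.1, p.2) (pullDesc P (K.potential v))) := by
  set F := dDesc (.inl p.1, p.2) (pullDesc P (K.potential v)) with hF
  have h1 : ∀ α : Fin N,
      (rowOp X.μt J.Rtsum)^[M] (J.rowSeq (.inr ())) (-p.2 - 1) (.inl α) =
      ∑ γ, ∑ k ∈ Finset.range (M + 1), virCoef X.μt J.Rtsum ((M : ℤ) - 1) (-p.2)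
        ((M : ℤ) - 1 - p.2 - k) γ (.inl α) • J.Φ k γ := by
    intro α
    rw [← sum_virAux_smul J.isGraded_Rtsum (-p.2) M (J.rowSeq (.inr ())) (.inl α)]
    refine Finset.sum_congr rfl fun γ _ => ?_
    rw [sum_virCoef_smul J.isGraded_Rtsum ((M : ℤ) - 1) (-p.2) (by push_cast; omega)
      (fun k => J.Φ k γ) γ (.inl α), sub_add_cancel, Int.toNat_natCast]
    have h2 : -(p.2 : ℤ) + M - 1 - wt X.μt γ (.inl α) = (M : ℤ) - 1 - p.2 - wt X.μt γ (.inl α) := by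
      ring
    rw [h2]
    rfl
  simp only [h1, map_sum, substHom_smul, Finset.sum_mul, Finset.smul_sum, loopTerm, Finset.mul_sum,
    Finset.sum_smul]
  rw [Finset.sum_comm (s := Finset.univ (α := Fin N))]
  refine Finset.sum_congr rfl fun γ _ => ?_
  rw [Finset.sum_comm]
  refine Finset.sum_congr rfl fun α _ => Finset.sum_congr rfl fun k _ => ?_
  rw [smul_mul_assoc, smul_smul]
  congr 1
  ring

theorem OpenCalibration.loopTerm_zero (m : ℤ) (γ : Fin N) (p : Fin N × ℕ) :
    J.loopTerm v hw m (.inl γ) 0 p = 0 := by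
  rw [loopTerm, J.Φ_zero, if_neg (by simp), map_zero, zero_mul, smul_zero]

/-- The three sums come from `L₃`, `Lo₄` and `Lo₆`. The part `Lo₄` supplies `k = 0` for `γ = N + 1`;
for `γ ≤ N` that term is zero because `Φ_{γ,-1} = 0`. -/
theorem OpenCalibration.sum_lowVars_loopTerm (M : ℕ) :
    ∑ a ∈ lowVars N M, ∑ p ∈ lowVars N M,
        J.loopTerm v hw ((M : ℤ) - 1) (.inl a.1) (a.2 + 1) p +
      ∑ p ∈ lowVars N M, J.loopTerm v hw ((M : ℤ) - 1) (.inr ()) 0 p +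
      ∑ k ∈ Finset.range M, ∑ p ∈ lowVars N M,
        J.loopTerm v hw ((M : ℤ) - 1) (.inr ()) (k + 1) p =
    ∑ p ∈ lowVars N M, ∑ γ, ∑ k ∈ Finset.range (M + 1), J.loopTerm v hw ((M : ℤ) - 1) γ k p := by
  rw [Finset.sum_comm, Finset.sum_comm (s := Finset.range M), ← Finset.sum_add_distrib,
    ← Finset.sum_add_distrib]
  refine Finset.sum_congr rfl fun p _ => ?_
  rw [Fintype.sum_sum_type, lowVars, Finset.sum_product]
  simp only [Finset.sum_range_succ' _ M, J.loopTerm_zero, add_zero, Finset.univ_unique (α := Unit),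
    Finset.sum_singleton]
  rw [add_assoc, add_comm (J.loopTerm v hw _ _ _ _)]

theorem OpenCalibration.sum_lowVars_loopTerm_eq (hv : K.IsTop v) (M : ℕ) :
    ∑ p ∈ lowVars N M, ∑ γ, ∑ k ∈ Finset.range (M + 1),
        J.loopTerm v hw ((M : ℤ) - 1) γ k p =
      shiftedSum J.Ωt (.inl 0) fun j => substHom hw.1
        (∑ d ∈ Finset.range M, ∑ μ, ∑ α, ((-1) ^ (d + 1) * X.η⁻¹ α μ) •
          ((rowOp X.μt J.Rtsum)^[M] (J.rowSeq (.inr ())) (-d - 1) (.inl α) *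
            K.twoPointExt d j.2 μ j.1)) := by
  have h : ∀ (c : ℂ) (f : Desc P.total) (g : (Fin N ⊕ Unit) × ℕ → Desc P.total),
      shiftedSum J.Ωt (.inl 0) (fun j => c • (f * g j)) =
        c • (f * shiftedSum J.Ωt (.inl 0) g) := by
    intro c f g
    simp only [← smul_mul_assoc, shiftedSum_mul_left]
  simp only [map_sum, substHom_smul, map_mul, shiftedSum_sum, h, J.sum_loopTerm hw,
    J.dDesc_pull_potential hv hw]
  rw [lowVars, Finset.sum_product_right]

/-- The genus zero open Virasoro constraints. -/
theorem OpenCalibration.coefOnExp_openL [Nontrivial P.base.carrier] (hv : K.IsTop v)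
    (hw : J.IsTop w) (M : ℕ) :
    (J.openL ((M : ℤ) - 1)).coefOnExp (J.exponent v w) (-1) = 0 := by
  have h := ((((((J.hasCoef_L₁ ((M : ℤ) - 1)).add (J.hasCoef_L₂ hw (v := v) ((M : ℤ) - 1))).add
    (J.hasCoef_L₃ hw M)).add (J.hasCoef_L₄ ((M : ℤ) - 1))).add
    (J.hasCoef_Lo₁ ((M : ℤ) - 1))).add ((J.hasCoef_Lo₂ hw ((M : ℤ) - 1)).add
    (J.hasCoef_Lo₃ ((M : ℤ) - 1)))).add ((J.hasCoef_Lo₄ hw M).add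
    (J.hasCoef_Lo₅ ((M : ℤ) - 1))) |>.add (J.hasCoef_Lo₆ hw M)
  refine h.2.trans ?_
  have h1 := J.sum_lowVars_loopTerm (v := v) hw M
  rw [J.sum_lowVars_loopTerm_eq hw hv] at h1
  have h2 := congrArg (shiftedSum J.Ωt (.inl 0)) (funext fun j => J.sum_firstOrderTerm hw M j)
  simp only [Fintype.sum_sum_type, Fintype.sum_unique, shiftedSum_add] at h2
  have h3 : shiftedSum J.Ωt (.inl 0) (fun j => substHom hw.1
      ((rowOp X.μt J.Rtsum)^[M] (J.rowSeq (.inr ())) j.2 j.1)) +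
      shiftedSum J.Ωt (.inl 0) (fun j => substHom hw.1
        (∑ d ∈ Finset.range M, ∑ μ, ∑ α, ((-1) ^ (d + 1) * X.η⁻¹ α μ) •
          ((rowOp X.μt J.Rtsum)^[M] (J.rowSeq (.inr ())) (-d - 1) (.inl α) *
            K.twoPointExt d j.2 μ j.1))) = 0 := by
    rw [← shiftedSum_add]
    simp only [← map_add, J.rowOp_iterate_add_loop]
    simp only [map_sum, map_mul, shiftedSum_sum, shiftedSum_mul_left]
    -- What remains is a combination of the Euler-Lagrange expressions of the extended hierarchy.
    refine Finset.sum_eq_zero fun δ _ => ?_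
    rw [← mul_zero (substHom hw.1 (Y.rowCoef M 0 δ))]
    exact congrArg _ (J.isFlat.eulerLagrange_eq_zero hw δ)
  rw [← h2, ← h1] at h3
  simp only [zero_add, add_zero]
  refine Eq.trans ?_ h3
  simp only [default]
  abel

end Constraints

end OpenVirasoro

end

open OpenVirasoro in
theorem theorem3p3 (N : ℕ) [NeZero N] (W : Domain N)
    (X : ConformalFrobenius W.functions.base) (K : Calibration X)
    (Y : OpenPotential W.functions X) (J : OpenCalibration K Y) :
    (∃! v, K.IsTop v) ∧ (∃! w, J.IsTop w) ∧
    ∀ v w, K.IsTop v → J.IsTop w → ∀ m : ℤ, -1 ≤ m →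
      (J.openL m).coefOnExp (J.exponent v w) (-1) = 0 := by
  refine ⟨existsUnique_isTopSolution K.isFlat, existsUnique_isTopSolution J.isFlat,
    fun v w hv hw m hm => ?_⟩
  -- The relation `μ^α + μ^β = 0` needs a non-zero ring; over the zero ring the constraint is
  -- vacuous.
  rcases subsingleton_or_nontrivial W.functions.base.carrier with h | h
  · have h1 : (1 : W.functions.total.carrier) = 0 := by
      rw [← map_one W.functions.pull, Subsingleton.elim (1 : W.functions.base.carrier) 0, map_zero]
    have := subsingleton_of_zero_eq_one h1.symm
    exact MvPowerSeries.ext fun n => Subsingleton.elim _ _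
  -- `M = m + 1` is the number of recursion steps from `P_{-1}` to `P_m`.
  · obtain ⟨M, hM⟩ := Int.eq_ofNat_of_zero_le (a := m + 1) (by omega)
    obtain rfl : m = (M : ℤ) - 1 := by omega
    exact J.coefOnExp_openL hv hw M
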